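/- Let $K$ be a field with $\mathrm{char}\,K\neq 2$, and let $(V,\mathfrak c)$ be a braided vector space over $K$, i.e. $\mathfrak c:V\otimes V\to V\otimes V$ is $K$-linear and satisfies the braid equation $(\mathfrak c\otimes V)(V\otimes\mathfrak c)(\mathfrak c\otimes V)=(V\otimes\mathfrak c)(\mathfrak c\otimes V)(V\otimes\mathfrak c)$. Assume that $\mathfrak c$ is of Hecke type of mark $\lambda\in K$, i.e. $(\mathfrak c+\mathrm{Id})(\mathfrak c-\lambda\,\mathrm{Id})=0$, that $\lambda\neq 0,1$, and that $\lambda$ is regular, i.e. $1+\lambda+\dots+\lambda^{k-1}\neq 0$ for all $k\geq 1$. A braided bialgebra over $K$ is a vector space $A$ with a braiding $\mathfrak c_A$, an associative unital algebra structure $(\nabla,1)$ and a coassociative counital coalgebra structure $(\Delta,\varepsilon)$, all four maps being compatible with $\mathfrak c_A$, such that $\varepsilon:A\to K$ and $\Delta:A\to A\otimes_{\mathfrak c_A}A$ are morphisms of algebras, where the product of $A\otimes_{\mathfrak c_A}A$ is $(\nabla\otimes\nabla)(A\otimes\mathfrak c_A\otimes A)$. An isomorphism of braided bialgebras is a linear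 bijection that respects $\nabla,1,\Delta,\varepsilon$ and the braidings. Let $T(V,\mathfrak c)$ be the tensor algebra with the braided bialgebra structure whose braiding extends $\mathfrak c$ and for which $\Delta(v)=v\otimes 1+1\otimes v$ and $\varepsilon(v)=0$ for $v\in V$. The braided symmetric algebra $S(V,\mathfrak c)$ is the quotient of $T(V,\mathfrak c)$ by the two-sided ideal generated by the elements $\mathfrak c(z)-\lambda z$, $z\in V\otimes V$, with the induced braided bialgebra structure. Let $A$ be a braided bialgebra over $K$ and let $\mathrm{gr}\,A=\bigoplus_{n\ge 0}A_n/A_{n-1}$ be the graded object associated with the coradical filtration $(A_n)_{n\geq 0}$ of $A$ (with $A_{-1}=0$), with the multiplication, unit, comultiplication, counit and braiding induced by those of $A$. If $\mathrm{gr}\,A$ is isomorphic to $S(V,\mathfrak c)$ as a braided bialgebra, then $A$ is isomorphic to $S(V,\mathfrak c)$ as a braided bialgebra. -/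

import Mathlib

open scoped TensorProduct

noncomputable section

namespace Braided

universe u v w

/-! ### Braided vector spaces, Hecke type, regular elements -/

section BraidedSpaces

variable {K : Type u} [Field K] {V : Type v} [AddCommGroup V] [Module K V]

/-- `c ⊗ V`, as an endomorphism of `V ⊗ (V ⊗ V)`. -/
def c₁ (c : V ⊗[K] V →ₗ[K] V ⊗[K] V) : V ⊗[K] (V ⊗[K] V) →ₗ[K] V ⊗[K] (V ⊗[K] V) :=
  (TensorProduct.assoc K V V V).toLinearMap ∘ₗ c.rTensor V ∘ₗ
    (TensorProduct.assoc K V V V).symm.toLinearMap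

/-- `V ⊗ c`, as an endomorphism of `V ⊗ (V ⊗ V)`. -/
def c₂ (c : V ⊗[K] V →ₗ[K] V ⊗[K] V) : V ⊗[K] (V ⊗[K] V) →ₗ[K] V ⊗[K] (V ⊗[K] V) :=
  c.lTensor V

/-- `(V, c)` is a braided vector space: `c` satisfies the braid equation. -/
def IsBraiding (c : V ⊗[K] V →ₗ[K] V ⊗[K] V) : Prop :=
  c₁ c ∘ₗ c₂ c ∘ₗ c₁ c = c₂ c ∘ₗ c₁ c ∘ₗ c₂ c

/-- `c` is of Hecke type of mark `lam`: `(c + Id) (c - lam Id) = 0`. -/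
def IsHecke (c : V ⊗[K] V →ₗ[K] V ⊗[K] V) (lam : K) : Prop :=
  (c + LinearMap.id) ∘ₗ (c - lam • LinearMap.id) = 0

/-- `lam` is regular: it is nonzero and `1 + lam + ⋯ + lam ^ (k - 1) ≠ 0` for all `k ≥ 1`. -/
def IsRegularMark (lam : K) : Prop :=
  lam ≠ 0 ∧ ∀ k : ℕ, 1 ≤ k → ∑ i ∈ Finset.range k, lam ^ i ≠ 0

end BraidedSpaces

/-! ### Braided bialgebras -/

section Bialgebras

/-- `(A, ∇, 1, Δ, ε, c)` is a braided bialgebra, where `(A, ∇, 1)` and `(A, Δ, ε)` are the given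
algebra and coalgebra. -/
structure IsBraidedBialgebra {K : Type u} [Field K] {A : Type w} [Ring A] [Algebra K A]
    [Coalgebra K A] (c : A ⊗[K] A →ₗ[K] A ⊗[K] A) : Prop where
  braid : IsBraiding c
  /-- `c (∇ ⊗ A) = (A ⊗ ∇) (c ⊗ A) (A ⊗ c)` -/
  braid_mul_left : c ∘ₗ (LinearMap.mul' K A).rTensor A ∘ₗ
      (TensorProduct.assoc K A A A).symm.toLinearMap =
    (LinearMap.mul' K A).lTensor A ∘ₗ c₁ c ∘ₗ c₂ c
  /-- `c (A ⊗ ∇) = (∇ ⊗ A) (A ⊗ c) (c ⊗ A)` -/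
  braid_mul_right : c ∘ₗ (LinearMap.mul' K A).lTensor A =
    (LinearMap.mul' K A).rTensor A ∘ₗ (TensorProduct.assoc K A A A).symm.toLinearMap ∘ₗ
      c₂ c ∘ₗ c₁ c
  braid_one_left : ∀ a : A, c (1 ⊗ₜ a) = a ⊗ₜ 1
  braid_one_right : ∀ a : A, c (a ⊗ₜ 1) = 1 ⊗ₜ a
  /-- `(A ⊗ Δ) c = (c ⊗ A) (A ⊗ c) (Δ ⊗ A)` -/
  braid_comul_left : (Coalgebra.comul (R := K) (A := A)).lTensor A ∘ₗ c =
    c₁ c ∘ₗ c₂ c ∘ₗ (TensorProduct.assoc K A A A).toLinearMap ∘ₗ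
      (Coalgebra.comul (R := K) (A := A)).rTensor A
  /-- `(Δ ⊗ A) c = (A ⊗ c) (c ⊗ A) (A ⊗ Δ)` -/
  braid_comul_right : (TensorProduct.assoc K A A A).toLinearMap ∘ₗ
      (Coalgebra.comul (R := K) (A := A)).rTensor A ∘ₗ c =
    c₂ c ∘ₗ c₁ c ∘ₗ (Coalgebra.comul (R := K) (A := A)).lTensor A
  /-- `(ε ⊗ A) c (x ⊗ y) = ε(y) x` -/
  braid_counit_left : ∀ x y : A, TensorProduct.lid K A
    ((Coalgebra.counit (R := K) (A := A)).rTensor A (c (x ⊗ₜ y))) =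
      Coalgebra.counit (R := K) y • x
  /-- `(A ⊗ ε) c (y ⊗ x) = ε(y) x` -/
  braid_counit_right : ∀ x y : A, TensorProduct.rid K A
    ((Coalgebra.counit (R := K) (A := A)).lTensor A (c (y ⊗ₜ x))) =
      Coalgebra.counit (R := K) y • x
  /-- `Δ ∇ = (∇ ⊗ ∇) (A ⊗ c ⊗ A) (Δ ⊗ Δ)` -/
  comul_mul : Coalgebra.comul (R := K) (A := A) ∘ₗ LinearMap.mul' K A =
    TensorProduct.map (LinearMap.mul' K A) (LinearMap.mul' K A) ∘ₗ
      (TensorProduct.assoc K A A (A ⊗[K] A)).symm.toLinearMap ∘ₗ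
      (c₁ c).lTensor A ∘ₗ
      (TensorProduct.assoc K A A (A ⊗[K] A)).toLinearMap ∘ₗ
      TensorProduct.map (Coalgebra.comul (R := K) (A := A)) (Coalgebra.comul (R := K) (A := A))
  comul_one : Coalgebra.comul (R := K) (1 : A) = 1 ⊗ₜ 1
  counit_mul : ∀ x y : A, Coalgebra.counit (R := K) (x * y) =
    Coalgebra.counit (R := K) x * Coalgebra.counit (R := K) y
  counit_one : Coalgebra.counit (R := K) (1 : A) = 1

/-- The structure maps `∇, 1, Δ, ε, c` of a braided bialgebra with underlying vector space `B`. -/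
structure StructureMaps (K : Type u) [Field K] (B : Type w) [AddCommGroup B] [Module K B] where
  mul : B ⊗[K] B →ₗ[K] B
  one : B
  comul : B →ₗ[K] B ⊗[K] B
  counit : B →ₗ[K] K
  braiding : B ⊗[K] B →ₗ[K] B ⊗[K] B

/-- The structure maps of an algebra and coalgebra `A` with a braiding `c`. -/
def structureMaps {K : Type u} [Field K] {A : Type w} [Ring A] [Algebra K A] [Coalgebra K A]
    (c : A ⊗[K] A →ₗ[K] A ⊗[K] A) : StructureMaps K A where
  mul := LinearMap.mul' K A
  one := 1
  comul := Coalgebra.comul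
  counit := Coalgebra.counit
  braiding := c

/-- Isomorphisms of braided bialgebras: linear bijections that are morphisms of algebras, of
coalgebras and of braided vector spaces. -/
structure StructureMaps.Iso {K : Type u} [Field K] {B : Type v} [AddCommGroup B] [Module K B]
    {B' : Type w} [AddCommGroup B'] [Module K B']
    (D : StructureMaps K B) (D' : StructureMaps K B') where
  equiv : B ≃ₗ[K] B'
  map_mul : equiv.toLinearMap ∘ₗ D.mul =
    D'.mul ∘ₗ TensorProduct.map equiv.toLinearMap equiv.toLinearMap
  map_one : equiv D.one = D'.one
  map_comul : TensorProduct.map equiv.toLinearMap equiv.toLinearMap ∘ₗ D.comul =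
    D'.comul ∘ₗ equiv.toLinearMap
  map_counit : D'.counit ∘ₗ equiv.toLinearMap = D.counit
  map_braiding : TensorProduct.map equiv.toLinearMap equiv.toLinearMap ∘ₗ D.braiding =
    D'.braiding ∘ₗ TensorProduct.map equiv.toLinearMap equiv.toLinearMap

end Bialgebras

/-! ### The tensor algebra of a braided vector space -/

section Tensor

variable {K : Type u} [Field K] {V : Type v} [AddCommGroup V] [Module K V]
  (c : V ⊗[K] V →ₗ[K] V ⊗[K] V)

/-- `t ⊗ v ↦ t · c (v ⊗ w)`, linearly in `w`: the strand `v` crosses the letter `w`. -/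
def crossLetter : V →ₗ[K] Module.End K (TensorAlgebra K V ⊗[K] V) :=
  (TensorProduct.curry
    ((LinearMap.mul' K (TensorAlgebra K V)).rTensor V ∘ₗ
      (TensorProduct.assoc K (TensorAlgebra K V) (TensorAlgebra K V) V).symm.toLinearMap ∘ₗ
      ((TensorAlgebra.ι K).rTensor V ∘ₗ c).lTensor (TensorAlgebra K V) ∘ₗ
      (TensorProduct.assoc K (TensorAlgebra K V) V V).toLinearMap)).flip

/-- `t ⊗ v ↦ t · c (v ⊗ s)` for a word `s`: the strand `v` crosses the letters of `s` one after
the other, from left to right. -/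
def crossWord : TensorAlgebra K V →ₐ[K] (Module.End K (TensorAlgebra K V ⊗[K] V))ᵐᵒᵖ :=
  TensorAlgebra.lift K ((MulOpposite.opLinearEquiv K).toLinearMap ∘ₗ crossLetter c)

/-- The braiding `V ⊗ T → T ⊗ V`. It satisfies `c (v ⊗ 1) = 1 ⊗ v`, extends the braiding of `V`,
and `c (V ⊗ ∇) = (∇ ⊗ V) (T ⊗ c) (c ⊗ T)`. -/
def braidVT : V ⊗[K] TensorAlgebra K V →ₗ[K] TensorAlgebra K V ⊗[K] V :=
  TensorProduct.lift (LinearMap.mk₂ K (fun v s => (crossWord c s).unop (1 ⊗ₜ v))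
    (by intros; simp [TensorProduct.tmul_add]) (by intros; simp)
    (by intros; simp) (by intros; simp))

/-- `s ⊗ t ↦ c (v ⊗ s) · t`, linearly in `v`. In `T ⊗_c T` this is left multiplication
by `1 ⊗ v`. -/
def letterAct : V →ₗ[K] Module.End K (TensorAlgebra K V ⊗[K] TensorAlgebra K V) :=
  TensorProduct.curry
    ((LinearMap.mul' K (TensorAlgebra K V) ∘ₗ
        (TensorAlgebra.ι K).rTensor (TensorAlgebra K V)).lTensor (TensorAlgebra K V) ∘ₗ
      (TensorProduct.assoc K (TensorAlgebra K V) V (TensorAlgebra K V)).toLinearMap ∘ₗ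
      (braidVT c).rTensor (TensorAlgebra K V) ∘ₗ
      (TensorProduct.assoc K V (TensorAlgebra K V) (TensorAlgebra K V)).symm.toLinearMap)

/-- `s ⊗ t ↦ c (a ⊗ s) · t` for a word `a`: the letters of `a` cross one after the other, from
right to left. -/
def wordAct : TensorAlgebra K V →ₐ[K]
    Module.End K (TensorAlgebra K V ⊗[K] TensorAlgebra K V) :=
  TensorAlgebra.lift K (letterAct c)

/-- The braiding `c_T` of the tensor algebra, the unique one that extends `c` and makes `T(V)` a
braided algebra. -/
def tensorBraiding : TensorAlgebra K V ⊗[K] TensorAlgebra K V →ₗ[K]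
    TensorAlgebra K V ⊗[K] TensorAlgebra K V :=
  TensorProduct.lift (LinearMap.mk₂ K (fun a s => wordAct c a (s ⊗ₜ 1))
    (by intros; simp) (by intros; simp)
    (by intros; simp [TensorProduct.add_tmul])
    (by intros; rw [← TensorProduct.smul_tmul', map_smul]))

/-- `x ⊗ y ↦ v x ⊗ y`, linearly in `v`. In `T ⊗_c T` this is left multiplication by `v ⊗ 1`. -/
def leftAct : V →ₗ[K] Module.End K (TensorAlgebra K V ⊗[K] TensorAlgebra K V) :=
  LinearMap.rTensorHom (TensorAlgebra K V) ∘ₗ LinearMap.mul K (TensorAlgebra K V) ∘ₗ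
    TensorAlgebra.ι K

/-- Left multiplication by `Δ_T(a)` in `T ⊗_c T`, where `Δ_T(v) = v ⊗ 1 + 1 ⊗ v` for `v ∈ V`. -/
def comulAct : TensorAlgebra K V →ₐ[K]
    Module.End K (TensorAlgebra K V ⊗[K] TensorAlgebra K V) :=
  TensorAlgebra.lift K (leftAct + letterAct c)

/-- The comultiplication `Δ_T : T → T ⊗_c T`, the algebra morphism with
`Δ_T(v) = v ⊗ 1 + 1 ⊗ v` for `v ∈ V`. -/
def tensorComul : TensorAlgebra K V →ₗ[K] TensorAlgebra K V ⊗[K] TensorAlgebra K V :=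
  LinearMap.applyₗ (1 ⊗ₜ 1) ∘ₗ (comulAct c).toLinearMap

/-- The structure maps of `T(V, c)`; the counit is the algebra morphism that vanishes on `V`. -/
def tensorMaps : StructureMaps K (TensorAlgebra K V) where
  mul := LinearMap.mul' K (TensorAlgebra K V)
  one := 1
  comul := tensorComul c
  counit := (TensorAlgebra.algebraMapInv (R := K) (M := V)).toLinearMap
  braiding := tensorBraiding c

end Tensor

/-! ### The braided symmetric algebra -/

section Symmetric

variable {K : Type u} [Field K] {V : Type v} [AddCommGroup V] [Module K V]
  (c : V ⊗[K] V →ₗ[K] V ⊗[K] V) (lam : K)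

/-- The identification of `V ⊗ V` with `T²(V)`. -/
def sq : V ⊗[K] V →ₗ[K] TensorAlgebra K V :=
  LinearMap.mul' K (TensorAlgebra K V) ∘ₗ TensorProduct.map (TensorAlgebra.ι K) (TensorAlgebra.ι K)

/-- The two-sided ideal of `T(V)` generated by the elements `c (z) - lam z`, `z ∈ V ⊗ V`. -/
def symIdeal : Ideal (TensorAlgebra K V) :=
  (TwoSidedIdeal.span (Set.range fun z : V ⊗[K] V => sq (c z) - lam • sq z)).asIdeal

instance : (symIdeal c lam).IsTwoSided := by unfold symIdeal; infer_instance

/-- The algebra underlying the braided symmetric algebra `S(V, c)`. -/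
abbrev BraidedSym : Type (max u v) := TensorAlgebra K V ⧸ symIdeal c lam

/-- The canonical projection `T(V) → S(V, c)`. -/
def symProj : TensorAlgebra K V →ₗ[K] BraidedSym c lam :=
  (Ideal.Quotient.mkₐ K (symIdeal c lam)).toLinearMap

/-! Well-definedness of the structure on the quotient. -/

section crossing

theorem crossLetter_tmul (w v : V) (t : TensorAlgebra K V) :
    crossLetter c w (t ⊗ₜ v) = (LinearMap.mulLeft K t).rTensor V
      ((TensorAlgebra.ι K).rTensor V (c (v ⊗ₜ w))) := by
  simp only [crossLetter, LinearMap.flip_apply, TensorProduct.curry_apply, LinearMap.comp_apply,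
    LinearEquiv.coe_coe, TensorProduct.assoc_tmul, LinearMap.lTensor_tmul]
  induction c (v ⊗ₜ w) with
  | zero => simp
  | add x y hx hy => simp only [map_add, TensorProduct.tmul_add, hx, hy]
  | tmul x y => simp

theorem crossWord_ι (w : V) : (crossWord c (TensorAlgebra.ι K w)).unop = crossLetter c w := by
  simp [crossWord]

theorem crossWord_mul (a b : TensorAlgebra K V) (x : TensorAlgebra K V ⊗[K] V) :
    (crossWord c (a * b)).unop x = (crossWord c b).unop ((crossWord c a).unop x) := by
  simp

theorem braidVT_tmul (v : V) (s : TensorAlgebra K V) :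
    braidVT c (v ⊗ₜ s) = (crossWord c s).unop (1 ⊗ₜ v) := by
  simp [braidVT]

theorem crossWord_tmul (s t : TensorAlgebra K V) (v : V) :
    (crossWord c s).unop (t ⊗ₜ v) = (LinearMap.mulLeft K t).rTensor V (braidVT c (v ⊗ₜ s)) := by
  have key : ∀ t y, (crossWord c s).unop ((LinearMap.mulLeft K t).rTensor V y) =
      (LinearMap.mulLeft K t).rTensor V ((crossWord c s).unop y) := by
    induction s using TensorAlgebra.induction with
    | algebraMap r => intro t y; simp [Algebra.algebraMap_eq_smul_one]
    | ι w =>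
      intro t y
      rw [crossWord_ι]
      induction y with
      | zero => simp
      | add x y hx hy => simp only [map_add, hx, hy]
      | tmul x y =>
        rw [LinearMap.rTensor_tmul, crossLetter_tmul, crossLetter_tmul, LinearMap.mulLeft_apply,
          LinearMap.mulLeft_mul, LinearMap.rTensor_comp, LinearMap.comp_apply]
    | mul a b ha hb => intro t y; rw [crossWord_mul, crossWord_mul, ha, hb]
    | add a b ha hb => intro t y; simp [ha, hb]
  rw [braidVT_tmul, ← key]
  simp

theorem braidVT_one (v : V) : braidVT c (v ⊗ₜ 1) = 1 ⊗ₜ v := by simp [braidVT_tmul]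

theorem braidVT_ι (v w : V) : braidVT c (v ⊗ₜ TensorAlgebra.ι K w) =
    (TensorAlgebra.ι K).rTensor V (c (v ⊗ₜ w)) := by
  rw [braidVT_tmul, crossWord_ι, crossLetter_tmul, LinearMap.mulLeft_one]
  simp

theorem letterAct_tmul (v : V) (s t : TensorAlgebra K V) :
    letterAct c v (s ⊗ₜ t) = (LinearMap.mulRight K t ∘ₗ TensorAlgebra.ι K).lTensor _
      (braidVT c (v ⊗ₜ s)) := by
  simp only [letterAct, TensorProduct.curry_apply, LinearMap.comp_apply,
    LinearEquiv.coe_coe, TensorProduct.assoc_symm_tmul, LinearMap.rTensor_tmul]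
  induction braidVT c (v ⊗ₜ s) with
  | zero => simp
  | add x y hx hy => simp only [map_add, TensorProduct.add_tmul, hx, hy]
  | tmul x y => simp

theorem tensorBraiding_tmul (a s : TensorAlgebra K V) :
    tensorBraiding c (a ⊗ₜ s) = wordAct c a (s ⊗ₜ 1) := by
  simp [tensorBraiding]

theorem braidVT_mul (v : V) (a b : TensorAlgebra K V) :
    braidVT c (v ⊗ₜ (a * b)) = (crossWord c b).unop (braidVT c (v ⊗ₜ a)) := by
  rw [braidVT_tmul, crossWord_mul, braidVT_tmul]

/-- `x ⊗ w ↦ c (v ⊗ x) ⊗ w`, linearly in `v`. -/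
def passStrand : V →ₗ[K] TensorAlgebra K V ⊗[K] V →ₗ[K] TensorAlgebra K V ⊗[K] (V ⊗[K] V) :=
  TensorProduct.curry ((TensorProduct.assoc K _ V V).toLinearMap ∘ₗ (braidVT c).rTensor V ∘ₗ
    (TensorProduct.assoc K V _ V).symm.toLinearMap)

theorem passStrand_tmul (v w : V) (x : TensorAlgebra K V) :
    passStrand c v (x ⊗ₜ w) = TensorProduct.assoc K _ V V (braidVT c (v ⊗ₜ x) ⊗ₜ w) := by
  simp [passStrand]

/-- `v ⊗ w ↦ c (v ⊗ w ⊗ s)`: two strands cross the word `s`. -/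
def crossTwo : TensorAlgebra K V →ₗ[K] V ⊗[K] V →ₗ[K] TensorAlgebra K V ⊗[K] (V ⊗[K] V) :=
  LinearMap.flip <| TensorProduct.lift <| LinearMap.mk₂ K
    (fun v w => passStrand c v ∘ₗ braidVT c ∘ₗ TensorProduct.mk K V _ w)
    (by intros; ext; simp) (by intros; ext; simp)
    (by intros; ext; simp) (by intros; ext; simp)

theorem crossTwo_tmul (v w : V) (s : TensorAlgebra K V) :
    crossTwo c s (v ⊗ₜ w) = passStrand c v (braidVT c (w ⊗ₜ s)) := by
  simp [crossTwo]

theorem passStrand_mulLeft (v w : V) (x b : TensorAlgebra K V) :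
    passStrand c v ((LinearMap.mulLeft K x).rTensor V (braidVT c (w ⊗ₜ b))) =
      ((LinearMap.mul' K _).rTensor _ ∘ₗ (TensorProduct.assoc K _ _ _).symm.toLinearMap ∘ₗ
        (crossTwo c b).lTensor _) (TensorProduct.assoc K _ V V (braidVT c (v ⊗ₜ x) ⊗ₜ w)) := by
  have h1 : ∀ q : TensorAlgebra K V ⊗[K] V,
      passStrand c v ((LinearMap.mulLeft K x).rTensor V q) =
      TensorProduct.assoc K _ V V (((LinearMap.applyₗ (braidVT c (v ⊗ₜ x))) ∘ₗ
        ((MulOpposite.opLinearEquiv K).symm.toLinearMap ∘ₗ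
          (crossWord c).toLinearMap)).rTensor V q) := by
    intro q
    induction q with
    | zero => simp
    | add a b ha hb => simp only [map_add, ha, hb]
    | tmul y u => simp [passStrand_tmul, braidVT_mul]
  rw [h1]
  induction braidVT c (v ⊗ₜ x) with
  | zero => simp
  | add p p' hp hp' =>
    rw [TensorProduct.add_tmul, map_add (TensorProduct.assoc K _ V V),
      map_add (_ ∘ₗ _ ∘ₗ _), ← hp, ← hp', ← map_add (TensorProduct.assoc K _ V V), map_add, LinearMap.add_comp, LinearMap.rTensor_add,
      LinearMap.add_apply]
  | tmul y u =>
    simp only [LinearMap.comp_apply, LinearEquiv.coe_coe, TensorProduct.assoc_tmul,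
      LinearMap.lTensor_tmul, crossTwo_tmul]
    induction braidVT c (w ⊗ₜ b) with
    | zero => simp
    | add p p' hp hp' => simp only [map_add, TensorProduct.tmul_add, hp, hp']
    | tmul z t =>
      simp only [passStrand_tmul, LinearMap.rTensor_tmul, LinearMap.comp_apply,
        AlgHom.toLinearMap_apply, LinearEquiv.coe_coe, LinearMap.applyₗ_apply_apply,
        MulOpposite.coe_opLinearEquiv_symm, crossWord_tmul]
      induction braidVT c (u ⊗ₜ z) with
      | zero => simp
      | add p p' hp hp' =>
        simp only [map_add, TensorProduct.add_tmul, TensorProduct.tmul_add, hp, hp']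
      | tmul z' t' => simp

theorem crossTwo_mul (a b : TensorAlgebra K V) (z : V ⊗[K] V) :
    crossTwo c (a * b) z = ((LinearMap.mul' K _).rTensor _ ∘ₗ
      (TensorProduct.assoc K _ _ _).symm.toLinearMap ∘ₗ (crossTwo c b).lTensor _)
        (crossTwo c a z) := by
  induction z with
  | zero => simp
  | add x y hx hy => simp only [map_add, hx, hy]
  | tmul v w =>
    rw [crossTwo_tmul, crossTwo_tmul, braidVT_mul]
    induction braidVT c (w ⊗ₜ a) with
    | zero => simp
    | add x y hx hy => simp only [map_add, hx, hy]
    | tmul x w' => rw [crossWord_tmul, passStrand_mulLeft, passStrand_tmul]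

variable {c}

theorem crossTwo_ι (u : V) (z : V ⊗[K] V) : crossTwo c (TensorAlgebra.ι K u) z =
    (TensorAlgebra.ι K).rTensor _ (c₁ c (c₂ c (TensorProduct.assoc K V V V (z ⊗ₜ u)))) := by
  induction z with
  | zero => simp
  | add x y hx hy => simp only [map_add, TensorProduct.add_tmul, hx, hy]
  | tmul v w =>
    rw [crossTwo_tmul, braidVT_ι]
    simp only [c₂, TensorProduct.assoc_tmul, LinearMap.lTensor_tmul]
    induction c (w ⊗ₜ u) with
    | zero => simp
    | add x y hx hy => simp only [map_add, TensorProduct.tmul_add, hx, hy]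
    | tmul x w' =>
      simp only [LinearMap.rTensor_tmul, passStrand_tmul, braidVT_ι, c₁, LinearMap.comp_apply,
        LinearEquiv.coe_coe, TensorProduct.assoc_symm_tmul]
      induction c (v ⊗ₜ x) with
      | zero => simp
      | add x y hx hy => simp only [map_add, TensorProduct.add_tmul, hx, hy]
      | tmul x w' => simp

theorem crossTwo_braid (hc : IsBraiding c) (s : TensorAlgebra K V) (z : V ⊗[K] V) :
    crossTwo c s (c z) = c.lTensor _ (crossTwo c s z) := by
  induction s using TensorAlgebra.induction generalizing z with
  | algebraMap r =>
    have h : ∀ z : V ⊗[K] V, crossTwo c 1 z = 1 ⊗ₜ z := by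
      intro z
      induction z with
      | zero => simp
      | add x y hx hy => simp only [map_add, TensorProduct.tmul_add, hx, hy]
      | tmul v w => simp [crossTwo_tmul, braidVT_one, passStrand_tmul]
    simp [Algebra.algebraMap_eq_smul_one, h]
  | ι u =>
    have h : TensorProduct.assoc K V V V (c z ⊗ₜ u) =
        c₁ c (TensorProduct.assoc K V V V (z ⊗ₜ u)) := by simp [c₁]
    have h2 := LinearMap.congr_fun hc (TensorProduct.assoc K V V V (z ⊗ₜ u))
    simp only [LinearMap.comp_apply] at h2
    rw [crossTwo_ι, crossTwo_ι, h, h2]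
    conv_lhs => rw [c₂]
    rw [← LinearMap.comp_apply, LinearMap.rTensor_comp_lTensor, ← LinearMap.lTensor_comp_rTensor,
      LinearMap.comp_apply]
    rfl
  | mul a b ha hb =>
    rw [crossTwo_mul, ha, crossTwo_mul]
    induction crossTwo c a z with
    | zero => simp
    | add x y hx hy => simp only [map_add, hx, hy]
    | tmul t y =>
      simp only [LinearMap.comp_apply, LinearMap.lTensor_tmul, hb, LinearEquiv.coe_coe]
      induction crossTwo c b y with
      | zero => simp
      | add x y hx hy => simp only [map_add, TensorProduct.tmul_add, hx, hy]
      | tmul t y => simp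
  | add a b ha hb => simp only [map_add, LinearMap.add_apply, ha, hb]


variable {lam}

theorem wordAct_sq (z : V ⊗[K] V) (s t : TensorAlgebra K V) : wordAct c (sq z) (s ⊗ₜ t) =
    (LinearMap.mulRight K t ∘ₗ sq).lTensor _ (crossTwo c s z) := by
  induction z with
  | zero => simp
  | add x y hx hy => simp only [map_add, LinearMap.add_apply, hx, hy]
  | tmul v w =>
    simp only [sq, LinearMap.comp_apply, TensorProduct.map_tmul, LinearMap.mul'_apply, map_mul,
      wordAct, TensorAlgebra.lift_ι_apply, Module.End.mul_apply, crossTwo_tmul]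
    rw [letterAct_tmul]
    induction braidVT c (w ⊗ₜ s) with
    | zero => simp
    | add x y hx hy => simp only [map_add, hx, hy]
    | tmul x w' =>
      simp only [LinearMap.lTensor_tmul, letterAct_tmul, passStrand_tmul]
      induction braidVT c (v ⊗ₜ x) with
      | zero => simp
      | add x y hx hy => simp only [map_add, TensorProduct.add_tmul, hx, hy]
      | tmul y u => simp [mul_assoc]

theorem braidVT_sq (v : V) (z : V ⊗[K] V) : braidVT c (v ⊗ₜ sq z) =
    sq.rTensor V ((TensorProduct.assoc K V V V).symm (c₂ c (c₁ c (v ⊗ₜ z)))) := by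
  induction z with
  | zero => simp
  | add x y hx hy => simp only [map_add, TensorProduct.tmul_add, hx, hy]
  | tmul w w' =>
    simp only [sq, LinearMap.comp_apply, TensorProduct.map_tmul, LinearMap.mul'_apply,
      braidVT_mul, braidVT_ι, c₁, LinearEquiv.coe_coe, TensorProduct.assoc_symm_tmul,
      LinearMap.rTensor_tmul]
    induction c (v ⊗ₜ w) with
    | zero => simp
    | add x y hx hy => simp only [map_add, TensorProduct.add_tmul, hx, hy]
    | tmul x u =>
      simp only [LinearMap.rTensor_tmul, crossWord_tmul, braidVT_ι, c₂, TensorProduct.assoc_tmul,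
        LinearMap.lTensor_tmul]
      induction c (u ⊗ₜ w') with
      | zero => simp
      | add x y hx hy => simp only [map_add, TensorProduct.tmul_add, hx, hy]
      | tmul y u' => simp

variable (c lam)

/-- The defining relation `z ↦ c (z) - lam z`. -/
def symRel : V ⊗[K] V →ₗ[K] TensorAlgebra K V := sq ∘ₗ c - lam • sq

theorem symRel_mem (z : V ⊗[K] V) : symRel c lam z ∈ symIdeal c lam :=
  TwoSidedIdeal.mem_asIdeal.2 (TwoSidedIdeal.subset_span ⟨z, rfl⟩)

theorem symIdeal_induction {p : TensorAlgebra K V → Prop} (mem : ∀ z, p (symRel c lam z))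
    (zero : p 0) (add : ∀ x y, p x → p y → p (x + y)) (neg : ∀ x, p x → p (-x))
    (left : ∀ a x, x ∈ symIdeal c lam → p x → p (a * x))
    (right : ∀ b x, x ∈ symIdeal c lam → p x → p (x * b))
    {x : TensorAlgebra K V} (hx : x ∈ symIdeal c lam) : p x := by
  refine TwoSidedIdeal.span_induction (p := fun x _ => p x) ?_ zero (fun x y _ _ => add x y)
    (fun x _ => neg x) (fun a x hx => left a x (TwoSidedIdeal.mem_asIdeal.2 hx))
    (fun b x hx => right b x (TwoSidedIdeal.mem_asIdeal.2 hx)) (TwoSidedIdeal.mem_asIdeal.1 hx)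
  rintro _ ⟨z, rfl⟩
  exact mem z

/-- The image of `I ⊗ W` in `T ⊗ W`. -/
def idealLeft (W : Type*) [AddCommGroup W] [Module K W] : Submodule K (TensorAlgebra K V ⊗[K] W) :=
  LinearMap.range (((symIdeal c lam).restrictScalars K).subtype.rTensor W)

/-- The image of `T ⊗ I` in `T ⊗ T`. -/
def idealRight : Submodule K (TensorAlgebra K V ⊗[K] TensorAlgebra K V) :=
  LinearMap.range (((symIdeal c lam).restrictScalars K).subtype.lTensor (TensorAlgebra K V))

variable {c lam}

theorem tmul_mem_idealLeft {W : Type*} [AddCommGroup W] [Module K W] {x : TensorAlgebra K V}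
    (hx : x ∈ symIdeal c lam) (w : W) : x ⊗ₜ[K] w ∈ idealLeft c lam W :=
  ⟨(⟨x, hx⟩ : (symIdeal c lam).restrictScalars K) ⊗ₜ w, by simp⟩

theorem tmul_mem_idealRight {x : TensorAlgebra K V}
    (hx : x ∈ symIdeal c lam) (s : TensorAlgebra K V) : s ⊗ₜ[K] x ∈ idealRight c lam :=
  ⟨s ⊗ₜ (⟨x, hx⟩ : (symIdeal c lam).restrictScalars K), by simp⟩

theorem idealLeft_le {W : Type*} [AddCommGroup W] [Module K W]
    {N : Submodule K (TensorAlgebra K V ⊗[K] W)}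
    (h : ∀ x ∈ symIdeal c lam, ∀ w : W, x ⊗ₜ w ∈ N) : idealLeft c lam W ≤ N := by
  rintro _ ⟨y, rfl⟩
  induction y with
  | zero => simp
  | add x y hx hy => rw [map_add]; exact N.add_mem hx hy
  | tmul x w => simpa using h x.1 x.2 w

theorem idealRight_le {N : Submodule K (TensorAlgebra K V ⊗[K] TensorAlgebra K V)}
    (h : ∀ x ∈ symIdeal c lam, ∀ s : TensorAlgebra K V, s ⊗ₜ x ∈ N) : idealRight c lam ≤ N := by
  rintro _ ⟨y, rfl⟩
  induction y with
  | zero => simp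
  | add x y hx hy => rw [map_add]; exact N.add_mem hx hy
  | tmul s x => simpa using h x.1 x.2 s

theorem map_mem_of_tmul {M M' M'' : Type*} [AddCommGroup M] [Module K M] [AddCommGroup M']
    [Module K M'] [AddCommGroup M''] [Module K M''] (f : M ⊗[K] M' →ₗ[K] M'')
    (N : Submodule K M'') (h : ∀ x y, f (x ⊗ₜ y) ∈ N) (z : M ⊗[K] M') : f z ∈ N := by
  induction z with
  | zero => simp
  | add x y hx hy => rw [map_add]; exact N.add_mem hx hy
  | tmul x y => exact h x y

theorem braidVT_mem (hc : IsBraiding c) {x : TensorAlgebra K V} (hx : x ∈ symIdeal c lam) :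
    ∀ v : V, braidVT c (v ⊗ₜ x) ∈ idealLeft c lam V := by
  refine symIdeal_induction c lam (p := fun x => ∀ v : V, braidVT c (v ⊗ₜ x) ∈ idealLeft c lam V)
    ?_ ?_ ?_ ?_ ?_ ?_ hx
  · intro z v
    have h1 : v ⊗ₜ c z = c₂ c (v ⊗ₜ z) := by simp [c₂]
    have h2 := LinearMap.congr_fun hc (v ⊗ₜ z)
    simp only [LinearMap.comp_apply] at h2
    have h3 : braidVT c (v ⊗ₜ symRel c lam z) = (symRel c lam).rTensor V
        ((TensorProduct.assoc K V V V).symm (c₂ c (c₁ c (v ⊗ₜ z)))) := by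
      simp only [symRel, LinearMap.sub_apply, LinearMap.comp_apply, LinearMap.smul_apply,
        TensorProduct.tmul_sub, map_sub, TensorProduct.tmul_smul, map_smul, braidVT_sq, h1, ← h2,
        LinearMap.rTensor_sub, LinearMap.rTensor_smul, LinearMap.rTensor_comp]
      conv_lhs => rw [c₁]
      simp [c₁]
    rw [h3]
    exact map_mem_of_tmul _ _ (fun z w => tmul_mem_idealLeft (symRel_mem c lam z) w) _
  · intro v; simp
  · intro x y hx hy v
    rw [TensorProduct.tmul_add, map_add]
    exact Submodule.add_mem _ (hx v) (hy v)
  · intro x hx v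
    rw [TensorProduct.tmul_neg, map_neg]
    exact Submodule.neg_mem _ (hx v)
  · intro a x _ h v
    rw [braidVT_mul]
    refine map_mem_of_tmul _ _ (fun y w => ?_) _
    rw [crossWord_tmul]
    refine (idealLeft_le (N := (idealLeft c lam V).comap
      ((LinearMap.mulLeft K y).rTensor V)) ?_) (h w)
    intro x hx w
    exact tmul_mem_idealLeft (Ideal.mul_mem_left _ _ hx) w
  · intro b x _ h v
    rw [braidVT_mul]
    refine (idealLeft_le (N := (idealLeft c lam V).comap (crossWord c b).unop) ?_) (h v)
    intro x hx w
    rw [Submodule.mem_comap, crossWord_tmul]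
    exact map_mem_of_tmul _ _
      (fun y u => tmul_mem_idealLeft (Ideal.mul_mem_right _ _ hx) u) _

theorem letterAct_mem_left (hc : IsBraiding c) (v : V) :
    idealLeft c lam _ ≤ (idealLeft c lam (TensorAlgebra K V)).comap (letterAct c v) := by
  refine idealLeft_le fun x hx t => ?_
  rw [Submodule.mem_comap, letterAct_tmul]
  refine (idealLeft_le (N := (idealLeft c lam _).comap
    ((LinearMap.mulRight K t ∘ₗ TensorAlgebra.ι K).lTensor _)) ?_) (braidVT_mem hc hx v)
  intro x hx w
  exact tmul_mem_idealLeft hx _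

theorem letterAct_mem_right (v : V) :
    idealRight c lam ≤ (idealRight c lam).comap (letterAct c v) := by
  refine idealRight_le fun x hx s => ?_
  rw [Submodule.mem_comap, letterAct_tmul]
  exact map_mem_of_tmul _ _ (fun y w => tmul_mem_idealRight (Ideal.mul_mem_left _ _ hx) y) _

theorem lift_mem (f : V →ₗ[K] Module.End K (TensorAlgebra K V ⊗[K] TensorAlgebra K V))
    (N : Submodule K (TensorAlgebra K V ⊗[K] TensorAlgebra K V))
    (h : ∀ v, N ≤ N.comap (f v)) (a : TensorAlgebra K V) :
    N ≤ N.comap (TensorAlgebra.lift K f a) := by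
  intro y hy
  rw [Submodule.mem_comap]
  induction a using TensorAlgebra.induction generalizing y with
  | algebraMap r => simpa using N.smul_mem r hy
  | ι v => simpa using h v hy
  | mul a b ha hb => rw [map_mul]; exact ha (hb hy)
  | add a b ha hb => rw [map_add]; exact N.add_mem (ha hy) (hb hy)

theorem wordAct_mem (hc : IsBraiding c) {x : TensorAlgebra K V} (hx : x ∈ symIdeal c lam) :
    ∀ y, wordAct c x y ∈ idealRight c lam := by
  refine symIdeal_induction c lam (p := fun x => ∀ y, wordAct c x y ∈ idealRight c lam)
    ?_ ?_ ?_ ?_ ?_ ?_ hx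
  · intro z y
    refine map_mem_of_tmul _ _ (fun s t => ?_) y
    have h : wordAct c (symRel c lam z) (s ⊗ₜ t) =
        (LinearMap.mulRight K t ∘ₗ symRel c lam).lTensor _ (crossTwo c s z) := by
      simp only [symRel, LinearMap.sub_apply, LinearMap.comp_apply, LinearMap.smul_apply, map_sub,
        map_smul, wordAct_sq, crossTwo_braid hc, LinearMap.comp_sub, LinearMap.comp_smul,
        LinearMap.lTensor_sub, LinearMap.lTensor_smul, LinearMap.lTensor_comp]
    rw [h]
    exact map_mem_of_tmul _ _ (fun y w =>
      tmul_mem_idealRight (Ideal.mul_mem_right _ _ (symRel_mem c lam w)) y) _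
  · intro y; simp
  · intro x y hx hy z
    rw [map_add]
    exact Submodule.add_mem _ (hx z) (hy z)
  · intro x hx y
    rw [map_neg]
    exact Submodule.neg_mem _ (hx y)
  · intro a x _ h y
    rw [map_mul]
    exact lift_mem _ _ letterAct_mem_right a (h y)
  · intro b x _ h y
    rw [map_mul]
    exact h _

theorem leftAct_apply (v : V) (y : TensorAlgebra K V ⊗[K] TensorAlgebra K V) :
    leftAct v y = (LinearMap.mulLeft K (TensorAlgebra.ι K v)).rTensor _ y := rfl

/-- `v ⊗ w ↦ (v ⊗ 1) (1 ⊗ w)` as an operator on `T ⊗_c T`. -/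
def crossAct (c : V ⊗[K] V →ₗ[K] V ⊗[K] V) :
    V ⊗[K] V →ₗ[K] Module.End K (TensorAlgebra K V ⊗[K] TensorAlgebra K V) :=
  TensorProduct.lift ((LinearMap.mul K _).compl₁₂ leftAct (letterAct c))

theorem letterAct_leftAct (v w : V) (y : TensorAlgebra K V ⊗[K] TensorAlgebra K V) :
    letterAct c v (leftAct w y) = crossAct c (c (v ⊗ₜ w)) y := by
  induction y with
  | zero => simp
  | add x y hx hy => simp only [map_add, hx, hy]
  | tmul s t =>
    rw [leftAct_apply, LinearMap.rTensor_tmul, letterAct_tmul, LinearMap.mulLeft_apply,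
      braidVT_mul, braidVT_ι]
    induction c (v ⊗ₜ w) with
    | zero => simp
    | add x y hx hy => simp only [map_add, LinearMap.add_apply, hx, hy]
    | tmul x u =>
      simp only [LinearMap.rTensor_tmul, crossWord_tmul, crossAct, TensorProduct.lift.tmul,
        LinearMap.compl₁₂_apply, LinearMap.mul_apply', Module.End.mul_apply, letterAct_tmul,
        leftAct_apply]
      induction braidVT c (u ⊗ₜ s) with
      | zero => simp
      | add x y hx hy => simp only [map_add, hx, hy]
      | tmul y u => simp

theorem comulAct_sq (z : V ⊗[K] V) (y : TensorAlgebra K V ⊗[K] TensorAlgebra K V) :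
    comulAct c (sq z) y = (LinearMap.mulLeft K (sq z)).rTensor _ y + wordAct c (sq z) y +
      crossAct c (z + c z) y := by
  induction z with
  | zero => simp
  | add x y hx hy =>
    have h : LinearMap.mulLeft K (sq x + sq y) = LinearMap.mulLeft K (sq x) +
        LinearMap.mulLeft K (sq y) := by ext; simp [add_mul]
    simp only [map_add, LinearMap.add_apply, hx, hy, h, LinearMap.rTensor_add]
    abel
  | tmul v w =>
    have h : sq (v ⊗ₜ[K] w) = TensorAlgebra.ι K v * TensorAlgebra.ι K w := by simp [sq]
    simp only [h, map_mul, comulAct, wordAct, TensorAlgebra.lift_ι_apply, Module.End.mul_apply,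
      LinearMap.add_apply, map_add, letterAct_leftAct, LinearMap.mulLeft_mul,
      LinearMap.rTensor_comp, LinearMap.comp_apply]
    simp only [leftAct_apply, crossAct, TensorProduct.lift.tmul, LinearMap.compl₁₂_apply,
      LinearMap.mul_apply', Module.End.mul_apply]
    abel

theorem comulAct_mem (hc : IsBraiding c) (hH : IsHecke c lam) {x : TensorAlgebra K V}
    (hx : x ∈ symIdeal c lam) :
    ∀ y, comulAct c x y ∈ idealRight c lam ⊔ idealLeft c lam (TensorAlgebra K V) := by
  refine symIdeal_induction c lam (p := fun x => ∀ y, comulAct c x y ∈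
    idealRight c lam ⊔ idealLeft c lam (TensorAlgebra K V)) ?_ ?_ ?_ ?_ ?_ ?_ hx
  · intro z y
    have hz : c (c z) + c z - lam • c z - lam • z = 0 := by
      have := LinearMap.congr_fun hH z
      simp only [LinearMap.comp_apply, LinearMap.add_apply, LinearMap.sub_apply,
        LinearMap.smul_apply, LinearMap.id_apply, LinearMap.zero_apply, map_sub, map_smul] at this
      rw [← this, smul_add]; abel
    have h : comulAct c (symRel c lam z) y =
        wordAct c (symRel c lam z) y + (LinearMap.mulLeft K (symRel c lam z)).rTensor _ y := by
      have h0 : crossAct c (c z + c (c z)) y - lam • crossAct c (z + c z) y = 0 := by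
        rw [← LinearMap.smul_apply, ← map_smul, ← LinearMap.sub_apply,
          ← map_sub (crossAct c)]
        have : c z + c (c z) - lam • (z + c z) = 0 := by
          rw [← hz, smul_add]; abel
        rw [this]; simp
      have hL : (LinearMap.mulLeft K (symRel c lam z)).rTensor (TensorAlgebra K V) y =
          (LinearMap.mulLeft K (sq (c z))).rTensor _ y -
            lam • (LinearMap.mulLeft K (sq z)).rTensor _ y := by
        rw [← LinearMap.smul_apply, ← LinearMap.rTensor_smul, ← LinearMap.sub_apply,
          ← LinearMap.rTensor_sub]
        congr 2
        ext t
        simp [symRel, sub_mul]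
      rw [hL]
      simp only [symRel, LinearMap.sub_apply, LinearMap.comp_apply, LinearMap.smul_apply, map_sub,
        map_smul, comulAct_sq, smul_add]
      rw [← sub_eq_zero, ← h0]
      abel
    rw [h]
    refine Submodule.add_mem_sup (wordAct_mem hc (symRel_mem c lam z) y) ?_
    exact map_mem_of_tmul _ _ (fun s t =>
      tmul_mem_idealLeft (Ideal.mul_mem_right _ _ (symRel_mem c lam z)) t) y
  · intro y; simp
  · intro x y hx hy z
    rw [map_add]
    exact Submodule.add_mem _ (hx z) (hy z)
  · intro x hx y
    rw [map_neg]
    exact Submodule.neg_mem _ (hx y)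
  · intro a x _ h y
    rw [map_mul]
    refine lift_mem (leftAct + letterAct c)
      (idealRight c lam ⊔ idealLeft c lam (TensorAlgebra K V)) (fun v => ?_) a (h y)
    refine sup_le ?_ ?_
    · intro y hy
      rw [Submodule.mem_comap, LinearMap.add_apply, LinearMap.add_apply]
      refine Submodule.add_mem _ ?_ (Submodule.mem_sup_left (letterAct_mem_right v hy))
      refine Submodule.mem_sup_left (idealRight_le (N := (idealRight c lam).comap (leftAct v))
        (fun x hx s => ?_) hy)
      exact tmul_mem_idealRight hx _
    · intro y hy
      rw [Submodule.mem_comap, LinearMap.add_apply, LinearMap.add_apply]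
      refine Submodule.add_mem _ ?_ (Submodule.mem_sup_right (letterAct_mem_left hc v hy))
      refine Submodule.mem_sup_right (idealLeft_le
        (N := (idealLeft c lam (TensorAlgebra K V)).comap (leftAct v)) (fun x hx s => ?_) hy)
      exact tmul_mem_idealLeft (Ideal.mul_mem_left _ _ hx) _
  · intro b x _ h y
    rw [map_mul]
    exact h _

theorem ker_symProj : LinearMap.ker (symProj c lam) = (symIdeal c lam).restrictScalars K := by
  ext x
  simp [symProj, Ideal.Quotient.eq_zero_iff_mem]

theorem symProj_surjective : Function.Surjective (symProj c lam) :=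
  Ideal.Quotient.mk_surjective

theorem ker_map_symProj : LinearMap.ker (TensorProduct.map (symProj c lam) (symProj c lam)) =
    idealRight c lam ⊔ idealLeft c lam (TensorAlgebra K V) := by
  have h : Function.Exact ((symIdeal c lam).restrictScalars K).subtype (symProj c lam) := by
    rw [LinearMap.exact_iff, ker_symProj, Submodule.range_subtype]
  exact TensorProduct.map_ker h symProj_surjective h symProj_surjective

theorem tensorComul_mem (hc : IsBraiding c) (hH : IsHecke c lam) :
    LinearMap.ker (symProj c lam) ≤
      LinearMap.ker (TensorProduct.map (symProj c lam) (symProj c lam) ∘ₗ tensorComul c) := by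
  intro x hx
  rw [ker_symProj] at hx
  rw [LinearMap.ker_comp, ker_map_symProj]
  exact comulAct_mem hc hH hx _

theorem tensorBraiding_mem (hc : IsBraiding c) :
    LinearMap.ker (TensorProduct.map (symProj c lam) (symProj c lam)) ≤
      LinearMap.ker (TensorProduct.map (symProj c lam) (symProj c lam) ∘ₗ tensorBraiding c) := by
  rw [LinearMap.ker_comp, ker_map_symProj]
  refine sup_le (idealRight_le fun x hx s => ?_) (idealLeft_le fun x hx s => ?_)
  · rw [Submodule.mem_comap, tensorBraiding_tmul]
    exact Submodule.mem_sup_right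
      (lift_mem _ _ (letterAct_mem_left hc) s (tmul_mem_idealLeft hx 1))
  · rw [Submodule.mem_comap, tensorBraiding_tmul]
    exact Submodule.mem_sup_left (wordAct_mem hc hx _)

theorem counit_mem : LinearMap.ker (symProj c lam) ≤
    LinearMap.ker (TensorAlgebra.algebraMapInv (R := K) (M := V)).toLinearMap := by
  intro x hx
  rw [ker_symProj] at hx
  have h : ∀ z : V ⊗[K] V, TensorAlgebra.algebraMapInv (R := K) (sq z) = 0 := by
    intro z
    induction z with
    | zero => simp
    | add x y hx hy => simp only [map_add, hx, hy, add_zero]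
    | tmul v w => simp [sq, TensorAlgebra.algebraMapInv]
  refine symIdeal_induction c lam
    (p := fun x => TensorAlgebra.algebraMapInv (R := K) (M := V) x = 0) ?_ ?_ ?_ ?_ ?_ ?_ hx
  · intro z; simp [symRel, h]
  · simp
  · intro x y hx hy; simp [hx, hy]
  · intro x hx; simp [hx]
  · intro a x _ hx; simp [hx]
  · intro a x _ hx; simp [hx]

/-- The map induced by `f` on the target of a surjection `p` whose kernel `f` kills. -/
def descend {M M' N : Type*} [AddCommGroup M] [Module K M] [AddCommGroup M'] [Module K M']
    [AddCommGroup N] [Module K N] (p : M →ₗ[K] M') (hp : Function.Surjective p) (f : M →ₗ[K] N)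
    (h : LinearMap.ker p ≤ LinearMap.ker f) : M' →ₗ[K] N :=
  (LinearMap.ker p).liftQ f h ∘ₗ (p.quotKerEquivOfSurjective hp).symm.toLinearMap

theorem descend_apply {M M' N : Type*} [AddCommGroup M] [Module K M] [AddCommGroup M']
    [Module K M'] [AddCommGroup N] [Module K N] (p : M →ₗ[K] M') (hp : Function.Surjective p)
    (f : M →ₗ[K] N) (h : LinearMap.ker p ≤ LinearMap.ker f) (x : M) :
    descend p hp f h (p x) = f x := by
  have : (p.quotKerEquivOfSurjective hp).symm (p x) = Submodule.Quotient.mk x := by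
    rw [LinearEquiv.symm_apply_eq]; rfl
  simp [descend, this]

/-- The braided symmetric algebra `S(V, c)`: the braided bialgebra structure on the quotient
`T(V) / (c (z) - lam z)` induced by that of `T(V, c)`. -/
def symMaps (hc : IsBraiding c) (hH : IsHecke c lam) : StructureMaps K (BraidedSym c lam) where
  mul := LinearMap.mul' K (BraidedSym c lam)
  one := 1
  comul := descend (symProj c lam) symProj_surjective
    (TensorProduct.map (symProj c lam) (symProj c lam) ∘ₗ (tensorMaps c).comul)
    (tensorComul_mem hc hH)
  counit := descend (symProj c lam) symProj_surjective (tensorMaps c).counit counit_mem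
  braiding := descend (TensorProduct.map (symProj c lam) (symProj c lam))
    (TensorProduct.map_surjective symProj_surjective symProj_surjective)
    (TensorProduct.map (symProj c lam) (symProj c lam) ∘ₗ (tensorMaps c).braiding)
    (tensorBraiding_mem hc)


end crossing

end Symmetric

/-! ### The coradical filtration and the associated graded braided bialgebra -/

section Graded

open scoped DirectSum

section Coradical

variable (K : Type u) [Field K] {A : Type w} [AddCommGroup A] [Module K A] [Coalgebra K A]

/-- `D` is a subcoalgebra: `Δ(D) ⊆ D ⊗ D`. -/
def IsSubcoalgebra (D : Submodule K A) : Prop :=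
  ∀ x ∈ D, Coalgebra.comul (R := K) x ∈ LinearMap.range (TensorProduct.map D.subtype D.subtype)

/-- `D` is a simple subcoalgebra. -/
def IsSimpleSubcoalgebra (D : Submodule K A) : Prop :=
  IsSubcoalgebra K D ∧ D ≠ ⊥ ∧ ∀ E ≤ D, IsSubcoalgebra K E → E = ⊥ ∨ E = D

variable (A)

/-- The coradical filtration: `A_0` is the coradical, the sum of all simple subcoalgebras, and
`A_{n+1} = Δ⁻¹(A ⊗ A_n + A_0 ⊗ A)`. -/
def coradFil : ℕ → Submodule K A
  | 0 => sSup {D | IsSimpleSubcoalgebra K D}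
  | n + 1 => (LinearMap.range ((coradFil n).subtype.lTensor A) ⊔
      LinearMap.range ((coradFil 0).subtype.rTensor A)).comap (Coalgebra.comul (R := K))

/-- The preceding term `A_{n-1}` of the coradical filtration, with `A_{-1} = 0`. -/
def coradPrev : ℕ → Submodule K A
  | 0 => ⊥
  | n + 1 => coradFil K A n

/-- `gr^n A = A_n / A_{n-1}`. -/
abbrev GrPiece (n : ℕ) : Type w :=
  coradFil K A n ⧸ (coradPrev K A n).submoduleOf (coradFil K A n)

/-- `gr A = ⨁ A_n / A_{n-1}`, for the coradical filtration. -/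
abbrev Gr : Type w := ⨁ n, GrPiece K A n

/-- The projection `A_n → A_n / A_{n-1}`. -/
abbrev grQ (n : ℕ) : coradFil K A n →ₗ[K] GrPiece K A n :=
  ((coradPrev K A n).submoduleOf (coradFil K A n)).mkQ

/-- The inclusion `gr^n A → gr A`. -/
abbrev grι (n : ℕ) : GrPiece K A n →ₗ[K] Gr K A := DirectSum.lof K ℕ (GrPiece K A) n

end Coradical

section Induced

variable {K : Type u} [Field K] {M M' X N N' : Type*} [AddCommMonoid M] [Module K M]
  [AddCommMonoid M'] [Module K M'] [AddCommMonoid X] [Module K X]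
  [AddCommMonoid N] [Module K N] [AddCommMonoid N'] [Module K N']
  (p : M →ₗ[K] M') (f : M →ₗ[K] X) (ι : N →ₗ[K] X) (q : N →ₗ[K] N')

/-- `g : M' → N'` is induced by `f : M → X`, where `p : M → M'` is a quotient map, `ι` parametrizes
a subspace of `X` and `q` is a map to a quotient of that subspace: `f` takes its values in this
subspace, and `g (p t)` is the class of `f t`. -/
def IsInduced (g : M' →ₗ[K] N') : Prop := ∀ t, ∃ u, ι u = f t ∧ g (p t) = q u

open Classical in
/-- The linear map induced by `f`; it is zero if `f` does not induce a map. -/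
def induced : M' →ₗ[K] N' := if h : ∃ g, IsInduced p f ι q g then h.choose else 0

/-- If `p` is surjective and the map to the quotient is well defined on the subspace, then the
induced map is the only one. -/
theorem induced_eq {K : Type u} [Field K] {M M' X N N' : Type*}
    [AddCommGroup M] [Module K M] [AddCommGroup M'] [Module K M'] [AddCommGroup X] [Module K X]
    [AddCommGroup N] [Module K N] [AddCommGroup N'] [Module K N']
    {p : M →ₗ[K] M'} {f : M →ₗ[K] X} {ι : N →ₗ[K] X} {q : N →ₗ[K] N'}
    (hp : Function.Surjective p) (hq : LinearMap.ker ι ≤ LinearMap.ker q) {g : M' →ₗ[K] N'}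
    (hg : IsInduced p f ι q g) : induced p f ι q = g := by
  have h : ∃ g, IsInduced p f ι q g := ⟨g, hg⟩
  rw [induced, dif_pos h]
  ext x
  obtain ⟨t, rfl⟩ := hp x
  obtain ⟨u, hu, hgu⟩ := hg t
  obtain ⟨u', hu', hgu'⟩ := h.choose_spec t
  rw [hgu, hgu', ← sub_eq_zero, ← map_sub]
  exact hq (by rw [LinearMap.mem_ker, map_sub, hu, hu', sub_self])

end Induced

variable {K : Type u} [Field K] {A : Type w} [Ring A] [Algebra K A] [Coalgebra K A]

variable (K A) in
/-- `gr^n A ⊗ gr^m A → gr^{n+m} A`, induced by the multiplication `A_n ⊗ A_m → A_{n+m}`. -/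
def grMul (n m : ℕ) : GrPiece K A n ⊗[K] GrPiece K A m →ₗ[K] GrPiece K A (n + m) :=
  induced (TensorProduct.map (grQ K A n) (grQ K A m))
    (LinearMap.mul' K A ∘ₗ TensorProduct.map (coradFil K A n).subtype (coradFil K A m).subtype)
    (coradFil K A (n + m)).subtype (grQ K A (n + m))

/-- `gr^n A ⊗ gr^m A → gr^m A ⊗ gr^n A`, induced by the braiding `A_n ⊗ A_m → A_m ⊗ A_n`. -/
def grBraiding (c : A ⊗[K] A →ₗ[K] A ⊗[K] A) (n m : ℕ) :
    GrPiece K A n ⊗[K] GrPiece K A m →ₗ[K] GrPiece K A m ⊗[K] GrPiece K A n :=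
  induced (TensorProduct.map (grQ K A n) (grQ K A m))
    (c ∘ₗ TensorProduct.map (coradFil K A n).subtype (coradFil K A m).subtype)
    (TensorProduct.map (coradFil K A m).subtype (coradFil K A n).subtype)
    (TensorProduct.map (grQ K A m) (grQ K A n))

variable (K A) in
/-- `gr^n A → ⨁_{i+j=n} gr^i A ⊗ gr^j A`, induced by the comultiplication
`A_n → ∑_{i+j=n} A_i ⊗ A_j`. -/
def grComul (n : ℕ) : GrPiece K A n →ₗ[K]
    ⨁ ij : Finset.HasAntidiagonal.antidiagonal n, GrPiece K A ij.1.1 ⊗[K] GrPiece K A ij.1.2 :=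
  induced (grQ K A n) (Coalgebra.comul (R := K) ∘ₗ (coradFil K A n).subtype)
    (DirectSum.toModule K (Finset.HasAntidiagonal.antidiagonal n) (A ⊗[K] A) fun ij =>
      TensorProduct.map (coradFil K A ij.1.1).subtype (coradFil K A ij.1.2).subtype)
    (DirectSum.lmap fun ij : Finset.HasAntidiagonal.antidiagonal n =>
      TensorProduct.map (grQ K A ij.1.1) (grQ K A ij.1.2))

variable (K A) in
/-- The counit of `gr A`: that of `A` on `gr^0 A = A_0`, and zero on `gr^n A` for `n > 0`. -/
def grCounit : (n : ℕ) → GrPiece K A n →ₗ[K] K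
  | 0 => ((coradPrev K A 0).submoduleOf (coradFil K A 0)).liftQ
      (Coalgebra.counit (R := K) ∘ₗ (coradFil K A 0).subtype) (by
        intro x hx
        have h : (x : A) = 0 := (Submodule.mem_bot K).1 (Submodule.mem_comap.1 hx)
        simp [h])
  | _ + 1 => 0

/-- The associated graded `gr A` of a braided bialgebra for the coradical filtration. -/
def grMaps (c : A ⊗[K] A →ₗ[K] A ⊗[K] A) : StructureMaps K (Gr K A) where
  mul := DirectSum.toModule K (ℕ × ℕ) (Gr K A) (fun nm => grι K A (nm.1 + nm.2) ∘ₗ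
    grMul K A nm.1 nm.2) ∘ₗ
      (TensorProduct.directSum K K (GrPiece K A) (GrPiece K A)).toLinearMap
  one := grι K A 0 (induced LinearMap.id (Algebra.linearMap K A) (coradFil K A 0).subtype
    (grQ K A 0) 1)
  comul := DirectSum.toModule K ℕ (Gr K A ⊗[K] Gr K A) fun n =>
    DirectSum.toModule K (Finset.HasAntidiagonal.antidiagonal n) (Gr K A ⊗[K] Gr K A) (fun ij =>
      TensorProduct.map (grι K A ij.1.1) (grι K A ij.1.2)) ∘ₗ grComul K A n
  counit := DirectSum.toModule K ℕ K (grCounit K A)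
  braiding := DirectSum.toModule K (ℕ × ℕ) (Gr K A ⊗[K] Gr K A) (fun nm =>
    TensorProduct.map (grι K A nm.2) (grι K A nm.1) ∘ₗ grBraiding c nm.1 nm.2) ∘ₗ
      (TensorProduct.directSum K K (GrPiece K A) (GrPiece K A)).toLinearMap

end Graded

end Braided

end

noncomputable section

namespace Braided

universe u v w

/-! ### Submodules of tensor products -/

section TensorSubmodule

variable {K : Type*} [Field K] {X M : Type*} [AddCommGroup X] [Module K X]
  [AddCommGroup M] [Module K M]

theorem eq_zero_of_forall_rTensor {t : X ⊗[K] M}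
    (h : ∀ f : X →ₗ[K] K, TensorProduct.lid K M (f.rTensor M t) = 0) : t = 0 := by
  let b := Module.Free.chooseBasis K X
  apply (TensorProduct.equivFinsuppOfBasisLeft (N := M) b).injective
  rw [map_zero]
  ext i
  rw [Finsupp.zero_apply, ← h (b.coord i)]
  clear h
  induction t with
  | zero => simp
  | add x y hx hy => simp only [map_add, Finsupp.add_apply, hx, hy]
  | tmul x y => simp

/-- Modulo `N` every slice of `t` vanishes, so the image of `t` in `X ⊗ (M ⧸ N)` is zero, and right
exactness returns `t` to `X ⊗ N`. Memberships in tensor products are thereby tested on single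
elements. -/
theorem mem_range_lTensor {N : Submodule K M} {t : X ⊗[K] M}
    (h : ∀ f : X →ₗ[K] K, TensorProduct.lid K M (f.rTensor M t) ∈ N) :
    t ∈ LinearMap.range (N.subtype.lTensor X) := by
  have hex : Function.Exact (N.subtype.lTensor X) (N.mkQ.lTensor X) :=
    lTensor_exact X (by
      rw [LinearMap.exact_iff, Submodule.ker_mkQ, Submodule.range_subtype]) N.mkQ_surjective
  rw [← LinearMap.exact_iff.1 hex, LinearMap.mem_ker]
  refine eq_zero_of_forall_rTensor fun f => ?_
  have : TensorProduct.lid K _ (f.rTensor _ (N.mkQ.lTensor X t)) =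
      N.mkQ (TensorProduct.lid K M (f.rTensor M t)) := by
    clear h
    induction t with
    | zero => simp
    | add x y hx hy => simp only [map_add, hx, hy]
    | tmul x y => simp
  rw [this, Submodule.mkQ_apply, Submodule.Quotient.mk_eq_zero]
  exact h f

/-- One family of slices puts `t` in `N ⊗ M`. The other slices are then needed for functionals on
`N` only, and these extend to `X`. -/
theorem mem_range_map {N : Submodule K X} {N' : Submodule K M} {t : X ⊗[K] M}
    (h : ∀ g : M →ₗ[K] K, TensorProduct.rid K X (g.lTensor X t) ∈ N)
    (h' : ∀ f : X →ₗ[K] K, TensorProduct.lid K M (f.rTensor M t) ∈ N') :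
    t ∈ LinearMap.range (TensorProduct.map N.subtype N'.subtype) := by
  have h1 : TensorProduct.comm K X M t ∈ LinearMap.range (N.subtype.lTensor M) := by
    refine mem_range_lTensor fun g => ?_
    convert h g
    clear h h'
    induction t with
    | zero => simp
    | add x y hx hy => simp only [map_add, hx, hy]
    | tmul x y => simp
  obtain ⟨s, hs⟩ := h1
  obtain ⟨s, rfl⟩ := (TensorProduct.comm K N M).surjective s
  have hs' : t = N.subtype.rTensor M s := by
    apply (TensorProduct.comm K X M).injective
    rw [← hs]
    clear hs
    induction s with
    | zero => simp
    | add x y hx hy => simp only [map_add, hx, hy]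
    | tmul x y => simp
  obtain ⟨r, hr⟩ : s ∈ LinearMap.range (N'.subtype.lTensor N) := by
    refine mem_range_lTensor fun f => ?_
    obtain ⟨f', hf'⟩ := LinearMap.exists_extend f
    rw [← hf', LinearMap.rTensor_comp, LinearMap.comp_apply, ← hs']
    exact h' f'
  refine ⟨r, ?_⟩
  rw [hs', ← hr, ← LinearMap.comp_apply, LinearMap.rTensor_comp_lTensor]

theorem rTensor_apply_mem_range_lTensor {N : Submodule K M} {t : X ⊗[K] M}
    (ht : t ∈ LinearMap.range (N.subtype.lTensor X)) (f : X →ₗ[K] K) :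
    TensorProduct.lid K M (f.rTensor M t) ∈ N := by
  obtain ⟨s, rfl⟩ := ht
  induction s with
  | zero => simp
  | add x y hx hy => simpa using N.add_mem hx hy
  | tmul x y => simpa using N.smul_mem _ y.2

theorem tmul_mem_range_lTensor {N : Submodule K M} (x : X) {y : M} (hy : y ∈ N) :
    x ⊗ₜ[K] y ∈ LinearMap.range (N.subtype.lTensor X) := ⟨x ⊗ₜ ⟨y, hy⟩, by simp⟩

theorem range_lTensor_le {N : Submodule K M} {L : Submodule K (X ⊗[K] M)}
    (h : ∀ x, ∀ y ∈ N, x ⊗ₜ[K] y ∈ L) : LinearMap.range (N.subtype.lTensor X) ≤ L := by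
  rintro _ ⟨s, rfl⟩
  induction s with
  | zero => simp
  | add x y hx hy => rw [map_add]; exact L.add_mem hx hy
  | tmul x y => simpa using h x y.1 y.2

theorem exists_finite_mem_range_lTensor (t : X ⊗[K] M) :
    ∃ N : Submodule K M, Module.Finite K N ∧ t ∈ LinearMap.range (N.subtype.lTensor X) := by
  induction t with
  | zero => exact ⟨⊥, inferInstance, zero_mem _⟩
  | tmul x y =>
    exact ⟨K ∙ y, inferInstance, tmul_mem_range_lTensor x (Submodule.mem_span_singleton_self y)⟩
  | add s t hs ht =>
    obtain ⟨N, hN, hs⟩ := hs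
    obtain ⟨N', hN', ht⟩ := ht
    have mono : ∀ {P Q : Submodule K M}, P ≤ Q →
        LinearMap.range (P.subtype.lTensor X) ≤ LinearMap.range (Q.subtype.lTensor X) :=
      fun h => range_lTensor_le fun x y hy => tmul_mem_range_lTensor x (h hy)
    exact ⟨N ⊔ N', inferInstance, add_mem (mono le_sup_left hs) (mono le_sup_right ht)⟩

end TensorSubmodule

/-! ### Exhaustiveness of the coradical filtration of a connected coalgebra -/

/-- Modulo the Jacobson radical the ring is semisimple, so a complement of the image of `I` yields
`e ∈ I` that acts on `I` as a right unit modulo the radical. The right annihilator `N` of `I` modulo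
the radical is two-sided and contains `1 - e`. If `N` were proper it would lie in `I`, and then `1 ∈
I`. So `N` is everything, `I` lies in the radical, and the radical is nilpotent. -/
theorem isNilpotent_of_largest_twoSided {R : Type*} [Ring R] [IsSemiprimaryRing R] (I : Ideal R)
    [I.IsTwoSided] (hI : I ≠ ⊤) (h : ∀ N : Ideal R, N.IsTwoSided → N ≠ ⊤ → N ≤ I) :
    ∃ n, I ^ n = ⊥ := by
  obtain ⟨e, heI, he⟩ : ∃ e ∈ I, ∀ x ∈ I, x - x * e ∈ Ring.jacobson R := by
    let q := Ideal.Quotient.mk (Ring.jacobson R)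
    obtain ⟨C, hC⟩ := exists_isCompl (I.map q)
    have h1 : (1 : R ⧸ Ring.jacobson R) ∈ I.map q ⊔ C := by rw [hC.sup_eq_top]; trivial
    obtain ⟨e, he, f, hf, hef⟩ := Submodule.mem_sup.1 h1
    obtain ⟨e, heI, rfl⟩ := (Ideal.mem_map_iff_of_surjective q Ideal.Quotient.mk_surjective).1 he
    refine ⟨e, heI, fun x hx => ?_⟩
    rw [← Ideal.Quotient.eq_zero_iff_mem, map_sub, map_mul]
    have hxf : q x - q x * q e = q x * f := by rw [sub_eq_iff_eq_add', ← mul_add, hef, mul_one]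
    have h2 : q x - q x * q e ∈ I.map q ⊓ C :=
      ⟨sub_mem (Ideal.mem_map_of_mem q hx) (Ideal.mul_mem_left _ _ he),
        hxf ▸ Ideal.mul_mem_left _ _ hf⟩
    rwa [hC.inf_eq_bot] at h2
  let N : Ideal R :=
    { carrier := {y | ∀ x ∈ I, x * y ∈ Ring.jacobson R}
      add_mem' := fun ha hb x hx => by rw [mul_add]; exact add_mem (ha x hx) (hb x hx)
      zero_mem' := fun x _ => by simp
      smul_mem' := fun r y hy x hx => by
        rw [smul_eq_mul, ← mul_assoc]; exact hy _ (I.mul_mem_right r hx) }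
  have hN : N.IsTwoSided := ⟨fun {a} b ha x hx => by
    rw [← mul_assoc]; exact Ideal.mul_mem_right _ _ (ha x hx)⟩
  have heN : 1 - e ∈ N := fun x hx => by rw [mul_sub, mul_one]; exact he x hx
  have hIJ : I ≤ Ring.jacobson R := by
    by_cases hNt : N = ⊤
    · intro x hx
      have : (1 : R) ∈ N := hNt ▸ trivial
      simpa using this x hx
    · refine absurd ((Ideal.eq_top_iff_one I).2 ?_) hI
      simpa using I.add_mem (h N hN hNt heN) heI
  obtain ⟨n, hn⟩ := IsSemiprimaryRing.isNilpotent (R := R)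
  exact ⟨n, le_bot_iff.1 ((Ideal.pow_right_mono hIJ n).trans hn.le)⟩

section Exhaustive

variable {K : Type u} [Field K] {A : Type w} [AddCommGroup A] [Module K A] [Coalgebra K A]

open Coalgebra WithConv

theorem convMul_apply_lid (f g : WithConv (A →ₗ[K] K)) (x : A) : (f * g) x =
    g (TensorProduct.lid K A (f.ofConv.rTensor A (comul (R := K) x))) := by
  rw [LinearMap.convMul_apply]
  induction comul (R := K) x with
  | zero => simp
  | add x y hx hy => simp only [map_add, hx, hy]
  | tmul x y => simp

theorem convMul_apply_rid (f g : WithConv (A →ₗ[K] K)) (x : A) : (f * g) x =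
    f (TensorProduct.rid K A (g.ofConv.lTensor A (comul (R := K) x))) := by
  rw [LinearMap.convMul_apply]
  induction comul (R := K) x with
  | zero => simp
  | add x y hx hy => simp only [map_add, hx, hy]
  | tmul x y => simp [mul_comm]

/-- The common zeros of an ideal of the convolution algebra. -/
def zeros (N : Ideal (WithConv (A →ₗ[K] K))) : Submodule K A where
  carrier := {x | ∀ f ∈ N, f x = 0}
  add_mem' ha hb f hf := by
    have h1 := ha f hf; have h2 := hb f hf
    change f.ofConv _ = 0 at *
    simp_all
  zero_mem' f _ := map_zero f.ofConv
  smul_mem' r x hx f hf := by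
    have h1 := hx f hf
    change f.ofConv _ = 0 at *
    simp_all

/-- Evaluating `f ∈ N` at a slice of `Δ(x)` by `g` is evaluating a convolution product of `f` and
`g` at `x`. The two sides of the ideal account for the two legs. -/
theorem isSubcoalgebra_zeros (N : Ideal (WithConv (A →ₗ[K] K))) [N.IsTwoSided] :
    IsSubcoalgebra K (zeros N) := by
  intro x hx
  refine mem_range_map (fun g f hf => ?_) (fun g f hf => ?_)
  · have := hx _ (N.mul_mem_right (toConv g) hf)
    rwa [convMul_apply_rid] at this
  · have := hx _ (N.mul_mem_left (toConv g) hf)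
    rwa [convMul_apply_lid] at this

theorem exists_isSimpleSubcoalgebra_le (D : Submodule K A) [Module.Finite K D]
    (hD : IsSubcoalgebra K D) (h0 : D ≠ ⊥) : ∃ E ≤ D, IsSimpleSubcoalgebra K E := by
  induction h : Module.finrank K D using Nat.strong_induction_on generalizing D with
  | _ n ih =>
    by_cases hs : ∀ E ≤ D, IsSubcoalgebra K E → E = ⊥ ∨ E = D
    · exact ⟨D, le_rfl, hD, h0, hs⟩
    · push Not at hs
      obtain ⟨E, hED, hE, hE0, hne⟩ := hs
      have : Module.Finite K E := Submodule.finiteDimensional_of_le hED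
      obtain ⟨E', h1, h2⟩ := ih _ (h ▸ Submodule.finrank_lt_finrank_of_lt (hED.lt_of_ne hne))
        E hE hE0 rfl
      exact ⟨E', h1.trans hED, h2⟩

variable (K) in
/-- The largest two-sided ideal of the convolution algebra on which evaluation at `a` vanishes. -/
def annIdeal (a : A) : Ideal (WithConv (A →ₗ[K] K)) where
  carrier := {h | ∀ f g : WithConv (A →ₗ[K] K), (f * h * g) a = 0}
  add_mem' ha hb f g := by
    rw [mul_add, add_mul]
    change (f * _ * g) a + (f * _ * g) a = 0
    rw [ha, hb, add_zero]
  zero_mem' f g := by rw [mul_zero, zero_mul]; rfl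
  smul_mem' r x hx f g := by rw [smul_eq_mul, ← mul_assoc f]; exact hx _ _

instance (a : A) : (annIdeal K a).IsTwoSided :=
  ⟨fun {h} b hh f g => by rw [← mul_assoc f, mul_assoc (f * h)]; exact hh _ _⟩

/-- Local finiteness of coalgebras in dual form: `(f * h * g) a` sees `h` only through the middle
legs of the iterated comultiplication of `a`, and `D` contains these. -/
theorem exists_finite_annIdeal (a : A) : ∃ D : Submodule K A, Module.Finite K D ∧
    ∀ h : WithConv (A →ₗ[K] K), (∀ x ∈ D, h x = 0) → h ∈ annIdeal K a := by
  obtain ⟨N, hN, hmem⟩ := exists_finite_mem_range_lTensor (comul (R := K) a)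
  let b := Module.finBasis K N
  -- The flip brings the left leg of `Δ(b i)`, a middle leg for `a`, to the side on which finiteness
  -- is available.
  choose D hD hD' using fun i => exists_finite_mem_range_lTensor
    (TensorProduct.comm K A A (comul (R := K) (b i : A)))
  refine ⟨⨆ i, D i, inferInstance, fun h hh f g => ?_⟩
  rw [mul_assoc, convMul_apply_lid]
  have key : ∀ i, (h * g) (b i : A) = 0 := by
    intro i
    rw [convMul_apply_rid]
    refine hh _ (Submodule.mem_iSup_of_mem i ?_)
    have := rTensor_apply_mem_range_lTensor (hD' i) g.ofConv
    convert this
    induction comul (R := K) (b i : A) with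
    | zero => simp
    | add x y hx hy => simp only [map_add, hx, hy]
    | tmul x y => simp
  have key2 : (h * g).ofConv ∘ₗ N.subtype = 0 := b.ext fun i => by simpa using key i
  exact LinearMap.congr_fun key2 ⟨_, rTensor_apply_mem_range_lTensor hmem f.ofConv⟩

/-- The common zeros of `N` form a finite-dimensional subcoalgebra. If it were zero, duality on `D`
would give `f ∈ N` that agrees with the convolution unit `ε` on `D`; then `1 - f ∈ annIdeal K a ≤ N`
and `N` would not be proper. So it contains a simple subcoalgebra, and with it `o`. -/
theorem le_augmentation {o : A} (hsimple : ∀ D, IsSimpleSubcoalgebra K D → o ∈ D)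
    {a : A} (N : Ideal (WithConv (A →ₗ[K] K))) [N.IsTwoSided] (haN : annIdeal K a ≤ N)
    (hN : N ≠ ⊤) {h : WithConv (A →ₗ[K] K)} (hh : h ∈ N) : h o = 0 := by
  obtain ⟨D, hD, hDa⟩ := exists_finite_annIdeal (K := K) a
  have hle : zeros N ≤ D := by
    intro x hx
    by_contra hxD
    obtain ⟨f, hf, hfD⟩ := Submodule.exists_dual_map_eq_bot_of_notMem hxD inferInstance
    exact hf (hx (toConv f) (haN (hDa _ fun y hy => by
      have : f y ∈ D.map f := Submodule.mem_map_of_mem hy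
      rw [hfD] at this; exact this)))
  have hfin : Module.Finite K (zeros N) := Submodule.finiteDimensional_of_le hle
  have hne : zeros N ≠ ⊥ := by
    intro hbot
    apply hN
    let L : Submodule K (Module.Dual K D) :=
      { carrier := {φ | ∃ f ∈ N, f.ofConv ∘ₗ D.subtype = φ}
        add_mem' := by
          rintro _ _ ⟨f, hf, rfl⟩ ⟨g, hg, rfl⟩
          exact ⟨f + g, N.add_mem hf hg, rfl⟩
        zero_mem' := ⟨0, N.zero_mem, rfl⟩
        smul_mem' := by
          rintro r _ ⟨f, hf, rfl⟩
          exact ⟨algebraMap K _ r * f, N.mul_mem_left _ hf, by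
            rw [← Algebra.smul_def]; rfl⟩ }
    have hL : L = ⊤ := by
      have h1 : L.dualCoannihilator = ⊥ := by
        rw [eq_bot_iff]
        intro x hx
        have : (x : A) ∈ zeros N := fun f hf => (Submodule.mem_dualCoannihilator x).1 hx _ ⟨f, hf, rfl⟩
        rw [hbot] at this
        simpa using this
      rw [← Subspace.dualCoannihilator_dualAnnihilator_eq (W := L), h1,
        Submodule.dualAnnihilator_bot]
    obtain ⟨f, hf, hfe⟩ : (1 : WithConv (A →ₗ[K] K)).ofConv ∘ₗ D.subtype ∈ L := hL ▸ trivial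
    rw [Ideal.eq_top_iff_one, ← sub_add_cancel 1 f]
    refine N.add_mem (haN (hDa _ fun x hx => ?_)) hf
    have := LinearMap.congr_fun hfe ⟨x, hx⟩
    exact sub_eq_zero.2 this.symm
  obtain ⟨E, hE, hEs⟩ := exists_isSimpleSubcoalgebra_le (zeros N) (isSubcoalgebra_zeros N) hne
  exact hE (hsimple E hEs) h hh

end Exhaustive

/-! ### Nilpotency of the augmentation ideal modulo `annIdeal` -/

section Connected

variable {K : Type u} [Field K] {A : Type w} [AddCommGroup A] [Module K A] [Coalgebra K A]

open Coalgebra WithConv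

/-- Modulo `annIdeal K a` a functional depends only on its restriction to a finite-dimensional `D`,
so the dual of `D` surjects onto the quotient. -/
theorem finite_quotient_annIdeal (a : A) :
    Module.Finite K (WithConv (A →ₗ[K] K) ⧸ annIdeal K a) := by
  obtain ⟨D, hD, hDa⟩ := exists_finite_annIdeal (K := K) a
  obtain ⟨p, hp⟩ := LinearMap.exists_leftInverse_of_injective D.subtype D.ker_subtype
  let ψ : Module.Dual K D →ₗ[K] WithConv (A →ₗ[K] K) ⧸ annIdeal K a :=
    { toFun := fun φ => Ideal.Quotient.mk _ (toConv (φ ∘ₗ p))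
      map_add' := fun φ φ' => rfl
      map_smul' := fun r φ => rfl }
  refine Module.Finite.of_surjective ψ fun y => ?_
  obtain ⟨f, rfl⟩ := Ideal.Quotient.mk_surjective y
  refine ⟨f.ofConv ∘ₗ D.subtype, (Ideal.Quotient.eq).2 (hDa _ fun x hx => ?_)⟩
  have := LinearMap.congr_fun hp ⟨x, hx⟩
  simp only [LinearMap.comp_apply, Submodule.subtype_apply, LinearMap.id_apply] at this
  change f (D.subtype (p x)) - f x = 0
  rw [this, Submodule.subtype_apply, sub_self]

/-- The ideal of the convolution algebra formed by the functionals that vanish at a group-like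
element. -/
def augIdeal (o : A) (ho : comul (R := K) o = o ⊗ₜ o) : Ideal (WithConv (A →ₗ[K] K)) where
  carrier := {h | h o = 0}
  add_mem' {f g} ha hb := by
    change f o + g o = 0
    rw [ha, hb, add_zero]
  zero_mem' := rfl
  smul_mem' r x hx := by
    change x o = 0 at hx
    change (r * x) o = 0
    rw [LinearMap.convMul_apply, ho]
    change r o * x o = 0
    rw [hx, mul_zero]

theorem mem_augIdeal {o : A} (ho : comul (R := K) o = o ⊗ₜ o) {h : WithConv (A →ₗ[K] K)} :
    h ∈ augIdeal o ho ↔ h o = 0 := Iff.rfl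

instance (o : A) (ho : comul (R := K) o = o ⊗ₜ o) : (augIdeal o ho).IsTwoSided :=
  ⟨fun {f} g hf => by
    rw [mem_augIdeal] at hf ⊢
    rw [LinearMap.convMul_apply, ho]
    change f o * g o = 0
    rw [hf, zero_mul]⟩

/-- The slice of `Δ(x) - o ⊗ x` by `f` is the slice of `Δ(x)` by `f - f(o) ε`, which lies in the
augmentation ideal. Hence one power of the ideal less suffices to kill each slice, and induction
places the slices one step lower in the filtration. -/
theorem mem_coradFil_of_augIdeal_pow {o : A} (ho : comul (R := K) o = o ⊗ₜ o)
    (ho' : counit (R := K) o = 1) (h0 : coradFil K A 0 = K ∙ o) (n : ℕ) (x : A)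
    (hx : ∀ h ∈ augIdeal o ho ^ (n + 1), h x = 0) : x ∈ coradFil K A n := by
  have haug : ∀ f : A →ₗ[K] K, toConv (f - f o • counit) ∈ augIdeal o ho := by
    intro f
    change f o - f o • counit (R := K) o = 0
    rw [ho', smul_eq_mul, mul_one, sub_self]
  induction n generalizing x with
  | zero =>
    rw [h0]
    suffices x - counit (R := K) x • o = 0 from
      sub_eq_zero.1 this ▸ Submodule.smul_mem _ _ (Submodule.mem_span_singleton_self o)
    refine (Module.forall_dual_apply_eq_zero_iff K _).1 fun f => ?_
    have := hx _ (by rw [zero_add, Submodule.pow_one]; exact haug f)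
    change f x - f o • counit (R := K) x = 0 at this
    rw [← this, map_sub, map_smul, smul_eq_mul, smul_eq_mul, mul_comm]
  | succ n ih =>
    rw [coradFil, Submodule.mem_comap]
    rw [← sub_add_cancel (comul (R := K) x) (o ⊗ₜ x)]
    refine Submodule.add_mem_sup (mem_range_lTensor fun f => ih _ fun k hk => ?_) ?_
    · have := hx _ (by rw [Submodule.pow_succ' _ n.succ_ne_zero]; exact Ideal.mul_mem_mul (haug f) hk)
      rw [convMul_apply_lid] at this
      rw [← this]
      congr 1
      simp [LinearMap.rTensor_sub, LinearMap.rTensor_smul]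
    · exact ⟨⟨o, h0 ▸ Submodule.mem_span_singleton_self o⟩ ⊗ₜ x, by simp⟩

/-- The coradical filtration of a connected coalgebra is exhaustive. -/
theorem exists_mem_coradFil {o : A} (ho : comul (R := K) o = o ⊗ₜ o)
    (ho' : counit (R := K) o = 1) (h0 : coradFil K A 0 = K ∙ o) (a : A) :
    ∃ n, a ∈ coradFil K A n := by
  have hsimple : ∀ D, IsSimpleSubcoalgebra K D → o ∈ D := by
    intro D hD
    obtain ⟨x, hx, hx0⟩ := (Submodule.ne_bot_iff D).1 hD.2.1
    have hle : D ≤ coradFil K A 0 := by rw [coradFil]; exact le_sSup hD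
    have : x ∈ K ∙ o := h0 ▸ hle hx
    obtain ⟨r, rfl⟩ := Submodule.mem_span_singleton.1 this
    have hr : r ≠ 0 := by rintro rfl; exact hx0 (zero_smul _ _)
    exact (Submodule.smul_mem_iff D hr).1 hx
  -- In the finite-dimensional quotient by `annIdeal K a`, if nonzero, the image of the augmentation
  -- ideal is the largest proper two-sided ideal, hence nilpotent. A power of it then vanishes at
  -- `a`.
  suffices ∃ n, augIdeal o ho ^ n ≤ annIdeal K a by
    obtain ⟨n, hn⟩ := this
    refine ⟨n, mem_coradFil_of_augIdeal_pow ho ho' h0 n a fun h hh => ?_⟩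
    have := hn (Ideal.pow_le_pow_right n.le_succ hh) 1 1
    rwa [one_mul, mul_one] at this
  by_cases hZ : annIdeal K a = ⊤
  · exact ⟨0, hZ ▸ le_top⟩
  have := finite_quotient_annIdeal (K := K) a
  have : IsArtinianRing (WithConv (A →ₗ[K] K) ⧸ annIdeal K a) := IsArtinianRing.of_finite K _
  let q := Ideal.Quotient.mk (annIdeal K a)
  have hq : Function.Surjective q := Ideal.Quotient.mk_surjective
  have : ((augIdeal o ho).map q).IsTwoSided := ⟨fun {x} y hx => by
    obtain ⟨x', hx', rfl⟩ := (Ideal.mem_map_iff_of_surjective q hq).1 hx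
    obtain ⟨y, rfl⟩ := hq y
    rw [← map_mul]
    exact Ideal.mem_map_of_mem q (Ideal.mul_mem_right _ (augIdeal o ho) hx')⟩
  suffices (augIdeal o ho).map q ≠ ⊤ ∧ ∀ N : Ideal (WithConv (A →ₗ[K] K) ⧸ annIdeal K a),
      N.IsTwoSided → N ≠ ⊤ → N ≤ (augIdeal o ho).map q by
    obtain ⟨n, hn⟩ := isNilpotent_of_largest_twoSided ((augIdeal o ho).map q) this.1 this.2
    refine ⟨n, fun h hh => ?_⟩
    have hpow : ∀ n, augIdeal o ho ^ n ≤ ((augIdeal o ho).map q ^ n).comap q := by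
      intro n
      induction n with
      | zero => exact fun h _ => by simp [Submodule.pow_zero, Ideal.one_eq_top]
      | succ n ih =>
        rw [Submodule.pow_succ]
        refine Ideal.mul_le.2 fun r hr s hs => ?_
        rw [Ideal.mem_comap, map_mul, Submodule.pow_succ]
        exact Ideal.mul_mem_mul (ih hr) (Ideal.mem_map_of_mem q hs)
    have := hpow n hh
    rw [hn, Ideal.mem_comap, Ideal.mem_bot] at this
    exact Ideal.Quotient.eq_zero_iff_mem.1 this
  constructor
  · intro htop
    have h1 : (1 : WithConv (A →ₗ[K] K) ⧸ annIdeal K a) ∈ (augIdeal o ho).map q := htop ▸ trivial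
    obtain ⟨h, hh, h1⟩ := (Ideal.mem_map_iff_of_surjective q hq).1 h1
    rw [← map_one q] at h1
    have h2 := le_augmentation hsimple _ le_rfl hZ (Ideal.Quotient.eq.1 h1)
    have h3 : h o - counit (R := K) o = 0 := h2
    rw [(mem_augIdeal ho).1 hh, ho', zero_sub, neg_eq_zero] at h3
    exact one_ne_zero h3
  · intro N hN hNt y hy
    obtain ⟨f, rfl⟩ := hq y
    refine Ideal.mem_map_of_mem q ?_
    have : (N.comap q).IsTwoSided := ⟨fun {x} b hx => by
      rw [Ideal.mem_comap, map_mul]; exact Ideal.mul_mem_right _ _ hx⟩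
    refine le_augmentation (a := a) hsimple (N.comap q) (fun h hh => ?_) ?_ (h := f) hy
    · rw [Ideal.mem_comap, Ideal.Quotient.eq_zero_iff_mem.2 hh]; exact N.zero_mem
    · intro htop
      refine hNt ((Ideal.eq_top_iff_one N).2 ?_)
      have : (1 : WithConv (A →ₗ[K] K)) ∈ N.comap q := htop ▸ trivial
      rwa [Ideal.mem_comap, map_one] at this

end Connected

/-! ### Brackets of Hecke type vanish -/

section Bracket

variable {K : Type*} [Field K] {M N : Type*} [AddCommGroup M] [Module K M]
  [AddCommGroup N] [Module K N]

/-- Maps `f`, `g` from a module of the Hecke algebra of the third symmetric group that behave as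
`β ⊗ V` and `V ⊗ β` for a braided bracket `β` coincide up to sign. -/
theorem eq_neg_of_hecke {lam : K} (h0 : lam ≠ 0) (h1 : lam ≠ 1) (h3 : 1 + lam + lam ^ 2 ≠ 0)
    (s t : M →ₗ[K] M) (c : N →ₗ[K] N) (f g : M →ₗ[K] N)
    (hst : ∀ x, s (t (s x)) = t (s (t x)))
    (hs : ∀ x, s (s x) = (lam - 1) • s x + lam • x)
    (ht : ∀ x, t (t x) = (lam - 1) • t x + lam • x)
    (hc : ∀ y, c (c y) = (lam - 1) • c y + lam • y)
    (hfs : ∀ x, f (s x) = - f x) (hgt : ∀ x, g (t x) = - g x)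
    (hcf : ∀ x, c (f x) = g (s (t x))) (hcg : ∀ x, c (g x) = f (t (s x))) (x : M) :
    f x = - g x := by
  have h1' : lam - 1 ≠ 0 := sub_ne_zero.2 h1
  have hfts : ∀ x, f (t (s (t x))) = - f (t (s x)) := fun x => by rw [← hst, hfs]
  have hgst : ∀ x, g (s (t (s x))) = - g (s (t x)) := fun x => by rw [hst, hgt]
  -- The quadratic relation of `c` applied to `f x`: twice `c` becomes `f t s s t`, and every term
  -- acquires the factor `lam - 1`, which is cancelled. `e2`, `e4` and `e6` are the mirror images of
  -- `e1`, `e3` and `e5`.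
  have e1 : ∀ x, g (s (t x)) = f (-(t (s x)) + lam • t x + lam • x) := by
    intro x
    have := hc (f x)
    rw [hcf, hcg, hs] at this
    simp only [map_add, map_smul, ht, hfts] at this
    have h : (lam - 1) • (g (s (t x)) - f (-(t (s x)) + lam • t x + lam • x)) = 0 := by
      simp only [map_add, map_smul, map_neg]
      linear_combination (norm := module) -this
    exact sub_eq_zero.1 ((smul_eq_zero.1 h).resolve_left h1')
  have e2 : ∀ x, f (t (s x)) = g (-(s (t x)) + lam • s x + lam • x) := by
    intro x
    have := hc (g x)
    rw [hcg, hcf, ht] at this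
    simp only [map_add, map_smul, hs, hgst] at this
    have h : (lam - 1) • (f (t (s x)) - g (-(s (t x)) + lam • s x + lam • x)) = 0 := by
      simp only [map_add, map_smul, map_neg]
      linear_combination (norm := module) -this
    exact sub_eq_zero.1 ((smul_eq_zero.1 h).resolve_left h1')
  -- `e1` at `t x` minus `lam - 1` times `e1` at `x` is a multiple of `lam`.
  have e3 : ∀ x, g (s x) = f (t (s x) + t x + x) := by
    intro x
    have := e1 (t x)
    simp only [ht, map_add, map_smul, map_neg, hfts] at this
    have h1 := e1 x
    simp only [map_add, map_smul, map_neg] at h1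
    have h : lam • (g (s x) - f (t (s x) + t x + x)) = 0 := by
      simp only [map_add]
      linear_combination (norm := module) this - (lam - 1) • h1
    exact sub_eq_zero.1 ((smul_eq_zero.1 h).resolve_left h0)
  have e4 : ∀ x, f (t x) = g (s (t x) + s x + x) := by
    intro x
    have := e2 (s x)
    simp only [hs, map_add, map_smul, map_neg, hgst] at this
    have h1 := e2 x
    simp only [map_add, map_smul, map_neg] at h1
    have h : lam • (f (t x) - g (s (t x) + s x + x)) = 0 := by
      simp only [map_add]
      linear_combination (norm := module) this - (lam - 1) • h1
    exact sub_eq_zero.1 ((smul_eq_zero.1 h).resolve_left h0)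
  -- The same device once more: `e3` at `s x` minus `lam - 1` times `e3` at `x`.
  have e5 : ∀ x, lam • g x = f (t (s x) + t x - lam • x) := by
    intro x
    have := e3 (s x)
    simp only [hs, map_add, map_smul, hfs] at this
    have h1 := e3 x
    simp only [map_add] at h1
    simp only [map_add, map_sub, map_smul]
    linear_combination (norm := module) this - (lam - 1) • h1
  have e6 : ∀ x, lam • f x = g (s (t x) + s x - lam • x) := by
    intro x
    have := e4 (t x)
    simp only [ht, map_add, map_smul, hgt] at this
    have h1 := e4 x
    simp only [map_add] at h1
    simp only [map_add, map_sub, map_smul]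
    linear_combination (norm := module) this - (lam - 1) • h1
  -- Substituting `e1`, `e3` and `e5` into `e6` eliminates `g`.
  have e7 : ∀ x, f (t (s x)) = lam • f (t x) + (lam + 1) • f x := by
    intro x
    have h1 := e6 x
    have h2 := e1 x
    have h3 := e3 x
    have h4 := e5 x
    simp only [map_add, map_sub, map_smul, map_neg] at h1 h2 h3 h4
    linear_combination (norm := module) h1 + h2 + h3 - h4
  -- Comparing `e7` at `t x` with `e7` at `x` leaves the factor `1 + lam + lam²`: `f` is a sign
  -- under `t` as well as under `s`, and `e5` then gives the claim.
  have e8 : ∀ x, f (t x) = - f x := by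
    intro x
    have h1 := e7 (t x)
    have h2 := e7 x
    simp only [map_add, map_smul, hfts, ht] at h1
    have h : (1 + lam + lam ^ 2) • (f (t x) + f x) = 0 := by
      linear_combination (norm := module) -h1 - h2
    exact eq_neg_of_add_eq_zero_left ((smul_eq_zero.1 h).resolve_left h3)
  have h1 := e5 x
  simp only [map_add, map_sub, map_smul, e8, hfs] at h1
  have h : lam • (f x + g x) = 0 := by
    linear_combination (norm := module) h1
  exact eq_neg_of_add_eq_zero_left ((smul_eq_zero.1 h).resolve_left h0)

/-- If `φ (β (x ⊗ y)) = 1`, slicing the hypothesis by `φ` gives `z = -φ(x) β (y ⊗ z)` for all `z`.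
So `φ(x) ≠ 0` and `φ(x) β (y ⊗ y) = -y`. The hypothesis at `(y, y, y)`, multiplied by `φ(x)`,
becomes `2 (y ⊗ y) = 0`; thus `y = 0`, a contradiction. -/
theorem bracket_eq_zero (hK : ringChar K ≠ 2) {V : Type*} [AddCommGroup V] [Module K V]
    (β : V ⊗[K] V →ₗ[K] V)
    (h : ∀ x y z : V, β (x ⊗ₜ y) ⊗ₜ[K] z = - (x ⊗ₜ[K] β (y ⊗ₜ z))) : β = 0 := by
  ext x y
  change β (x ⊗ₜ y) = 0
  by_contra hne
  obtain ⟨φ, hφ⟩ : ∃ φ : V →ₗ[K] K, φ (β (x ⊗ₜ y)) = 1 :=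
    Module.Projective.exists_dual_eq_one K hne
  have h1 : ∀ z, z = - (φ x • β (y ⊗ₜ z)) := fun z => by
    simpa [hφ] using congrArg (fun t => TensorProduct.lid K V (φ.rTensor V t)) (h x y z)
  have hx : φ x ≠ 0 := fun h0 => hne (by rw [h1 (β _), h0, zero_smul, neg_zero])
  have h2 := congrArg (fun t => φ x • t) (h y y y)
  rw [smul_neg, TensorProduct.smul_tmul', ← TensorProduct.tmul_smul] at h2
  rw [← neg_eq_iff_eq_neg.2 (h1 y), TensorProduct.neg_tmul, TensorProduct.tmul_neg, neg_neg,
    neg_eq_iff_add_eq_zero, ← two_smul K] at h2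
  have h3 : y ⊗ₜ[K] y = 0 := (smul_eq_zero.1 h2).resolve_left (Ring.two_ne_zero hK)
  have h4 : y = 0 := by
    by_contra hy
    obtain ⟨χ, hχ⟩ : ∃ χ : V →ₗ[K] K, χ y = 1 := Module.Projective.exists_dual_eq_one K hy
    apply hy
    simpa [hχ] using congrArg (fun t => TensorProduct.lid K V (χ.rTensor V t)) h3
  exact hne (by rw [h4, TensorProduct.tmul_zero, map_zero])

end Bracket

/-! ### Primitive elements of braided bialgebras -/

section Primitive

variable {K : Type u} [Field K] {A : Type w} [Ring A] [Algebra K A] [Coalgebra K A]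

open Coalgebra

variable (K A) in
/-- `x ↦ Δ(x) - x ⊗ 1 - 1 ⊗ x` -/
def primDefect : A →ₗ[K] A ⊗[K] A :=
  comul - (TensorProduct.mk K A A).flip 1 - TensorProduct.mk K A A 1

variable (K A) in
/-- The primitive elements. -/
def prim : Submodule K A := LinearMap.ker (primDefect K A)

theorem mem_prim {x : A} : x ∈ prim K A ↔ comul (R := K) x = x ⊗ₜ 1 + 1 ⊗ₜ x := by
  simp [prim, primDefect, sub_sub, sub_eq_zero]

/-- `x ⊗ (s ⊗ t) ↦ c (x ⊗ s) · t`, linearly in `x`: left multiplication by `1 ⊗ x` in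
`A ⊗_c A`. -/
def braidAct (cA : A ⊗[K] A →ₗ[K] A ⊗[K] A) : A →ₗ[K] Module.End K (A ⊗[K] A) :=
  TensorProduct.curry ((LinearMap.mul' K A).lTensor A ∘ₗ
    (TensorProduct.assoc K A A A).toLinearMap ∘ₗ cA.rTensor A ∘ₗ
    (TensorProduct.assoc K A A A).symm.toLinearMap)

omit [Coalgebra K A] in
theorem braidAct_tmul (cA : A ⊗[K] A →ₗ[K] A ⊗[K] A) (x s t : A) :
    braidAct cA x (s ⊗ₜ t) = (LinearMap.mulRight K t).lTensor A (cA (x ⊗ₜ s)) := by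
  simp only [braidAct, TensorProduct.curry_apply, LinearMap.comp_apply, LinearEquiv.coe_coe,
    TensorProduct.assoc_symm_tmul, LinearMap.rTensor_tmul]
  induction cA (x ⊗ₜ s) with
  | zero => simp
  | add x y hx hy => simp only [map_add, TensorProduct.add_tmul, hx, hy]
  | tmul x y => simp

variable {cA : A ⊗[K] A →ₗ[K] A ⊗[K] A} (hA : IsBraidedBialgebra cA)
include hA

theorem braidAct_one (z : A ⊗[K] A) : braidAct cA 1 z = z := by
  induction z with
  | zero => simp
  | add x y hx hy => simp only [map_add, hx, hy]
  | tmul s t => simp [braidAct_tmul, hA.braid_one_left]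

theorem braidAct_mul (x y : A) (z : A ⊗[K] A) :
    braidAct cA (x * y) z = braidAct cA x (braidAct cA y z) := by
  induction z with
  | zero => simp
  | add x y hx hy => simp only [map_add, hx, hy]
  | tmul s t =>
    have h := LinearMap.congr_fun hA.braid_mul_left (x ⊗ₜ (y ⊗ₜ s))
    simp only [LinearMap.comp_apply, LinearEquiv.coe_coe, TensorProduct.assoc_symm_tmul,
      LinearMap.rTensor_tmul, LinearMap.mul'_apply, c₂, LinearMap.lTensor_tmul, c₁] at h
    rw [braidAct_tmul, braidAct_tmul, h]
    induction cA (y ⊗ₜ s) with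
    | zero => simp
    | add x y hx hy => simp only [map_add, TensorProduct.tmul_add, hx, hy]
    | tmul a b =>
      simp only [TensorProduct.assoc_symm_tmul, LinearMap.rTensor_tmul, LinearMap.lTensor_tmul,
        braidAct_tmul]
      induction cA (x ⊗ₜ a) with
      | zero => simp
      | add x y hx hy => simp only [map_add, TensorProduct.add_tmul, hx, hy]
      | tmul a b => simp [mul_assoc]

/-- This is `Δ(p) Δ(y)` in `A ⊗_c A`, split along `Δ(p) = p ⊗ 1 + 1 ⊗ p`. It allows products of
primitive elements to be treated one letter at a time. -/
theorem comul_prim_mul {p : A} (hp : p ∈ prim K A) (y : A) :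
    comul (R := K) (p * y) = (LinearMap.mulLeft K p).rTensor A (comul (R := K) y) +
      braidAct cA p (comul (R := K) y) := by
  have h := LinearMap.congr_fun hA.comul_mul (p ⊗ₜ y)
  simp only [LinearMap.comp_apply, LinearMap.mul'_apply, TensorProduct.map_tmul] at h
  rw [h, mem_prim.1 hp]
  generalize comul (R := K) y = w
  induction w with
  | zero => simp
  | add x y hx hy =>
    simp only [map_add, TensorProduct.tmul_add, TensorProduct.add_tmul] at *
    rw [add_add_add_comm (LinearMap.rTensor _ _ x), ← hx, ← hy, add_add_add_comm]
  | tmul s t =>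
    simp only [TensorProduct.add_tmul, map_add, LinearEquiv.coe_coe, TensorProduct.assoc_tmul,
      LinearMap.lTensor_tmul, c₁, LinearMap.comp_apply, TensorProduct.assoc_symm_tmul,
      LinearMap.rTensor_tmul, hA.braid_one_left, braidAct_tmul]
    congr 1
    · simp
    · induction cA (p ⊗ₜ s) with
      | zero => simp
      | add x y hx hy => simp only [map_add, TensorProduct.add_tmul, TensorProduct.tmul_add, hx, hy]
      | tmul a b => simp

theorem counit_prim {p : A} (hp : p ∈ prim K A) : counit (R := K) p = 0 := by
  have h := congrArg (fun t => TensorProduct.lid K A ((counit (R := K)).rTensor A t)) (mem_prim.1 hp)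
  simp only [rTensor_counit_comul, map_add, LinearMap.rTensor_tmul, TensorProduct.lid_tmul,
    one_smul, hA.counit_one] at h
  have h2 : counit (R := K) p • (1 : A) = 0 := by simpa using h
  simpa [hA.counit_one] using congrArg (counit (R := K)) h2

/-- The comultiplication of a strand passes through a crossing, so `A ⊗ primDefect` kills `c (p ⊗
x)`; tensoring over a field preserves the kernel that defines `prim`. -/
theorem braid_prim_mem {p : A} (hp : p ∈ prim K A) (x : A) :
    cA (p ⊗ₜ x) ∈ LinearMap.range ((prim K A).subtype.lTensor A) := by
  have hex : Function.Exact ((prim K A).subtype.lTensor A) ((primDefect K A).lTensor A) :=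
    Module.Flat.lTensor_exact A (LinearMap.exact_subtype_ker_map _)
  rw [← LinearMap.exact_iff.1 hex, LinearMap.mem_ker]
  have h := LinearMap.congr_fun hA.braid_comul_left (p ⊗ₜ x)
  simp only [LinearMap.comp_apply, LinearMap.rTensor_tmul, mem_prim.1 hp, TensorProduct.add_tmul,
    map_add, LinearEquiv.coe_coe, TensorProduct.assoc_tmul, c₂, LinearMap.lTensor_tmul,
    hA.braid_one_left, c₁, TensorProduct.assoc_symm_tmul] at h
  rw [primDefect, LinearMap.lTensor_sub, LinearMap.lTensor_sub, LinearMap.sub_apply,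
    LinearMap.sub_apply, h, sub_sub, sub_eq_zero]
  clear h
  congr 1
  · induction cA (p ⊗ₜ x) with
    | zero => simp
    | add x y hx hy => simp only [map_add, TensorProduct.add_tmul, hx, hy]
    | tmul a b => simp
  · induction cA (p ⊗ₜ x) with
    | zero => simp
    | add x y hx hy => simp only [map_add, TensorProduct.tmul_add, hx, hy]
    | tmul a b => simp [hA.braid_one_left]

omit hA

variable (K A) in
/-- `x ↦ x - ε(x) 1` -/
def reduce : A →ₗ[K] A := LinearMap.id - Algebra.linearMap K A ∘ₗ counit

theorem reduce_apply (x : A) : reduce K A x = x - counit (R := K) x • 1 := by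
  simp [reduce, Algebra.algebraMap_eq_smul_one]

include hA

/-- The counit travels with its strand, so it kills both legs of the braided element, where `reduce`
therefore does nothing. -/
theorem reduce_braid {V : Type v} [AddCommGroup V] [Module K V] (j : V →ₗ[K] A)
    (hj : ∀ v, counit (R := K) (j v) = 0) (z : V ⊗[K] V) :
    TensorProduct.map (reduce K A) (reduce K A) (cA (TensorProduct.map j j z)) =
      cA (TensorProduct.map j j z) := by
  have hl : ∀ t : A ⊗[K] A, (reduce K A).rTensor A t =
      t - 1 ⊗ₜ TensorProduct.lid K A ((counit (R := K)).rTensor A t) := by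
    intro t
    induction t with
    | zero => simp
    | add x y hx hy => simp only [map_add, hx, hy, TensorProduct.tmul_add]; abel
    | tmul x y => simp [reduce_apply, TensorProduct.sub_tmul, TensorProduct.smul_tmul']
  have hr : ∀ t : A ⊗[K] A, (reduce K A).lTensor A t =
      t - TensorProduct.rid K A ((counit (R := K)).lTensor A t) ⊗ₜ 1 := by
    intro t
    induction t with
    | zero => simp
    | add x y hx hy => simp only [map_add, hx, hy, TensorProduct.add_tmul]; abel
    | tmul x y => simp [reduce_apply, TensorProduct.tmul_sub, TensorProduct.smul_tmul]
  induction z with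
  | zero => simp
  | add x y hx hy => simp only [map_add, hx, hy]
  | tmul v v' =>
    rw [← LinearMap.rTensor_comp_lTensor, LinearMap.comp_apply, hr, TensorProduct.map_tmul,
      hA.braid_counit_right, hj, zero_smul, TensorProduct.zero_tmul, sub_zero, hl,
      hA.braid_counit_left, hj, zero_smul, TensorProduct.tmul_zero, sub_zero]

/-- The cross terms of `(v ⊗ 1 + 1 ⊗ v)(v' ⊗ 1 + 1 ⊗ v')` are `v ⊗ v'` and `c (v ⊗ v')`. Hence the
product of an element killed by `Id + c` is primitive. -/
theorem comul_mul_prim {V : Type v} [AddCommGroup V] [Module K V] (j : V →ₗ[K] A)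
    (hj : ∀ v, j v ∈ prim K A) (z : V ⊗[K] V) :
    primDefect K A (LinearMap.mul' K A (TensorProduct.map j j z)) =
      TensorProduct.map j j z + cA (TensorProduct.map j j z) := by
  induction z with
  | zero => simp
  | add x y hx hy => simp only [map_add, hx, hy]; abel
  | tmul v v' =>
    simp only [TensorProduct.map_tmul, LinearMap.mul'_apply, primDefect, LinearMap.sub_apply,
      comul_prim_mul hA (hj v), mem_prim.1 (hj v'), map_add, LinearMap.rTensor_tmul,
      LinearMap.mulLeft_apply, mul_one, braidAct_tmul, hA.braid_one_right, LinearMap.mulRight_one,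
      LinearMap.lTensor_id, LinearMap.id_apply, LinearMap.lTensor_tmul, LinearMap.mulRight_apply,
      LinearMap.flip_apply, TensorProduct.mk_apply]
    abel

omit hA

theorem coradFil_mono_succ (hΔ : comul (R := K) (1 : A) = 1 ⊗ₜ 1)
    (h0 : coradFil K A 0 = K ∙ (1 : A)) (n : ℕ) : coradFil K A n ≤ coradFil K A (n + 1) := by
  induction n with
  | zero =>
    rw [h0, Submodule.span_singleton_le_iff_mem, coradFil, Submodule.mem_comap, hΔ]
    exact Submodule.mem_sup_left (tmul_mem_range_lTensor _ (h0 ▸ Submodule.mem_span_singleton_self _))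
  | succ n ih =>
    intro x hx
    rw [coradFil, Submodule.mem_comap] at hx ⊢
    refine (sup_le_sup_right (α := Submodule K (A ⊗[K] A))
      (range_lTensor_le fun x y hy => ?_) _) hx
    exact tmul_mem_range_lTensor x (ih hy)

theorem range_rTensor_coradFil_zero (h0 : coradFil K A 0 = K ∙ (1 : A)) {t : A ⊗[K] A}
    (ht : t ∈ LinearMap.range ((coradFil K A 0).subtype.rTensor A)) : ∃ b : A, t = 1 ⊗ₜ b := by
  obtain ⟨s, rfl⟩ := ht
  induction s with
  | zero => exact ⟨0, by simp⟩
  | add x y hx hy =>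
    obtain ⟨b, hb⟩ := hx
    obtain ⟨b', hb'⟩ := hy
    exact ⟨b + b', by rw [map_add, hb, hb', TensorProduct.tmul_add]⟩
  | tmul x y =>
    have hx : (x : A) ∈ K ∙ (1 : A) := h0 ▸ x.2
    obtain ⟨r, hr⟩ := Submodule.mem_span_singleton.1 hx
    exact ⟨r • y, by rw [LinearMap.rTensor_tmul, Submodule.subtype_apply, ← hr,
      TensorProduct.smul_tmul]⟩

/-- With `A_0 = K·1` the part of `Δ(a)` in `A_0 ⊗ A` is some `1 ⊗ b`, and `ε ⊗ A` shows that `b` and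
`a` differ by an element of `A_n`. -/
theorem mem_coradFil_succ (h1 : counit (R := K) (1 : A) = 1)
    (h0 : coradFil K A 0 = K ∙ (1 : A)) {n : ℕ} {a : A} :
    a ∈ coradFil K A (n + 1) ↔ comul (R := K) a - 1 ⊗ₜ a ∈
      LinearMap.range ((coradFil K A n).subtype.lTensor A) := by
  constructor
  · intro ha
    rw [coradFil, Submodule.mem_comap] at ha
    obtain ⟨t, ht, s, hs, hts⟩ := Submodule.mem_sup.1 ha
    obtain ⟨b, rfl⟩ := range_rTensor_coradFil_zero h0 hs
    have h := congrArg (fun t => TensorProduct.lid K A ((counit (R := K)).rTensor A t)) hts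
    simp only [map_add, LinearMap.rTensor_tmul, TensorProduct.lid_tmul, rTensor_counit_comul,
      one_smul] at h
    rw [h1, one_smul] at h
    rw [← hts, ← h, TensorProduct.tmul_add, add_sub_add_right_eq_sub]
    exact sub_mem ht (tmul_mem_range_lTensor 1 (rTensor_apply_mem_range_lTensor ht _))
  · intro h
    rw [coradFil, Submodule.mem_comap, ← sub_add_cancel (comul (R := K) a) (1 ⊗ₜ a)]
    exact Submodule.add_mem_sup h
      ⟨⟨1, h0 ▸ Submodule.mem_span_singleton_self 1⟩ ⊗ₜ a, by simp⟩

/-- For `a ∈ A_1` one has `Δ(a) = 1 ⊗ a + x ⊗ 1`, and `A ⊗ ε` identifies `x` with `a - ε(a) 1`. -/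
theorem reduce_mem_prim (hΔ : comul (R := K) (1 : A) = 1 ⊗ₜ 1)
    (h1 : counit (R := K) (1 : A) = 1) (h0 : coradFil K A 0 = K ∙ (1 : A))
    {a : A} (ha : a ∈ coradFil K A 1) : reduce K A a ∈ prim K A := by
  rw [mem_coradFil_succ h1 h0] at ha
  obtain ⟨x, hx⟩ : ∃ x : A, comul (R := K) a - 1 ⊗ₜ a = x ⊗ₜ 1 := by
    obtain ⟨s, hs⟩ := ha
    rw [← hs]
    clear hs
    induction s with
    | zero => exact ⟨0, by simp⟩
    | add x y hx hy =>
      obtain ⟨b, hb⟩ := hx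
      obtain ⟨b', hb'⟩ := hy
      exact ⟨b + b', by rw [map_add, hb, hb', TensorProduct.add_tmul]⟩
    | tmul x y =>
      have hy : (y : A) ∈ K ∙ (1 : A) := h0 ▸ y.2
      obtain ⟨r, hr⟩ := Submodule.mem_span_singleton.1 hy
      exact ⟨r • x, by rw [LinearMap.lTensor_tmul, Submodule.subtype_apply, ← hr,
        TensorProduct.smul_tmul]⟩
  rw [sub_eq_iff_eq_add] at hx
  have h := congrArg (fun t => TensorProduct.rid K A ((counit (R := K)).lTensor A t)) hx
  simp only [map_add, LinearMap.lTensor_tmul, TensorProduct.rid_tmul, lTensor_counit_comul,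
    one_smul, h1] at h
  have hr : reduce K A a = x := by rw [reduce_apply, sub_eq_iff_eq_add, ← h]
  rw [mem_prim, reduce_apply, map_sub, hx, map_smul, hΔ, ← reduce_apply, hr]
  nth_rw 1 [h]
  rw [TensorProduct.tmul_add, TensorProduct.tmul_smul]
  abel

theorem prim_le_coradFil_one (h1 : counit (R := K) (1 : A) = 1)
    (h0 : coradFil K A 0 = K ∙ (1 : A)) : prim K A ≤ coradFil K A 1 := by
  intro x hx
  rw [mem_coradFil_succ h1 h0, mem_prim.1 hx, add_sub_cancel_right]
  exact tmul_mem_range_lTensor x (h0 ▸ Submodule.mem_span_singleton_self 1)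

include hA

/-- In `(1 ⊗ p) Δ(a)` the factor `p` crosses the left leg and is still primitive afterwards
(`braid_prim_mem`), so by induction it raises a right leg by one step. The summand `1 ⊗ a` of `Δ(a)`
yields the `1 ⊗ p a` that `mem_coradFil_succ` subtracts. -/
theorem prim_mul_mem_coradFil (h0 : coradFil K A 0 = K ∙ (1 : A)) {p : A} (hp : p ∈ prim K A)
    (n : ℕ) {a : A} (ha : a ∈ coradFil K A n) : p * a ∈ coradFil K A (n + 1) := by
  induction n generalizing p a with
  | zero =>
    obtain ⟨r, rfl⟩ := Submodule.mem_span_singleton.1 (h0 ▸ ha : a ∈ K ∙ (1 : A))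
    rw [mul_smul_comm, mul_one]
    exact Submodule.smul_mem _ _ (prim_le_coradFil_one hA.counit_one h0 hp)
  | succ n ih =>
    have hmono : LinearMap.range ((coradFil K A n).subtype.lTensor A) ≤
        LinearMap.range ((coradFil K A (n + 1)).subtype.lTensor A) :=
      range_lTensor_le fun x y hy =>
        tmul_mem_range_lTensor x (coradFil_mono_succ hA.comul_one h0 n hy)
    have har := (mem_coradFil_succ hA.counit_one h0).1 ha
    rw [mem_coradFil_succ hA.counit_one h0, comul_prim_mul hA hp]
    obtain ⟨r, hr⟩ : ∃ r, comul (R := K) a - 1 ⊗ₜ a = r := ⟨_, rfl⟩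
    rw [hr] at har
    rw [sub_eq_iff_eq_add] at hr
    have h1 : braidAct cA p (1 ⊗ₜ a) = 1 ⊗ₜ (p * a) := by
      simp [braidAct_tmul, hA.braid_one_right]
    rw [hr, map_add, map_add, h1, ← add_assoc, add_sub_cancel_right, LinearMap.rTensor_tmul,
      LinearMap.mulLeft_apply, mul_one]
    refine add_mem (add_mem ?_ (tmul_mem_range_lTensor p ha)) ?_
    · exact range_lTensor_le (L := (LinearMap.range ((coradFil K A (n + 1)).subtype.lTensor A)).comap
        ((LinearMap.mulLeft K p).rTensor A))
        (fun x y hy => hmono (tmul_mem_range_lTensor (p * x) hy)) har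
    · refine range_lTensor_le (L := (LinearMap.range
        ((coradFil K A (n + 1)).subtype.lTensor A)).comap (braidAct cA p)) (fun x y hy => ?_) har
      rw [Submodule.mem_comap, braidAct_tmul]
      exact range_lTensor_le (L := (LinearMap.range
        ((coradFil K A (n + 1)).subtype.lTensor A)).comap ((LinearMap.mulRight K y).lTensor A))
        (fun u q hq => tmul_mem_range_lTensor u (ih hq hy)) (braid_prim_mem hA hp x)

end Primitive

/-! ### The braided symmetric algebra -/

section SymFacts

variable {K : Type u} [Field K] {V : Type v} [AddCommGroup V] [Module K V]

theorem tensorAlgebra_induction_left {p : TensorAlgebra K V → Prop} (one : p 1)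
    (smul : ∀ (r : K) s, p s → p (r • s)) (add : ∀ s t, p s → p t → p (s + t))
    (ι_mul : ∀ v s, p s → p (TensorAlgebra.ι K v * s)) (t : TensorAlgebra K V) : p t := by
  suffices ∀ s, p s → p (t * s) by simpa using this 1 one
  induction t using TensorAlgebra.induction with
  | algebraMap r => intro s hs; rw [← Algebra.smul_def]; exact smul r s hs
  | ι v => exact ι_mul v
  | mul a b ha hb => intro s hs; rw [mul_assoc]; exact ha _ (hb s hs)
  | add a b ha hb => intro s hs; rw [add_mul]; exact add _ _ (ha s hs) (hb s hs)

variable (c : V ⊗[K] V →ₗ[K] V ⊗[K] V)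

theorem tensorComul_one : tensorComul c 1 = 1 ⊗ₜ 1 := by simp [tensorComul]

theorem tensorComul_ι_mul (v : V) (s : TensorAlgebra K V) :
    tensorComul c (TensorAlgebra.ι K v * s) =
      leftAct v (tensorComul c s) + letterAct c v (tensorComul c s) := by
  simp [tensorComul, comulAct]

theorem tensorComul_ι (v : V) : tensorComul c (TensorAlgebra.ι K v) =
    TensorAlgebra.ι K v ⊗ₜ 1 + 1 ⊗ₜ TensorAlgebra.ι K v := by
  rw [← mul_one (TensorAlgebra.ι K v), tensorComul_ι_mul, tensorComul_one, leftAct_apply,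
    letterAct_tmul, braidVT_one]
  simp

theorem tensorBraiding_ι (z : V ⊗[K] V) :
    tensorBraiding c (TensorProduct.map (TensorAlgebra.ι K) (TensorAlgebra.ι K) z) =
      TensorProduct.map (TensorAlgebra.ι K) (TensorAlgebra.ι K) (c z) := by
  induction z with
  | zero => simp
  | add x y hx hy => simp only [map_add, hx, hy]
  | tmul v w =>
    rw [TensorProduct.map_tmul, tensorBraiding_tmul, wordAct, TensorAlgebra.lift_ι_apply,
      letterAct_tmul, braidVT_ι, LinearMap.mulRight_one, LinearMap.id_comp, ← LinearMap.comp_apply,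
      LinearMap.lTensor_comp_rTensor]

variable (K V) in
/-- The words of length less than `n`. -/
def wordFil : ℕ → Submodule K (TensorAlgebra K V)
  | 0 => ⊥
  | n + 1 => 1 ⊔ LinearMap.range (TensorAlgebra.ι K (M := V)) * wordFil n

theorem wordFil_mono_succ (n : ℕ) : wordFil K V n ≤ wordFil K V (n + 1) := by
  induction n with
  | zero => exact bot_le
  | succ n ih => rw [wordFil, wordFil]; exact sup_le_sup_left (mul_le_mul' le_rfl ih) _

theorem exists_mem_wordFil (t : TensorAlgebra K V) : ∃ n, t ∈ wordFil K V n := by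
  have mono : Monotone (wordFil K V) := monotone_nat_of_le_succ wordFil_mono_succ
  induction t using tensorAlgebra_induction_left with
  | one => exact ⟨1, Submodule.mem_sup_left (Submodule.one_le.1 le_rfl)⟩
  | smul r s hs => obtain ⟨n, hn⟩ := hs; exact ⟨n, Submodule.smul_mem _ r hn⟩
  | add s t hs ht =>
    obtain ⟨n, hn⟩ := hs
    obtain ⟨m, hm⟩ := ht
    exact ⟨max n m, add_mem (mono (le_max_left n m) hn) (mono (le_max_right n m) hm)⟩
  | ι_mul v s hs =>
    obtain ⟨n, hn⟩ := hs
    exact ⟨n + 1, Submodule.mem_sup_right (Submodule.mul_mem_mul ⟨v, rfl⟩ hn)⟩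

/-- Connectedness of the tensor algebra, with word length in the role of the coradical filtration.
The index is shifted by one: `wordFil K V (n + 1)` holds the words of length at most `n`, and the
right legs other than that of `1 ⊗ t` are shorter than `n`. -/
theorem tensorComul_sub_mem (n : ℕ) {t : TensorAlgebra K V} (ht : t ∈ wordFil K V (n + 1)) :
    tensorComul c t - 1 ⊗ₜ t ∈
      LinearMap.range ((wordFil K V n).subtype.lTensor (TensorAlgebra K V)) := by
  induction n generalizing t with
  | zero =>
    have h1 : t ∈ (1 : Submodule K (TensorAlgebra K V)) := by simpa [wordFil] using ht
    obtain ⟨r, rfl⟩ := Submodule.mem_one.1 h1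
    simp [Algebra.algebraMap_eq_smul_one, tensorComul_one]
  | succ n ih =>
    have hmono : LinearMap.range ((wordFil K V n).subtype.lTensor (TensorAlgebra K V)) ≤
        LinearMap.range ((wordFil K V (n + 1)).subtype.lTensor (TensorAlgebra K V)) :=
      range_lTensor_le fun x y hy => tmul_mem_range_lTensor x (wordFil_mono_succ n hy)
    rw [wordFil] at ht
    obtain ⟨a, ha, b, hb, rfl⟩ := Submodule.mem_sup.1 ht
    rw [map_add, TensorProduct.tmul_add, add_sub_add_comm]
    refine add_mem ?_ ?_
    · obtain ⟨r, rfl⟩ := Submodule.mem_one.1 ha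
      simp [Algebra.algebraMap_eq_smul_one, tensorComul_one]
    · refine Submodule.mul_induction_on hb ?_ ?_
      · rintro _ ⟨v, rfl⟩ s hs
        have hrm := ih hs
        obtain ⟨r, hr⟩ : ∃ r, tensorComul c s - 1 ⊗ₜ s = r := ⟨_, rfl⟩
        rw [hr] at hrm
        rw [sub_eq_iff_eq_add] at hr
        have h1 : letterAct c v (1 ⊗ₜ s) = 1 ⊗ₜ (TensorAlgebra.ι K v * s) := by
          simp [letterAct_tmul, braidVT_one]
        rw [tensorComul_ι_mul, hr, map_add, map_add, h1, ← add_assoc, add_sub_cancel_right,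
          leftAct_apply, leftAct_apply, LinearMap.rTensor_tmul, LinearMap.mulLeft_apply, mul_one]
        refine add_mem (add_mem ?_ (tmul_mem_range_lTensor _ hs)) ?_
        · exact range_lTensor_le (L := (LinearMap.range
            ((wordFil K V (n + 1)).subtype.lTensor _)).comap
              ((LinearMap.mulLeft K (TensorAlgebra.ι K v)).rTensor _))
            (fun x y hy => hmono (tmul_mem_range_lTensor _ hy)) hrm
        · refine range_lTensor_le (L := (LinearMap.range
            ((wordFil K V (n + 1)).subtype.lTensor _)).comap (letterAct c v))
              (fun x y hy => ?_) hrm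
          rw [Submodule.mem_comap, letterAct_tmul]
          refine map_mem_of_tmul _ _ (fun u q => ?_) _
          exact tmul_mem_range_lTensor u
            (Submodule.mem_sup_right (Submodule.mul_mem_mul ⟨q, rfl⟩ hy))
      · intro x y hx hy
        rw [map_add, TensorProduct.tmul_add, add_sub_add_comm]
        exact add_mem hx hy

variable {c} {lam : K} (hc : IsBraiding c) (hH : IsHecke c lam)

theorem symProj_one : symProj c lam (1 : TensorAlgebra K V) = 1 := rfl

theorem symMaps_comul_symProj (t : TensorAlgebra K V) : (symMaps hc hH).comul (symProj c lam t) =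
    TensorProduct.map (symProj c lam) (symProj c lam) (tensorComul c t) :=
  descend_apply _ _ _ _ t

theorem symMaps_counit_symProj (t : TensorAlgebra K V) : (symMaps hc hH).counit (symProj c lam t) =
    TensorAlgebra.algebraMapInv t :=
  descend_apply _ _ _ _ t

theorem symMaps_braiding_map (z : TensorAlgebra K V ⊗[K] TensorAlgebra K V) :
    (symMaps hc hH).braiding (TensorProduct.map (symProj c lam) (symProj c lam) z) =
      TensorProduct.map (symProj c lam) (symProj c lam) (tensorBraiding c z) :=
  descend_apply _ _ _ _ z

/-- The relations are quadratic, so they die in the square-zero extension `K ⊕ V`, where `v` can be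
read off. -/
theorem symProj_ι_injective :
    Function.Injective (symProj c lam ∘ₗ TensorAlgebra.ι K (M := V)) := by
  -- The square-zero extension takes a bimodule; the right action is the left one.
  let _ : Module Kᵐᵒᵖ V := Module.compHom V ((RingHom.id K).fromOpposite mul_comm)
  have _ : IsCentralScalar K V := ⟨fun _ _ => rfl⟩
  let φ : TensorAlgebra K V →ₐ[K] TrivSqZeroExt K V :=
    TensorAlgebra.lift K (TrivSqZeroExt.inrHom K V)
  have hsq : ∀ z : V ⊗[K] V, φ (sq z) = 0 := by
    intro z
    induction z with
    | zero => simp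
    | add x y hx hy => simp only [map_add, hx, hy, add_zero]
    | tmul v w => simp [sq, φ]
  have hI : ∀ x ∈ symIdeal c lam, φ x = 0 := fun x hx => by
    refine symIdeal_induction c lam (p := fun x => φ x = 0) ?_ ?_ ?_ ?_ ?_ ?_ hx
    · intro z; simp [symRel, hsq]
    · simp
    · intro x y hx hy; simp [hx, hy]
    · intro x hx; simp [hx]
    · intro a x _ hx; simp [hx]
    · intro a x _ hx; simp [hx]
  rw [← LinearMap.ker_eq_bot, LinearMap.ker_eq_bot']
  intro v hv
  have h := hI (TensorAlgebra.ι K v) (Ideal.Quotient.eq_zero_iff_mem.1 hv)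
  simpa [φ] using congrArg TrivSqZeroExt.snd h

end SymFacts

/-! ### Morphisms from the tensor algebra -/

section Lift

variable {K : Type u} [Field K] {V : Type v} [AddCommGroup V] [Module K V]
  {c : V ⊗[K] V →ₗ[K] V ⊗[K] V} {A : Type w} [Ring A] [Algebra K A] [Coalgebra K A]
  {cA : A ⊗[K] A →ₗ[K] A ⊗[K] A} (hA : IsBraidedBialgebra cA) (j : V →ₗ[K] A)
  (hj : ∀ v, j v ∈ prim K A)
  (hjc : ∀ z, cA (TensorProduct.map j j z) = TensorProduct.map j j (c z))

open Coalgebra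

include hA hjc in
-- `braid_mul_right` in `A` is the same recursion on products of words as the one that governs
-- `braidVT`, and `hjc` is the agreement on letters.
theorem map_lift_braidVT (v : V) (s : TensorAlgebra K V) :
    TensorProduct.map (TensorAlgebra.lift K j).toLinearMap j (braidVT c (v ⊗ₜ s)) =
      cA (j v ⊗ₜ TensorAlgebra.lift K j s) := by
  induction s using TensorAlgebra.induction generalizing v with
  | algebraMap r =>
    simp [Algebra.algebraMap_eq_smul_one, braidVT_one, hA.braid_one_right]
  | ι w =>
    rw [braidVT_ι, TensorAlgebra.lift_ι_apply, ← TensorProduct.map_tmul, hjc,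
      ← LinearMap.comp_apply, LinearMap.map_comp_rTensor]
    congr 2
    ext; simp
  | mul a b ha hb =>
    have key : ∀ y, TensorProduct.map (TensorAlgebra.lift K j).toLinearMap j
        ((crossWord c b).unop y) = (LinearMap.mul' K A).rTensor A
          ((TensorProduct.assoc K A A A).symm (cA.lTensor A (TensorProduct.assoc K A A A
            (TensorProduct.map (TensorAlgebra.lift K j).toLinearMap j y ⊗ₜ
              TensorAlgebra.lift K j b)))) := by
      intro y
      induction y with
      | zero => simp
      | add x y hx hy => simp only [map_add, TensorProduct.add_tmul, hx, hy]
      | tmul t u =>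
        rw [crossWord_tmul, TensorProduct.map_tmul, TensorProduct.assoc_tmul,
          LinearMap.lTensor_tmul, ← hb]
        induction braidVT c (u ⊗ₜ b) with
        | zero => simp
        | add x y hx hy => simp only [map_add, TensorProduct.tmul_add, hx, hy]
        | tmul x y => simp
    rw [braidVT_mul, key, ha, map_mul]
    have h := LinearMap.congr_fun hA.braid_mul_right
      (j v ⊗ₜ (TensorAlgebra.lift K j a ⊗ₜ TensorAlgebra.lift K j b))
    simp only [LinearMap.comp_apply, LinearMap.lTensor_tmul, LinearMap.mul'_apply, c₁, c₂,
      LinearEquiv.coe_coe, TensorProduct.assoc_symm_tmul, LinearMap.rTensor_tmul] at h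
    exact h.symm
  | add a b ha hb => simp only [map_add, TensorProduct.tmul_add, ha, hb]

include hA hjc in
theorem map_lift_letterAct (v : V) (y : TensorAlgebra K V ⊗[K] TensorAlgebra K V) :
    TensorProduct.map (TensorAlgebra.lift K j).toLinearMap (TensorAlgebra.lift K j).toLinearMap
      (letterAct c v y) = braidAct cA (j v) (TensorProduct.map (TensorAlgebra.lift K j).toLinearMap
        (TensorAlgebra.lift K j).toLinearMap y) := by
  induction y with
  | zero => simp
  | add x y hx hy => simp only [map_add, hx, hy]
  | tmul s t =>
    rw [letterAct_tmul, TensorProduct.map_tmul, braidAct_tmul, AlgHom.toLinearMap_apply,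
      AlgHom.toLinearMap_apply, ← map_lift_braidVT hA j hjc]
    induction braidVT c (v ⊗ₜ s) with
    | zero => simp
    | add x y hx hy => simp only [map_add, hx, hy]
    | tmul x y => simp

include hA hjc in
theorem map_lift_wordAct (a : TensorAlgebra K V) (y : TensorAlgebra K V ⊗[K] TensorAlgebra K V) :
    TensorProduct.map (TensorAlgebra.lift K j).toLinearMap (TensorAlgebra.lift K j).toLinearMap
      (wordAct c a y) = braidAct cA (TensorAlgebra.lift K j a)
        (TensorProduct.map (TensorAlgebra.lift K j).toLinearMap
          (TensorAlgebra.lift K j).toLinearMap y) := by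
  induction a using TensorAlgebra.induction generalizing y with
  | algebraMap r =>
    simp [Algebra.algebraMap_eq_smul_one, braidAct_one hA]
  | ι v => rw [wordAct, TensorAlgebra.lift_ι_apply, map_lift_letterAct hA j hjc,
      TensorAlgebra.lift_ι_apply]
  | mul a b ha hb => rw [map_mul, map_mul, Module.End.mul_apply, ha, hb, braidAct_mul hA]
  | add a b ha hb => simp only [map_add, LinearMap.add_apply, ha, hb]

include hA hjc in
theorem map_lift_tensorBraiding (z : TensorAlgebra K V ⊗[K] TensorAlgebra K V) :
    TensorProduct.map (TensorAlgebra.lift K j).toLinearMap (TensorAlgebra.lift K j).toLinearMap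
      (tensorBraiding c z) = cA (TensorProduct.map (TensorAlgebra.lift K j).toLinearMap
        (TensorAlgebra.lift K j).toLinearMap z) := by
  induction z with
  | zero => simp
  | add x y hx hy => simp only [map_add, hx, hy]
  | tmul a s =>
    rw [tensorBraiding_tmul, map_lift_wordAct hA j hjc, TensorProduct.map_tmul, braidAct_tmul]
    simp

include hA hjc hj in
theorem map_lift_tensorComul (t : TensorAlgebra K V) :
    TensorProduct.map (TensorAlgebra.lift K j).toLinearMap (TensorAlgebra.lift K j).toLinearMap
      (tensorComul c t) = comul (R := K) (TensorAlgebra.lift K j t) := by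
  induction t using tensorAlgebra_induction_left with
  | one => simp [tensorComul_one, hA.comul_one]
  | smul r s hs => simp only [map_smul, hs]
  | add s t hs ht => simp only [map_add, hs, ht]
  | ι_mul v s hs =>
    rw [tensorComul_ι_mul, map_add, map_lift_letterAct hA j hjc, hs, map_mul,
      TensorAlgebra.lift_ι_apply, comul_prim_mul hA (hj v), ← hs, leftAct_apply]
    congr 1
    generalize tensorComul c s = w
    induction w with
    | zero => simp
    | add x y hx hy => simp only [map_add, hx, hy]
    | tmul x y => simp

include hA hj in
theorem counit_lift (t : TensorAlgebra K V) :
    counit (R := K) (TensorAlgebra.lift K j t) = TensorAlgebra.algebraMapInv t := by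
  induction t using tensorAlgebra_induction_left with
  | one => simp [hA.counit_one]
  | smul r s hs => simp only [map_smul, hs]
  | add s t hs ht => simp only [map_add, hs, ht]
  | ι_mul v s hs =>
    rw [map_mul, hA.counit_mul, TensorAlgebra.lift_ι_apply, counit_prim hA (hj v), map_mul]
    simp [TensorAlgebra.algebraMapInv]

/-- The algebra morphism from the braided symmetric algebra that extends a linear map. -/
def symLift (lam : K) (hrel : ∀ z, LinearMap.mul' K A (TensorProduct.map j j (c z - lam • z)) = 0) :
    BraidedSym c lam →ₐ[K] A :=
  Ideal.Quotient.liftₐ (symIdeal c lam) (TensorAlgebra.lift K j) fun x hx => by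
    have hsq : ∀ z : V ⊗[K] V, TensorAlgebra.lift K j (sq z) =
        LinearMap.mul' K A (TensorProduct.map j j z) := by
      intro z
      induction z with
      | zero => simp
      | add x y hx hy => simp only [map_add, hx, hy]
      | tmul v w => simp [sq]
    refine symIdeal_induction c lam (p := fun x => TensorAlgebra.lift K j x = 0)
      ?_ ?_ ?_ ?_ ?_ ?_ hx
    · intro z
      rw [← hrel z, ← hsq]
      simp [symRel]
    · simp
    · intro x y hx hy; simp [hx, hy]
    · intro x hx; simp [hx]
    · intro a x _ hx; simp [hx]
    · intro a x _ hx; simp [hx]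

omit [Coalgebra K A] in
theorem symLift_symProj (lam : K)
    (hrel : ∀ z, LinearMap.mul' K A (TensorProduct.map j j (c z - lam • z)) = 0)
    (t : TensorAlgebra K V) : symLift j lam hrel (symProj c lam t) = TensorAlgebra.lift K j t := rfl

/-- The inverse of an isomorphism of braided bialgebras. -/
def StructureMaps.Iso.symm {B : Type*} [AddCommGroup B] [Module K B] {B' : Type*} [AddCommGroup B']
    [Module K B'] {D : StructureMaps K B} {D' : StructureMaps K B'} (e : D.Iso D') : D'.Iso D := by
  have hs : TensorProduct.map e.equiv.symm.toLinearMap e.equiv.symm.toLinearMap ∘ₗ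
      TensorProduct.map e.equiv.toLinearMap e.equiv.toLinearMap = LinearMap.id := by
    rw [← TensorProduct.map_comp, ← TensorProduct.map_id]
    congr 1 <;> ext <;> simp
  have hsur : Function.Surjective (TensorProduct.map e.equiv.toLinearMap e.equiv.toLinearMap) :=
    TensorProduct.map_surjective e.equiv.surjective e.equiv.surjective
  have hs' : ∀ z, TensorProduct.map e.equiv.symm.toLinearMap e.equiv.symm.toLinearMap
      (TensorProduct.map e.equiv.toLinearMap e.equiv.toLinearMap z) = z := LinearMap.congr_fun hs
  refine ⟨e.equiv.symm, LinearMap.ext fun z => ?_, ?_, LinearMap.ext fun z => ?_,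
    LinearMap.ext fun z => ?_, LinearMap.ext fun z => ?_⟩
  · obtain ⟨z, rfl⟩ := hsur z
    have h := LinearMap.congr_fun e.map_mul z
    simp only [LinearMap.comp_apply] at h ⊢
    rw [← h, hs']
    simp
  · rw [← e.map_one, LinearEquiv.symm_apply_apply]
  · obtain ⟨z, rfl⟩ := e.equiv.surjective z
    have h := LinearMap.congr_fun e.map_comul z
    simp only [LinearMap.comp_apply, LinearEquiv.coe_coe] at h ⊢
    rw [← h, hs']
    simp
  · obtain ⟨z, rfl⟩ := e.equiv.surjective z
    have h := LinearMap.congr_fun e.map_counit z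
    simp only [LinearMap.comp_apply, LinearEquiv.coe_coe] at h ⊢
    rw [h]
    simp
  · obtain ⟨z, rfl⟩ := hsur z
    have h := LinearMap.congr_fun e.map_braiding z
    simp only [LinearMap.comp_apply] at h ⊢
    rw [← h, hs', hs']

/-- If the algebra morphism that extends a braided linear map into the primitive elements is
bijective, then it is an isomorphism of braided bialgebras. -/
def symIso {lam : K} (hc : IsBraiding c) (hH : IsHecke c lam) (hA : IsBraidedBialgebra cA)
    (hj : ∀ v, j v ∈ prim K A)
    (hjc : ∀ z, cA (TensorProduct.map j j z) = TensorProduct.map j j (c z))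
    (hrel : ∀ z, LinearMap.mul' K A (TensorProduct.map j j (c z - lam • z)) = 0)
    (hbij : Function.Bijective (symLift j lam hrel)) :
    (symMaps hc hH).Iso (structureMaps cA) := by
  let f : BraidedSym c lam →ₗ[K] A := (symLift j lam hrel).toLinearMap
  have hf : f ∘ₗ symProj c lam = (TensorAlgebra.lift K j).toLinearMap := rfl
  have hmap : ∀ z, TensorProduct.map f f (TensorProduct.map (symProj c lam) (symProj c lam) z) =
      TensorProduct.map (TensorAlgebra.lift K j).toLinearMap
        (TensorAlgebra.lift K j).toLinearMap z := fun z => by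
    rw [← LinearMap.comp_apply, ← TensorProduct.map_comp, hf]
  refine ⟨LinearEquiv.ofBijective f hbij, ?_, ?_, ?_, ?_, ?_⟩
  · refine TensorProduct.ext' fun x y => ?_
    exact map_mul (symLift j lam hrel) x y
  · exact map_one (symLift j lam hrel)
  · refine LinearMap.ext fun x => ?_
    obtain ⟨t, rfl⟩ := symProj_surjective x
    change TensorProduct.map f f ((symMaps hc hH).comul _) = comul (TensorAlgebra.lift K j t)
    rw [symMaps_comul_symProj, hmap, map_lift_tensorComul hA j hj hjc]
  · refine LinearMap.ext fun x => ?_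
    obtain ⟨t, rfl⟩ := symProj_surjective x
    change counit (TensorAlgebra.lift K j t) = (symMaps hc hH).counit _
    rw [symMaps_counit_symProj, counit_lift hA j hj]
  · refine LinearMap.ext fun x => ?_
    obtain ⟨z, rfl⟩ := TensorProduct.map_surjective symProj_surjective symProj_surjective x
    change TensorProduct.map f f ((symMaps hc hH).braiding _) = cA (TensorProduct.map f f _)
    rw [symMaps_braiding_map, hmap, hmap, map_lift_tensorBraiding hA j hjc]

end Lift

/-! ### The associated graded braided bialgebra -/

section Junk

variable {K : Type u} [Field K] {M M' X N N' : Type*} [AddCommMonoid M] [Module K M]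
  [AddCommMonoid M'] [Module K M'] [AddCommMonoid X] [Module K X]
  [AddCommMonoid N] [Module K N] [AddCommMonoid N'] [Module K N']

/-- Multiplication, unit, comultiplication and braiding of `gr A` are built from `induced` maps.
Splitting on this dichotomy replaces a proof that the coradical filtration is compatible with the
structure of `A`. -/
theorem isInduced_induced_or_eq_zero (p : M →ₗ[K] M') (f : M →ₗ[K] X) (ι : N →ₗ[K] X)
    (q : N →ₗ[K] N') : IsInduced p f ι q (induced p f ι q) ∨ induced p f ι q = 0 := by
  by_cases h : ∃ g, IsInduced p f ι q g
  · left
    rw [induced, dif_pos h]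
    exact h.choose_spec
  · right
    rw [induced, dif_neg h]

end Junk

theorem directSum_induction {K ι : Type*} [Semiring K] [DecidableEq ι] {M : ι → Type*}
    [∀ i, AddCommMonoid (M i)] [∀ i, Module K (M i)] {p : DirectSum ι M → Prop}
    (x : DirectSum ι M) (zero : p 0) (of : ∀ i y, p (DirectSum.lof K ι M i y))
    (add : ∀ x y, p x → p y → p (x + y)) : p x :=
  DirectSum.induction_on x zero of add

/-! ### The structure maps of `gr A` on homogeneous elements -/

section GrMaps

variable {K : Type u} [Field K] {A : Type w} [Ring A] [Algebra K A] [Coalgebra K A]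
  (cA : A ⊗[K] A →ₗ[K] A ⊗[K] A)

open Coalgebra DirectSum

theorem grMaps_mul_grι (n m : ℕ) (x : GrPiece K A n) (y : GrPiece K A m) :
    (grMaps cA).mul (grι K A n x ⊗ₜ grι K A m y) = grι K A (n + m) (grMul K A n m (x ⊗ₜ y)) := by
  simp only [grMaps, grι, LinearMap.comp_apply, LinearEquiv.coe_coe,
    TensorProduct.directSum_lof_tmul_lof, DirectSum.toModule_lof]

theorem grMaps_braiding_grι (n m : ℕ) (z : GrPiece K A n ⊗[K] GrPiece K A m) :
    (grMaps cA).braiding (TensorProduct.map (grι K A n) (grι K A m) z) =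
      TensorProduct.map (grι K A m) (grι K A n) (grBraiding cA n m z) := by
  induction z with
  | zero => simp
  | add x y hx hy => simp only [map_add, hx, hy]
  | tmul x y =>
    simp only [TensorProduct.map_tmul, grMaps, grι, LinearMap.comp_apply, LinearEquiv.coe_coe,
      TensorProduct.directSum_lof_tmul_lof, DirectSum.toModule_lof]

theorem grMaps_comul_grι (n : ℕ) (x : GrPiece K A n) : (grMaps cA).comul (grι K A n x) =
    DirectSum.toModule K (Finset.HasAntidiagonal.antidiagonal n) (Gr K A ⊗[K] Gr K A) (fun ij =>
      TensorProduct.map (grι K A ij.1.1) (grι K A ij.1.2)) (grComul K A n x) := by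
  simp only [grMaps, grι, DirectSum.toModule_lof, LinearMap.comp_apply]

theorem grMaps_counit_grι (n : ℕ) (x : GrPiece K A n) :
    (grMaps cA).counit (grι K A n x) = grCounit K A n x := by
  simp only [grMaps, grι, DirectSum.toModule_lof]

variable (K A) in
/-- The projection `gr A → gr^n A`. -/
abbrev grπ (n : ℕ) : Gr K A →ₗ[K] GrPiece K A n := DirectSum.component K ℕ (GrPiece K A) n

theorem grπ_grι_self (n : ℕ) (x : GrPiece K A n) : grπ K A n (grι K A n x) = x :=
  DirectSum.component.lof_self K n x

theorem grπ_grι_of_ne {n m : ℕ} (h : n ≠ m) (x : GrPiece K A n) :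
    grπ K A m (grι K A n x) = 0 := by
  rw [grπ, grι, DirectSum.component.of, dif_neg h]

theorem map_grπ_comul_grι (n : ℕ) (x : GrPiece K A n)
    (ij : Finset.HasAntidiagonal.antidiagonal n) :
    TensorProduct.map (grπ K A ij.1.1) (grπ K A ij.1.2) ((grMaps cA).comul (grι K A n x)) =
      DirectSum.component K _ _ ij (grComul K A n x) := by
  rw [grMaps_comul_grι]
  refine directSum_induction (K := K) (p := fun t => TensorProduct.map (grπ K A ij.1.1)
    (grπ K A ij.1.2) (DirectSum.toModule K (Finset.HasAntidiagonal.antidiagonal n)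
      (Gr K A ⊗[K] Gr K A) (fun ij => TensorProduct.map (grι K A ij.1.1) (grι K A ij.1.2)) t) =
        DirectSum.component K _ _ ij t) (grComul K A n x) ?_ (fun kl w => ?_) ?_
  · simp
  · rw [DirectSum.toModule_lof]
    by_cases h : kl = ij
    · subst h
      rw [DirectSum.component.lof_self, ← LinearMap.comp_apply, ← TensorProduct.map_comp]
      convert LinearMap.id_apply w
      rw [← TensorProduct.map_id]
      congr 1 <;> exact LinearMap.ext (grπ_grι_self _)
    · rw [DirectSum.component.of, dif_neg h, ← LinearMap.comp_apply, ← TensorProduct.map_comp]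
      have hne : kl.1.1 ≠ ij.1.1 ∨ kl.1.2 ≠ ij.1.2 := by
        by_contra! hh
        exact h (Subtype.ext (Prod.ext hh.1 hh.2))
      rcases hne with hne | hne
      · have : grπ K A ij.1.1 ∘ₗ grι K A kl.1.1 = 0 := LinearMap.ext (grπ_grι_of_ne hne)
        rw [this, TensorProduct.map_zero_left, LinearMap.zero_apply]
      · have : grπ K A ij.1.2 ∘ₗ grι K A kl.1.2 = 0 := LinearMap.ext (grπ_grι_of_ne hne)
        rw [this, TensorProduct.map_zero_right, LinearMap.zero_apply]
  · intro x y hx hy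
    simp only [map_add, hx, hy]

theorem map_grπ_comul_grι_of_ne {n : ℕ} (x : GrPiece K A n) {i j : ℕ} (hij : i + j ≠ n) :
    TensorProduct.map (grπ K A i) (grπ K A j) ((grMaps cA).comul (grι K A n x)) = 0 := by
  rw [grMaps_comul_grι]
  refine directSum_induction (K := K) (p := fun t => TensorProduct.map (grπ K A i)
    (grπ K A j) (DirectSum.toModule K (Finset.HasAntidiagonal.antidiagonal n)
      (Gr K A ⊗[K] Gr K A) (fun ij => TensorProduct.map (grι K A ij.1.1) (grι K A ij.1.2)) t) = 0)
        (grComul K A n x) ?_ (fun kl w => ?_) ?_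
  · simp
  · rw [DirectSum.toModule_lof, ← LinearMap.comp_apply, ← TensorProduct.map_comp]
    have hne : kl.1.1 ≠ i ∨ kl.1.2 ≠ j := by
      by_contra! hh
      have := Finset.HasAntidiagonal.mem_antidiagonal.1 kl.2
      exact hij (by rw [← hh.1, ← hh.2, this])
    rcases hne with hne | hne
    · have : grπ K A i ∘ₗ grι K A kl.1.1 = 0 := LinearMap.ext (grπ_grι_of_ne hne)
      rw [this, TensorProduct.map_zero_left, LinearMap.zero_apply]
    · have : grπ K A j ∘ₗ grι K A kl.1.2 = 0 := LinearMap.ext (grπ_grι_of_ne hne)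
      rw [this, TensorProduct.map_zero_right, LinearMap.zero_apply]
  · intro x y hx hy
    simp only [map_add, hx, hy, add_zero]

/-- A component of the comultiplication of `gr A` is that of the comultiplication of `gr^n A`. -/
theorem map_grπ_comul {i j n : ℕ} (hij : i + j = n) (y : Gr K A) :
    TensorProduct.map (grπ K A i) (grπ K A j) ((grMaps cA).comul y) =
      DirectSum.component K _ _ ⟨(i, j), Finset.HasAntidiagonal.mem_antidiagonal.2 hij⟩
        (grComul K A n (grπ K A n y)) := by
  refine directSum_induction (K := K) (p := fun y : Gr K A => TensorProduct.map (grπ K A i)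
    (grπ K A j) ((grMaps cA).comul y) =
      DirectSum.component K _ _ ⟨(i, j), Finset.HasAntidiagonal.mem_antidiagonal.2 hij⟩
        (grComul K A n (grπ K A n y))) y ?_ (fun m x => ?_) ?_
  · simp
  · by_cases h : n = m
    · subst h
      rw [grπ_grι_self]
      exact map_grπ_comul_grι cA _ x ⟨(i, j), Finset.HasAntidiagonal.mem_antidiagonal.2 hij⟩
    · rw [map_grπ_comul_grι_of_ne cA x (hij.trans_ne h), grπ_grι_of_ne (Ne.symm h), map_zero, map_zero]
  · intro x y hx hy
    simp only [map_add, hx, hy]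

end GrMaps

/-! ### The coradical of `A` is `K·1` -/

section Iso

variable {K : Type u} [Field K] {V : Type v} [AddCommGroup V] [Module K V]
  {c : V ⊗[K] V →ₗ[K] V ⊗[K] V} {lam : K} {hc : IsBraiding c} {hH : IsHecke c lam}
  {A : Type w} [Ring A] [Algebra K A] [Coalgebra K A]
  {cA : A ⊗[K] A →ₗ[K] A ⊗[K] A} (hA : IsBraidedBialgebra cA)
  (e : (grMaps cA).Iso (symMaps hc hH))

open Coalgebra

include e in
-- The counit of `S(V, c)` is `1` at the unit, so the unit of `gr A` is nonzero. This excludes the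
-- default value, and only then is `1` known to lie in the coradical.
theorem grMaps_one : ∃ h : (1 : A) ∈ coradFil K A 0,
    (grMaps cA).one = grι K A 0 (grQ K A 0 ⟨1, h⟩) := by
  rcases isInduced_induced_or_eq_zero LinearMap.id (Algebra.linearMap K A)
    (coradFil K A 0).subtype (grQ K A 0) with h | h
  · obtain ⟨u, hu, hg⟩ := h 1
    have hu1 : (u : A) = 1 := by simpa using hu
    refine ⟨hu1 ▸ u.2, ?_⟩
    change grι K A 0 (induced _ _ _ _ 1) = _
    rw [LinearMap.id_apply] at hg
    rw [hg]
    congr 2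
    exact Subtype.ext hu1
  · exfalso
    have h1 : (grMaps cA).one = 0 := by
      change grι K A 0 (induced _ _ _ _ 1) = _
      rw [h, LinearMap.zero_apply, map_zero]
    have h2 : (symMaps hc hH).counit (e.equiv (grMaps cA).one) = 1 := by
      rw [e.map_one]
      exact (symMaps_counit_symProj hc hH 1).trans (map_one _)
    rw [h1, map_zero, map_zero] at h2
    exact zero_ne_one h2

theorem symMaps_comul_one : (symMaps hc hH).comul 1 = 1 ⊗ₜ 1 := by
  rw [← symProj_one, symMaps_comul_symProj, tensorComul_one, TensorProduct.map_tmul]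

theorem one_tmul_one_ne_zero (hc : IsBraiding c) (hH : IsHecke c lam) :
    (1 : BraidedSym c lam) ⊗ₜ[K] (1 : BraidedSym c lam) ≠ 0 := by
  intro h
  have h1 : (symMaps hc hH).counit 1 = 1 :=
    (symMaps_counit_symProj hc hH 1).trans (map_one _)
  have h2 := congrArg (fun t => TensorProduct.lid K _
    (TensorProduct.map (symMaps hc hH).counit (symMaps hc hH).counit t)) h
  simp [h1] at h2

include e in
-- The only bidegree of total degree zero is `(0, 0)`. The default value is excluded because `1 ⊗ 1
-- ≠ 0` in `S(V, c) ⊗ S(V, c)`.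
theorem grMaps_comul_grι_zero (x : coradFil K A 0) :
    ∃ u : coradFil K A 0 ⊗[K] coradFil K A 0,
      TensorProduct.map (coradFil K A 0).subtype (coradFil K A 0).subtype u =
        comul (R := K) (x : A) ∧ (grMaps cA).comul (grι K A 0 (grQ K A 0 x)) =
          TensorProduct.map (grι K A 0 ∘ₗ grQ K A 0) (grι K A 0 ∘ₗ grQ K A 0) u := by
  have key : ∀ u : DirectSum (Finset.HasAntidiagonal.antidiagonal 0)
      fun ij => coradFil K A ij.1.1 ⊗[K] coradFil K A ij.1.2,
      ∃ u' : coradFil K A 0 ⊗[K] coradFil K A 0,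
        u = DirectSum.lof K _ (fun ij : Finset.HasAntidiagonal.antidiagonal 0 =>
          coradFil K A ij.1.1 ⊗[K] coradFil K A ij.1.2)
            ⟨(0, 0), Finset.HasAntidiagonal.mem_antidiagonal.2 rfl⟩ u' := by
    intro u
    refine directSum_induction (K := K) (p := fun u => ∃ u' : coradFil K A 0 ⊗[K] coradFil K A 0,
        u = DirectSum.lof K _ (fun ij : Finset.HasAntidiagonal.antidiagonal 0 =>
          coradFil K A ij.1.1 ⊗[K] coradFil K A ij.1.2)
            ⟨(0, 0), Finset.HasAntidiagonal.mem_antidiagonal.2 rfl⟩ u') u ?_ (fun ij w => ?_) ?_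
    · exact ⟨0, by rw [map_zero]⟩
    · obtain ⟨⟨i, j⟩, hij⟩ := ij
      obtain ⟨rfl, rfl⟩ : i = 0 ∧ j = 0 := by
        have := Finset.HasAntidiagonal.mem_antidiagonal.1 hij
        simp only at this
        omega
      exact ⟨w, rfl⟩
    · rintro x y ⟨x', rfl⟩ ⟨y', rfl⟩
      exact ⟨x' + y', by rw [map_add]⟩
  have hspec := isInduced_induced_or_eq_zero (grQ K A 0)
    (Coalgebra.comul (R := K) ∘ₗ (coradFil K A 0).subtype)
    (DirectSum.toModule K (Finset.HasAntidiagonal.antidiagonal 0) (A ⊗[K] A) fun ij =>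
      TensorProduct.map (coradFil K A ij.1.1).subtype (coradFil K A ij.1.2).subtype)
    (DirectSum.lmap fun ij : Finset.HasAntidiagonal.antidiagonal 0 =>
      TensorProduct.map (grQ K A ij.1.1) (grQ K A ij.1.2))
  rcases hspec with h | h
  · obtain ⟨u, hu, hg⟩ := h x
    obtain ⟨u', rfl⟩ := key u
    refine ⟨u', by rw [DirectSum.toModule_lof] at hu; exact hu, ?_⟩
    rw [grMaps_comul_grι, grComul, hg, DirectSum.lmap_lof, DirectSum.toModule_lof,
      TensorProduct.map_comp]
    rfl
  · exfalso
    obtain ⟨h1, hone⟩ := grMaps_one e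
    have h2 := LinearMap.congr_fun e.map_comul (grMaps cA).one
    rw [LinearMap.comp_apply, LinearMap.comp_apply, LinearEquiv.coe_coe, e.map_one, hone,
      grMaps_comul_grι, grComul, h] at h2
    refine one_tmul_one_ne_zero hc hH ?_
    rw [← symMaps_comul_one (hc := hc) (hH := hH)]
    rw [LinearMap.zero_apply, map_zero, map_zero] at h2
    exact h2.symm

theorem grι_injective (n : ℕ) : Function.Injective (grι K A n) :=
  Function.LeftInverse.injective (grπ_grι_self n)

theorem grQ_zero_injective : Function.Injective (grQ K A 0) := by
  rw [← LinearMap.ker_eq_bot, Submodule.ker_mkQ, eq_bot_iff]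
  intro x hx
  exact Subtype.ext ((Submodule.mem_bot K).1 hx)

include e in
-- `D ⊆ A_0` embeds in `S(V, c)` compatibly with `Δ`. Let `x ∈ D` be nonzero of minimal word length
-- there, and let `g` vanish on shorter words but not at `x`. Then slicing `Δ(x)` by `g` in the
-- right leg gives `g(x) 1`, and this slice stays in `D` because `Δ(x) ∈ D ⊗ D`.
theorem one_mem_of_isSimpleSubcoalgebra {D : Submodule K A} (hD : IsSimpleSubcoalgebra K D) :
    (1 : A) ∈ D := by
  have hle : D ≤ coradFil K A 0 := by rw [coradFil]; exact le_sSup hD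
  obtain ⟨h1, hone⟩ := grMaps_one e
  let ψ : coradFil K A 0 →ₗ[K] BraidedSym c lam :=
    e.equiv.toLinearMap ∘ₗ grι K A 0 ∘ₗ grQ K A 0
  have hψ : Function.Injective ψ :=
    e.equiv.injective.comp ((grι_injective 0).comp grQ_zero_injective)
  have hψ1 : ψ ⟨1, h1⟩ = 1 := by
    change e.equiv (grι K A 0 (grQ K A 0 ⟨1, h1⟩)) = 1
    rw [← hone, e.map_one]
    rfl
  obtain ⟨x0, hx0, hx0'⟩ := (Submodule.ne_bot_iff D).1 hD.2.1
  have hex : ∃ n, ∃ x : D, x ≠ 0 ∧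
      ψ (Submodule.inclusion hle x) ∈ (wordFil K V n).map (symProj c lam) := by
    obtain ⟨t, ht⟩ := symProj_surjective (ψ (Submodule.inclusion hle ⟨x0, hx0⟩))
    obtain ⟨n, hn⟩ := exists_mem_wordFil t
    exact ⟨n, ⟨x0, hx0⟩, fun h => hx0' (congrArg Subtype.val h), t, hn, ht⟩
  classical
  obtain ⟨x, hx, hxn⟩ := Nat.find_spec hex
  have hmin := fun m => Nat.find_min (m := m) hex
  generalize Nat.find hex = n at hxn hmin
  cases n with
  | zero =>
    obtain ⟨t, ht, htx⟩ := hxn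
    rw [(Submodule.mem_bot K).1 ht, map_zero] at htx
    refine absurd (hψ (htx.symm.trans (map_zero ψ).symm)) fun h => hx (Subtype.ext ?_)
    exact congrArg (fun y : coradFil K A 0 => (y : A)) h
  | succ m =>
    have hxm : ψ (Submodule.inclusion hle x) ∉ (wordFil K V m).map (symProj c lam) :=
      fun h => hmin m m.lt_succ_self ⟨x, hx, h⟩
    obtain ⟨g, hg, hgm⟩ := Submodule.exists_dual_map_eq_bot_of_notMem hxm inferInstance
    obtain ⟨t, ht, htx⟩ := hxn
    have hE : TensorProduct.rid K _ (g.lTensor _ ((symMaps hc hH).comul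
        (ψ (Submodule.inclusion hle x)))) = g (ψ (Submodule.inclusion hle x)) • 1 := by
      have hgz : ∀ z ∈ LinearMap.range ((wordFil K V m).subtype.lTensor (TensorAlgebra K V)),
          g.lTensor _ (TensorProduct.map (symProj c lam) (symProj c lam) z) = 0 := by
        intro z hz
        refine range_lTensor_le (L := LinearMap.ker (g.lTensor _ ∘ₗ
          TensorProduct.map (symProj c lam) (symProj c lam))) (fun a b hb => ?_) hz
        have : g (symProj c lam b) ∈ ((wordFil K V m).map (symProj c lam)).map g :=
          ⟨_, ⟨b, hb, rfl⟩, rfl⟩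
        rw [hgm, Submodule.mem_bot] at this
        simp [this]
      have h := hgz _ (tensorComul_sub_mem c m ht)
      rw [map_sub, map_sub, sub_eq_zero, ← symMaps_comul_symProj hc hH, htx,
        TensorProduct.map_tmul, htx] at h
      rw [h, LinearMap.lTensor_tmul, TensorProduct.rid_tmul]
      rfl
    obtain ⟨s, hs⟩ := hD.1 x x.2
    obtain ⟨u, hu, hgu⟩ := grMaps_comul_grι_zero e (Submodule.inclusion hle x)
    -- `A_0 ⊗ A_0` embeds in `A ⊗ A`, so the lift of `Δ(x)` used by `gr A` is the one coming from `D
    -- ⊗ D`.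
    have hus : u = TensorProduct.map (Submodule.inclusion hle) (Submodule.inclusion hle) s := by
      apply TensorProduct.map_injective_of_flat_flat (coradFil K A 0).subtype
        (coradFil K A 0).subtype (Submodule.injective_subtype _) (Submodule.injective_subtype _)
      rw [hu, ← LinearMap.comp_apply, ← TensorProduct.map_comp]
      exact hs.symm
    have hψu : (symMaps hc hH).comul (ψ (Submodule.inclusion hle x)) =
        TensorProduct.map (ψ ∘ₗ Submodule.inclusion hle) (ψ ∘ₗ Submodule.inclusion hle) s := by
      have h2 := LinearMap.congr_fun e.map_comul (grι K A 0 (grQ K A 0 (Submodule.inclusion hle x)))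
      rw [LinearMap.comp_apply, hgu, hus] at h2
      refine h2.symm.trans ?_
      simp only [← LinearMap.comp_apply, ← TensorProduct.map_comp]
      rfl
    have hrange : ∀ s : D ⊗[K] D, ∃ d : D, TensorProduct.rid K _ (g.lTensor _ (TensorProduct.map
        (ψ ∘ₗ Submodule.inclusion hle) (ψ ∘ₗ Submodule.inclusion hle) s)) =
          ψ (Submodule.inclusion hle d) := by
      intro s
      induction s with
      | zero => exact ⟨0, by simp⟩
      | add x y hx hy =>
        obtain ⟨a, ha⟩ := hx
        obtain ⟨b, hb⟩ := hy
        exact ⟨a + b, by simp only [map_add, ha, hb]⟩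
      | tmul a b => exact ⟨g (ψ (Submodule.inclusion hle b)) • a, by simp⟩
    obtain ⟨d, hd⟩ := hrange s
    rw [← hψu, hE, ← hψ1, ← map_smul] at hd
    have hd' := congrArg Subtype.val (hψ hd)
    have hmem : g (ψ (Submodule.inclusion hle x)) • (1 : A) ∈ D := by
      rw [show g (ψ (Submodule.inclusion hle x)) • (1 : A) = d from hd']
      exact d.2
    exact (Submodule.smul_mem_iff D hg).1 hmem

include hA e in
-- Every simple subcoalgebra contains the subcoalgebra `K·1`, hence equals it.
theorem coradFil_zero : coradFil K A 0 = K ∙ (1 : A) := by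
  apply le_antisymm
  · rw [coradFil]
    refine sSup_le fun D hD => ?_
    have h1 : (1 : A) ∈ D := one_mem_of_isSimpleSubcoalgebra e hD
    have hsub : IsSubcoalgebra K (K ∙ (1 : A)) := by
      intro x hx
      obtain ⟨r, rfl⟩ := Submodule.mem_span_singleton.1 hx
      rw [map_smul, hA.comul_one]
      refine Submodule.smul_mem _ r ⟨⟨1, Submodule.mem_span_singleton_self _⟩ ⊗ₜ
        ⟨1, Submodule.mem_span_singleton_self _⟩, by simp⟩
    rcases hD.2.2 _ ((Submodule.span_singleton_le_iff_mem _ _).2 h1) hsub with h | h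
    · have h2 : (1 : A) = 0 := by simpa using h
      have h3 := hA.counit_one
      rw [h2, map_zero] at h3
      exact absurd h3 zero_ne_one
    · exact h.ge
  · rw [Submodule.span_singleton_le_iff_mem]
    exact (grMaps_one e).1

end Iso

/-- The kernel of a tensor product of two quotient maps is the sum of the two images of kernel
tensor whole space. -/
theorem map_subtype_mem_of_map_mkQ_eq_zero {K X Y : Type*} [Field K] [AddCommGroup X] [Module K X]
    [AddCommGroup Y] [Module K Y] {P P' : Submodule K X} {Q Q' : Submodule K Y} (t : P ⊗[K] Q)
    (ht : TensorProduct.map (P'.submoduleOf P).mkQ (Q'.submoduleOf Q).mkQ t = 0) :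
    TensorProduct.map P.subtype Q.subtype t ∈
      LinearMap.range (Q'.subtype.lTensor X) ⊔ LinearMap.range (P'.subtype.rTensor Y) := by
  rw [← LinearMap.mem_ker, TensorProduct.map_ker
    (LinearMap.exact_subtype_mkQ (P'.submoduleOf P)) (Submodule.mkQ_surjective _)
    (LinearMap.exact_subtype_mkQ (Q'.submoduleOf Q)) (Submodule.mkQ_surjective _)] at ht
  obtain ⟨_, ⟨s, rfl⟩, _, ⟨t, rfl⟩, rfl⟩ := Submodule.mem_sup.1 ht
  rw [map_add]
  refine add_mem ?_ ?_
  · rw [← LinearMap.comp_apply, LinearMap.map_comp_lTensor]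
    refine map_mem_of_tmul _ _ (fun x y => ?_) s
    exact Submodule.mem_sup_left (tmul_mem_range_lTensor (x : X) y.2)
  · rw [← LinearMap.comp_apply, LinearMap.map_comp_rTensor]
    refine map_mem_of_tmul _ _ (fun x y => ?_) t
    exact Submodule.mem_sup_right ⟨⟨x, x.2⟩ ⊗ₜ (y : Y), by simp⟩

/-! ### Linear maps from `gr A` to `A` that lift the classes -/

section Filtered

variable {K : Type u} [Field K] {A : Type w} [Ring A] [Algebra K A] [Coalgebra K A]

theorem coradPrev_le (hmono : ∀ n, coradFil K A n ≤ coradFil K A (n + 1)) (n : ℕ) :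
    coradPrev K A n ≤ coradFil K A n := by
  cases n with
  | zero => exact bot_le
  | succ n => exact hmono n

variable {G : Gr K A →ₗ[K] A}

theorem mem_coradPrev_of_component_eq_zero
    (hmono : ∀ n, coradFil K A n ≤ coradFil K A (n + 1))
    (hG : ∀ n x, ∃ a : coradFil K A n, G (grι K A n x) = a ∧ grQ K A n a = x) (n : ℕ) (x : Gr K A)
    (hx : ∀ m, n ≤ m → grπ K A m x = 0) : G x ∈ coradPrev K A n := by
  induction n generalizing x with
  | zero =>
    rw [DirectSum.ext_component K (f := x) (g := 0) fun m => by
      rw [map_zero]; exact hx m m.zero_le, map_zero]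
    exact zero_mem _
  | succ n ih =>
    obtain ⟨a, ha, -⟩ := hG n (grπ K A n x)
    rw [← sub_add_cancel x (grι K A n (grπ K A n x)), map_add, ha]
    refine add_mem (coradPrev_le hmono n (ih _ fun m hm => ?_)) a.2
    rw [map_sub]
    rcases hm.eq_or_lt with rfl | hm
    · rw [grπ_grι_self, sub_self]
    · rw [grπ_grι_of_ne hm.ne, hx m hm, sub_zero]

/-- A linear map from the associated graded space to a filtered space that induces the identity of
the associated graded space is bijective. -/
theorem bijective_of_graded (hmono : ∀ n, coradFil K A n ≤ coradFil K A (n + 1))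
    (hex : ∀ a : A, ∃ n, a ∈ coradFil K A n)
    (hG : ∀ n x, ∃ a : coradFil K A n, G (grι K A n x) = a ∧ grQ K A n a = x) :
    Function.Bijective G := by
  have hq : ∀ n (a : coradFil K A n), grQ K A n a = 0 ↔ (a : A) ∈ coradPrev K A n := by
    intro n a
    rw [Submodule.mkQ_apply, Submodule.Quotient.mk_eq_zero]
    rfl
  constructor
  -- If `G x = 0`, the image of the top component of `x` is minus that of the lower components. It
  -- lies one filtration step down, so the top component has class zero.
  · have key : ∀ n (x : Gr K A), (∀ m, n ≤ m → grπ K A m x = 0) → G x = 0 → x = 0 := by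
      intro n
      induction n with
      | zero =>
        intro x hx _
        exact DirectSum.ext_component K fun m => by rw [map_zero]; exact hx m m.zero_le
      | succ n ih =>
        intro x hx hGx
        obtain ⟨a, ha, haq⟩ := hG n (grπ K A n x)
        refine ih x (fun m hm => ?_) hGx
        rcases hm.eq_or_lt with rfl | hm
        · rw [← haq, hq, ← neg_mem_iff, ← ha, ← zero_sub, ← hGx, ← map_sub]
          refine mem_coradPrev_of_component_eq_zero hmono hG n _ fun m hm => ?_
          rw [map_sub]
          rcases hm.eq_or_lt with rfl | hm
          · rw [grπ_grι_self, sub_self]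
          · rw [grπ_grι_of_ne hm.ne, hx m hm, sub_zero]
        · exact hx m hm
    intro y y' hyy
    rw [← sub_eq_zero]
    generalize hx : y - y' = x
    have hGx : G x = 0 := by rw [← hx, map_sub, hyy, sub_self]
    obtain ⟨n, hn⟩ : ∃ n, ∀ m, n ≤ m → grπ K A m x = 0 := by
      clear hx hGx
      refine directSum_induction (K := K)
        (p := fun x : Gr K A => ∃ n, ∀ m, n ≤ m → grπ K A m x = 0) x ?_ (fun i y => ?_) ?_
      · exact ⟨0, fun m _ => map_zero _⟩
      · exact ⟨i + 1, fun m hm => grπ_grι_of_ne (Nat.lt_of_succ_le hm).ne y⟩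
      · rintro x y ⟨n, hn⟩ ⟨n', hn'⟩
        exact ⟨max n n', fun m hm => by
          rw [map_add, hn m ((le_max_left _ _).trans hm), hn' m ((le_max_right _ _).trans hm),
            add_zero]⟩
    exact key n x hn hGx
  · rw [← LinearMap.range_eq_top]
    -- Subtracting from `a ∈ A_n` the value of `G` at its class leaves an element of `A_{n-1}`.
    have key : ∀ n, coradFil K A n ≤ LinearMap.range G := by
      have step : ∀ n, coradPrev K A n ≤ LinearMap.range G → coradFil K A n ≤ LinearMap.range G := by
        intro n hn a ha
        obtain ⟨a', ha', haq⟩ := hG n (grQ K A n ⟨a, ha⟩)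
        rw [← sub_add_cancel a a']
        refine add_mem (hn ?_) ⟨_, ha'⟩
        refine (hq n (⟨a, ha⟩ - a')).1 ?_
        rw [map_sub, haq, sub_self]
      intro n
      induction n with
      | zero => exact step 0 bot_le
      | succ n ih => exact step (n + 1) ih
    rw [eq_top_iff]
    intro a _
    obtain ⟨n, hn⟩ := hex a
    exact key n hn

end Filtered

/-! ### Injectivity of the part of `Δ` in bidegree `(1, n - 1)` -/

section Degree

variable {K : Type u} [Field K] {A : Type w} [Ring A] [Algebra K A] [Coalgebra K A]

open Coalgebra

/-- In the associated graded coalgebra, an element of degree at least two is determined by the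
component of its comultiplication in bidegree `(1, n - 1)`. -/
theorem eq_zero_of_component_grComul (hmono : ∀ n, coradFil K A n ≤ coradFil K A (n + 1)) (k : ℕ)
    (h : IsInduced (grQ K A (k + 2)) (Coalgebra.comul (R := K) ∘ₗ (coradFil K A (k + 2)).subtype)
      (DirectSum.toModule K (Finset.HasAntidiagonal.antidiagonal (k + 2)) (A ⊗[K] A) fun ij =>
        TensorProduct.map (coradFil K A ij.1.1).subtype (coradFil K A ij.1.2).subtype)
      (DirectSum.lmap fun ij : Finset.HasAntidiagonal.antidiagonal (k + 2) =>
        TensorProduct.map (grQ K A ij.1.1) (grQ K A ij.1.2)) (grComul K A (k + 2)))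
    (x : GrPiece K A (k + 2)) (h1 : (1, k + 1) ∈ Finset.HasAntidiagonal.antidiagonal (k + 2))
    (hx : DirectSum.component K _ _ ⟨(1, k + 1), h1⟩ (grComul K A (k + 2) x) = 0) : x = 0 := by
  obtain ⟨a, rfl⟩ := Submodule.mkQ_surjective _ x
  obtain ⟨u, hu, hg⟩ := h a
  have mono : Monotone (coradFil K A) := monotone_nat_of_le_succ hmono
  -- `Δ⁻¹(L)` is `A_{k+1}`. A bidegree `(i, j)` of total `k + 2` other than `(1, k + 1)` has `i = 0`
  -- or `j ≤ k`, so its contribution lies in `L` anyway.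
  let L := LinearMap.range ((coradFil K A k).subtype.lTensor A) ⊔
      LinearMap.range ((coradFil K A 0).subtype.rTensor A)
  have hL : ∀ {i j} (w : coradFil K A i ⊗[K] coradFil K A j), j ≤ k ∨ i = 0 →
      TensorProduct.map (coradFil K A i).subtype (coradFil K A j).subtype w ∈ L := by
    intro i j w hij
    refine map_mem_of_tmul _ L (fun x y => ?_) w
    rcases hij with hij | rfl
    · exact Submodule.mem_sup_left (tmul_mem_range_lTensor (x : A) (mono hij y.2))
    · exact Submodule.mem_sup_right ⟨x ⊗ₜ (y : A), by simp⟩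
  have key : DirectSum.toModule K (Finset.HasAntidiagonal.antidiagonal (k + 2)) (A ⊗[K] A)
      (fun ij => TensorProduct.map (coradFil K A ij.1.1).subtype (coradFil K A ij.1.2).subtype) u -
      TensorProduct.map (coradFil K A 1).subtype (coradFil K A (k + 1)).subtype
        (DirectSum.component K (Finset.HasAntidiagonal.antidiagonal (k + 2))
          (fun ij => coradFil K A ij.1.1 ⊗[K] coradFil K A ij.1.2) ⟨(1, k + 1), h1⟩ u) ∈ L := by
    refine directSum_induction (K := K) (p := fun u => DirectSum.toModule K
      (Finset.HasAntidiagonal.antidiagonal (k + 2)) (A ⊗[K] A)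
      (fun ij => TensorProduct.map (coradFil K A ij.1.1).subtype (coradFil K A ij.1.2).subtype) u -
      TensorProduct.map (coradFil K A 1).subtype (coradFil K A (k + 1)).subtype
        (DirectSum.component K (Finset.HasAntidiagonal.antidiagonal (k + 2))
          (fun ij => coradFil K A ij.1.1 ⊗[K] coradFil K A ij.1.2) ⟨(1, k + 1), h1⟩ u) ∈ L) u
        ?_ (fun ij w => ?_) ?_
    · simp
    · rw [DirectSum.toModule_lof]
      by_cases hij : ij = ⟨(1, k + 1), h1⟩
      · subst hij
        rw [DirectSum.component.lof_self, sub_self]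
        exact zero_mem _
      · rw [DirectSum.component.of, dif_neg hij, map_zero, sub_zero]
        refine hL w ?_
        obtain ⟨⟨i, j⟩, hmem⟩ := ij
        have hsum := Finset.HasAntidiagonal.mem_antidiagonal.1 hmem
        simp only at hsum ⊢
        by_contra! hcon
        apply hij
        obtain ⟨rfl, rfl⟩ : i = 1 ∧ j = k + 1 := by omega
        rfl
    · intro x y hx hy
      rw [map_add, map_add, map_add, add_sub_add_comm]
      exact add_mem hx hy
  have hcomp : TensorProduct.map (grQ K A 1) (grQ K A (k + 1))
      (DirectSum.component K (Finset.HasAntidiagonal.antidiagonal (k + 2))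
          (fun ij => coradFil K A ij.1.1 ⊗[K] coradFil K A ij.1.2) ⟨(1, k + 1), h1⟩ u) = 0 := by
    rw [← hx, hg]
    rfl
  -- A vanishing class in `gr^1 A ⊗ gr^{k+1} A` puts this term in `A ⊗ A_k + A_0 ⊗ A`, which is `L`
  -- again.
  have hmem : TensorProduct.map (coradFil K A 1).subtype (coradFil K A (k + 1)).subtype
      (DirectSum.component K (Finset.HasAntidiagonal.antidiagonal (k + 2))
          (fun ij => coradFil K A ij.1.1 ⊗[K] coradFil K A ij.1.2) ⟨(1, k + 1), h1⟩ u) ∈ L := by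
    exact map_subtype_mem_of_map_mkQ_eq_zero (P' := coradPrev K A 1) (Q' := coradPrev K A (k + 1))
      _ hcomp
  rw [Submodule.mkQ_apply, Submodule.Quotient.mk_eq_zero]
  change (a : A) ∈ coradFil K A (k + 1)
  rw [coradFil, Submodule.mem_comap]
  rw [hu] at key
  simpa using add_mem key hmem

end Degree

/-! ### The quadratic relations hold in `A` -/

section BracketOfPrimitives

variable {K : Type u} [Field K] {V : Type v} [AddCommGroup V] [Module K V]
  {c : V ⊗[K] V →ₗ[K] V ⊗[K] V} {lam : K}

theorem IsHecke.apply_apply (hH : IsHecke c lam) (z : V ⊗[K] V) :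
    c (c z) = (lam - 1) • c z + lam • z := by
  have h := LinearMap.congr_fun hH z
  simp only [LinearMap.comp_apply, LinearMap.add_apply, LinearMap.sub_apply,
    LinearMap.smul_apply, LinearMap.id_apply, LinearMap.zero_apply, map_sub, map_smul] at h
  linear_combination (norm := module) h

theorem IsHecke.c₁_c₁ (hH : IsHecke c lam) (x : V ⊗[K] (V ⊗[K] V)) :
    c₁ c (c₁ c x) = (lam - 1) • c₁ c x + lam • x := by
  obtain ⟨x, rfl⟩ := (TensorProduct.assoc K V V V).surjective x
  simp only [c₁, LinearMap.comp_apply, LinearEquiv.coe_coe, LinearEquiv.symm_apply_apply]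
  rw [← map_smul (TensorProduct.assoc K V V V), ← map_smul (TensorProduct.assoc K V V V),
    ← map_add (TensorProduct.assoc K V V V)]
  congr 1
  induction x with
  | zero => simp
  | add x y hx hy => simp only [map_add, smul_add, hx, hy]; abel
  | tmul z v =>
    simp only [LinearMap.rTensor_tmul, hH.apply_apply, TensorProduct.add_tmul,
      TensorProduct.smul_tmul']

theorem IsHecke.c₂_c₂ (hH : IsHecke c lam) (x : V ⊗[K] (V ⊗[K] V)) :
    c₂ c (c₂ c x) = (lam - 1) • c₂ c x + lam • x := by
  induction x with
  | zero => simp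
  | add x y hx hy => simp only [map_add, smul_add, hx, hy]; abel
  | tmul v z =>
    simp only [c₂, LinearMap.lTensor_tmul, hH.apply_apply, TensorProduct.tmul_add,
      TensorProduct.tmul_smul]

variable {A : Type w} [Ring A] [Algebra K A] [Coalgebra K A]
  {cA : A ⊗[K] A →ₗ[K] A ⊗[K] A}

omit [Coalgebra K A] in
/-- A linear map intertwines `c ⊗ V` if it intertwines the braidings. -/
theorem map_c₁ (j : V →ₗ[K] A)
    (hjc : ∀ z, cA (TensorProduct.map j j z) = TensorProduct.map j j (c z))
    (x : V ⊗[K] (V ⊗[K] V)) : TensorProduct.map j (TensorProduct.map j j) (c₁ c x) =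
      c₁ cA (TensorProduct.map j (TensorProduct.map j j) x) := by
  obtain ⟨x, rfl⟩ := (TensorProduct.assoc K V V V).surjective x
  induction x with
  | zero => simp
  | add x y hx hy => simp only [map_add, hx, hy]
  | tmul z v =>
    have h : ∀ z : V ⊗[K] V, TensorProduct.map j (TensorProduct.map j j)
        (TensorProduct.assoc K V V V (z ⊗ₜ v)) =
          TensorProduct.assoc K A A A (TensorProduct.map j j z ⊗ₜ j v) := by
      intro z
      induction z with
      | zero => simp
      | add x y hx hy => simp only [map_add, TensorProduct.add_tmul, hx, hy]
      | tmul x y => simp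
    simp only [c₁, LinearMap.comp_apply, LinearEquiv.coe_coe, LinearEquiv.symm_apply_apply,
      LinearMap.rTensor_tmul, h, hjc]

omit [Coalgebra K A] in
theorem map_c₂ (j : V →ₗ[K] A)
    (hjc : ∀ z, cA (TensorProduct.map j j z) = TensorProduct.map j j (c z))
    (x : V ⊗[K] (V ⊗[K] V)) : TensorProduct.map j (TensorProduct.map j j) (c₂ c x) =
      c₂ cA (TensorProduct.map j (TensorProduct.map j j) x) := by
  induction x with
  | zero => simp
  | add x y hx hy => simp only [map_add, hx, hy]
  | tmul v z => simp only [c₂, LinearMap.lTensor_tmul, TensorProduct.map_tmul, hjc]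

/-- The products of the relations of the braided symmetric algebra are primitive, and vanish if
all primitive elements come from `V`. -/
theorem mul_rel_eq_zero (hK : ringChar K ≠ 2) (hc : IsBraiding c) (hH : IsHecke c lam)
    (hreg : IsRegularMark lam) (hlam : lam ≠ 1) (hA : IsBraidedBialgebra cA) (j : V →ₗ[K] A)
    (hinj : Function.Injective j) (hj : ∀ v, j v ∈ prim K A) (hrange : prim K A ≤ LinearMap.range j)
    (hjc : ∀ z, cA (TensorProduct.map j j z) = TensorProduct.map j j (c z)) (z : V ⊗[K] V) :
    LinearMap.mul' K A (TensorProduct.map j j (c z - lam • z)) = 0 := by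
  obtain ⟨p, hp⟩ := LinearMap.exists_leftInverse_of_injective j (LinearMap.ker_eq_bot.2 hinj)
  let b : V ⊗[K] V →ₗ[K] A :=
    LinearMap.mul' K A ∘ₗ TensorProduct.map j j ∘ₗ (c - lam • LinearMap.id)
  have hb : ∀ z, b z = LinearMap.mul' K A (TensorProduct.map j j (c z - lam • z)) := fun z => rfl
  have hjb : ∀ z, j (p (b z)) = b z := by
    intro z
    -- The defect of `b z` is the image of `(Id + c)(c - lam) z = 0`, so `b z` is primitive.
    obtain ⟨v, hv⟩ : b z ∈ LinearMap.range j := by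
      apply hrange
      rw [prim, LinearMap.mem_ker, hb, comul_mul_prim hA j hj, hjc, ← map_add, map_sub, map_smul,
        hH.apply_apply]
      convert map_zero (TensorProduct.map j j)
      module
    rw [← hv]
    exact congrArg j (LinearMap.congr_fun hp v)
  let β : V ⊗[K] V →ₗ[K] V := p ∘ₗ b
  have hjβ : ∀ z, j (β z) = b z := hjb
  -- The Hecke relation in the form `(c - lam) c = -(c - lam)`.
  have hβc : ∀ z, β (c z) = - β z := by
    intro z
    apply hinj
    rw [map_neg, hjβ, hjβ, hb, hb, ← map_neg, ← map_neg, hH.apply_apply]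
    congr 2
    module
  suffices β = 0 by rw [← hb, ← hjβ, this, LinearMap.zero_apply, map_zero]
  let f : V ⊗[K] (V ⊗[K] V) →ₗ[K] V ⊗[K] V :=
    β.rTensor V ∘ₗ (TensorProduct.assoc K V V V).symm.toLinearMap
  let g : V ⊗[K] (V ⊗[K] V) →ₗ[K] V ⊗[K] V := β.lTensor V
  have hjj : Function.Injective (TensorProduct.map j j) :=
    TensorProduct.map_injective_of_flat_flat j j hinj hinj
  let J := TensorProduct.map j (TensorProduct.map j j)
  have hst : ∀ x, c₁ c (c₂ c (c₁ c x)) = c₂ c (c₁ c (c₂ c x)) := LinearMap.congr_fun hc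
  have hJf : ∀ x, TensorProduct.map j j (f x) = (LinearMap.mul' K A).rTensor A
      ((TensorProduct.assoc K A A A).symm (J (c₁ c x - lam • x))) := by
    intro x
    obtain ⟨x, rfl⟩ := (TensorProduct.assoc K V V V).surjective x
    induction x with
    | zero => simp
    | add x y hx hy => simp only [map_add, smul_add, add_sub_add_comm, hx, hy]
    | tmul z v =>
      have h : ∀ w : V ⊗[K] V, (LinearMap.mul' K A).rTensor A ((TensorProduct.assoc K A A A).symm
          (J (TensorProduct.assoc K V V V (w ⊗ₜ v)))) =
            LinearMap.mul' K A (TensorProduct.map j j w) ⊗ₜ j v := by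
        intro w
        induction w with
        | zero => simp
        | add x y hx hy => simp only [map_add, TensorProduct.add_tmul, hx, hy]
        | tmul x y => simp [J]
      have h2 : c₁ c (TensorProduct.assoc K V V V (z ⊗ₜ v)) -
          lam • TensorProduct.assoc K V V V (z ⊗ₜ v) =
            TensorProduct.assoc K V V V ((c z - lam • z) ⊗ₜ v) := by
        simp only [c₁, LinearMap.comp_apply, LinearEquiv.coe_coe, LinearEquiv.symm_apply_apply,
          LinearMap.rTensor_tmul, TensorProduct.sub_tmul, map_sub, ← TensorProduct.smul_tmul',
          map_smul]
      rw [h2, h, ← hb, ← hjβ]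
      simp [f]
  have hJg : ∀ x, TensorProduct.map j j (g x) =
      (LinearMap.mul' K A).lTensor A (J (c₂ c x - lam • x)) := by
    intro x
    induction x with
    | zero => simp
    | add x y hx hy => simp only [map_add, smul_add, add_sub_add_comm, hx, hy]
    | tmul v z =>
      simp only [c₂, g, J, LinearMap.lTensor_tmul, ← TensorProduct.tmul_smul,
        ← TensorProduct.tmul_sub, TensorProduct.map_tmul, ← hb, hjβ]
  have key := eq_neg_of_hecke hreg.1 hlam (by
      have := hreg.2 3 (by norm_num)
      simpa [Finset.sum_range_succ] using this) (c₁ c) (c₂ c) c f g hst hH.c₁_c₁ hH.c₂_c₂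
      hH.apply_apply ?_ ?_ ?_ ?_
  · refine bracket_eq_zero hK β fun x y z => ?_
    simpa [f, g] using key (x ⊗ₜ (y ⊗ₜ z))
  · intro x
    obtain ⟨x, rfl⟩ := (TensorProduct.assoc K V V V).surjective x
    induction x with
    | zero => simp
    | add x y hx hy => simp only [map_add, hx, hy, neg_add]
    | tmul z v => simp [f, c₁, hβc, TensorProduct.neg_tmul]
  · intro x
    induction x with
    | zero => simp
    | add x y hx hy => simp only [map_add, hx, hy, neg_add]
    | tmul v z => simp [g, c₂, hβc, TensorProduct.tmul_neg]
  · intro x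
    apply hjj
    -- Compatibility of `β` with `c` is inherited from the product of `A`. The braid equation gives
    -- `c₁ c₂ (c₁ - lam) = (c₂ - lam) c₁ c₂`, which turns the relation on one pair of strands into
    -- the relation on the other.
    have h := LinearMap.congr_fun hA.braid_mul_left (J (c₁ c x - lam • x))
    simp only [LinearMap.comp_apply, LinearEquiv.coe_coe] at h
    rw [← hjc, hJf, h, hJg, ← map_c₂ j hjc, ← map_c₁ j hjc, ← hst]
    simp only [map_sub, map_smul, J]
  · intro x
    apply hjj
    have h := LinearMap.congr_fun hA.braid_mul_right (J (c₂ c x - lam • x))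
    simp only [LinearMap.comp_apply, LinearEquiv.coe_coe] at h
    rw [← hjc, hJg, h, hJf, ← map_c₁ j hjc, ← map_c₂ j hjc, hst]
    simp only [map_sub, map_smul, J]

end BracketOfPrimitives

/-! ### `V` as `gr^1 A` and as the primitive elements of `A` -/

section Generators

variable {K : Type u} [Field K] {V : Type v} [AddCommGroup V] [Module K V]
  {c : V ⊗[K] V →ₗ[K] V ⊗[K] V} {lam : K} {hc : IsBraiding c} {hH : IsHecke c lam}
  {A : Type w} [Ring A] [Algebra K A] [Coalgebra K A]
  {cA : A ⊗[K] A →ₗ[K] A ⊗[K] A} (hA : IsBraidedBialgebra cA)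
  (e : (grMaps cA).Iso (symMaps hc hH))

open Coalgebra

theorem grMaps_counit (y : Gr K A) : (grMaps cA).counit y = grCounit K A 0 (grπ K A 0 y) := by
  refine directSum_induction (K := K) (p := fun y : Gr K A =>
    (grMaps cA).counit y = grCounit K A 0 (grπ K A 0 y)) y ?_ (fun n x => ?_) ?_
  · simp
  · cases n with
    | zero =>
      rw [grπ_grι_self]
      exact grMaps_counit_grι cA 0 x
    | succ n =>
      rw [grπ_grι_of_ne n.succ_ne_zero, map_zero]
      exact grMaps_counit_grι cA (n + 1) x
  · intro x y hx hy
    rw [map_add, map_add, map_add, hx, hy]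

/-- The element of `gr A` that corresponds to a vector. -/
def grVec : V →ₗ[K] Gr K A :=
  e.equiv.symm.toLinearMap ∘ₗ symProj c lam ∘ₗ TensorAlgebra.ι K

theorem equiv_grVec (v : V) : e.equiv (grVec e v) = symProj c lam (TensorAlgebra.ι K v) := by
  simp [grVec]

theorem comul_grVec (v : V) : (grMaps cA).comul (grVec e v) =
    grVec e v ⊗ₜ (grMaps cA).one + (grMaps cA).one ⊗ₜ grVec e v := by
  have hinj : Function.Injective (TensorProduct.map e.equiv.toLinearMap e.equiv.toLinearMap) :=
    TensorProduct.map_injective_of_flat_flat _ _ e.equiv.injective e.equiv.injective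
  apply hinj
  have h := LinearMap.congr_fun e.map_comul (grVec e v)
  rw [LinearMap.comp_apply, LinearMap.comp_apply, LinearEquiv.coe_coe, equiv_grVec,
    symMaps_comul_symProj, tensorComul_ι] at h
  rw [h, map_add, map_add, TensorProduct.map_tmul, TensorProduct.map_tmul, TensorProduct.map_tmul,
    TensorProduct.map_tmul, LinearEquiv.coe_coe, equiv_grVec, e.map_one]
  rfl

include hA e in
theorem exists_smul_one (x : GrPiece K A 0) :
    ∃ r : K, grι K A 0 x = r • (grMaps cA).one := by
  obtain ⟨h1, hone⟩ := grMaps_one e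
  obtain ⟨a, rfl⟩ := Submodule.mkQ_surjective _ x
  have ha : (a : A) ∈ K ∙ (1 : A) := coradFil_zero hA e ▸ a.2
  obtain ⟨r, hr⟩ := Submodule.mem_span_singleton.1 ha
  refine ⟨r, ?_⟩
  rw [hone, ← map_smul, ← map_smul]
  congr 2
  exact Subtype.ext hr.symm

include hA e in
theorem coradFil_mono (n : ℕ) : coradFil K A n ≤ coradFil K A (n + 1) :=
  coradFil_mono_succ hA.comul_one (coradFil_zero hA e) n

include hA in
-- The element is primitive in `gr A`, with counit zero. Its degree zero part is a multiple of the
-- unit, which the counit detects. In degree `k + 2` the bidegree `(1, k + 1)` part of `Δ` vanishes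
-- because the unit sits in degree zero, and that part determines the component.
theorem grπ_grVec (v : V) {n : ℕ} (hn : n ≠ 1) : grπ K A n (grVec e v) = 0 := by
  obtain ⟨h1, hone⟩ := grMaps_one e
  have hone0 : ∀ {m}, m ≠ 0 → grπ K A m (grMaps cA).one = 0 := fun hm => by
    rw [hone, grπ_grι_of_ne (Ne.symm hm)]
  match n with
  | 0 =>
    obtain ⟨r, hr⟩ := exists_smul_one hA e (grπ K A 0 (grVec e v))
    have hε : (grMaps cA).counit (grVec e v) = 0 := by
      have h := LinearMap.congr_fun e.map_counit (grVec e v)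
      rw [LinearMap.comp_apply, LinearEquiv.coe_coe, equiv_grVec, symMaps_counit_symProj] at h
      rw [← h]
      simp [TensorAlgebra.algebraMapInv]
    rw [grMaps_counit, ← grMaps_counit_grι cA 0, hr, hone, map_smul, grMaps_counit_grι] at hε
    have hε1 : grCounit K A 0 (grQ K A 0 ⟨1, h1⟩) = 1 := hA.counit_one
    rw [hε1, smul_eq_mul, mul_one] at hε
    rw [hε, zero_smul] at hr
    exact grι_injective 0 (hr.trans (map_zero _).symm)
  | k + 2 =>
    rcases isInduced_induced_or_eq_zero (grQ K A (k + 2))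
      (Coalgebra.comul (R := K) ∘ₗ (coradFil K A (k + 2)).subtype)
      (DirectSum.toModule K (Finset.HasAntidiagonal.antidiagonal (k + 2)) (A ⊗[K] A) fun ij =>
        TensorProduct.map (coradFil K A ij.1.1).subtype (coradFil K A ij.1.2).subtype)
      (DirectSum.lmap fun ij : Finset.HasAntidiagonal.antidiagonal (k + 2) =>
        TensorProduct.map (grQ K A ij.1.1) (grQ K A ij.1.2)) with h | h
    · have hk : 1 + (k + 1) = k + 2 := by omega
      refine eq_zero_of_component_grComul (coradFil_mono hA e) k h _
        (Finset.HasAntidiagonal.mem_antidiagonal.2 hk) ?_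
      rw [← map_grπ_comul cA hk, comul_grVec, map_add, TensorProduct.map_tmul,
        TensorProduct.map_tmul, hone0 k.succ_ne_zero, hone0 one_ne_zero, TensorProduct.tmul_zero,
        TensorProduct.zero_tmul, add_zero]
    -- Default case: zero comultiplication on `gr^{k+2} A` makes the bidegree `(k + 2, 0)` part
    -- vanish. This part is the component tensor `1`, and the counit removes the `1`.
    · have h2 := map_grπ_comul cA (i := k + 2) (j := 0) rfl (grVec e v)
      rw [grComul, h, LinearMap.zero_apply, map_zero, comul_grVec, map_add, TensorProduct.map_tmul,
        TensorProduct.map_tmul, hone0 (m := k + 2) (by omega), TensorProduct.zero_tmul, add_zero, hone,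
        grπ_grι_self] at h2
      have h3 := congrArg (fun t => TensorProduct.rid K _ ((grCounit K A 0).lTensor _ t)) h2
      have hε1 : grCounit K A 0 (grQ K A 0 ⟨1, h1⟩) = 1 := hA.counit_one
      simpa only [LinearMap.lTensor_tmul, TensorProduct.rid_tmul, hε1, one_smul, map_zero] using h3

/-- The element of `gr^1 A` that corresponds to a vector. -/
def grVecOne : V →ₗ[K] GrPiece K A 1 := grπ K A 1 ∘ₗ grVec e

include hA in
theorem grι_grVecOne (v : V) : grι K A 1 (grVecOne e v) = grVec e v := by
  refine DirectSum.ext_component K fun m => ?_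
  by_cases hm : m = 1
  · subst hm
    exact grπ_grι_self 1 _
  · exact (grπ_grι_of_ne (Ne.symm hm) _).trans (grπ_grVec hA e v hm).symm

include hA in
theorem equiv_grι_grVecOne (v : V) :
    e.equiv (grι K A 1 (grVecOne e v)) = symProj c lam (TensorAlgebra.ι K v) := by
  rw [grι_grVecOne hA, equiv_grVec]

theorem equiv_mul (x y : Gr K A) :
    e.equiv ((grMaps cA).mul (x ⊗ₜ y)) = e.equiv x * e.equiv y :=
  LinearMap.congr_fun e.map_mul (x ⊗ₜ y)

include hA in
theorem grVecOne_injective : Function.Injective (grVecOne e) := by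
  intro v v' h
  apply symProj_ι_injective (c := c) (lam := lam)
  rw [LinearMap.comp_apply, LinearMap.comp_apply, ← equiv_grι_grVecOne hA e, h,
    equiv_grι_grVecOne hA e]

theorem grπ_mul_grι_one (x : GrPiece K A 1) (n : ℕ) (y : Gr K A) :
    grπ K A (1 + n) ((grMaps cA).mul (grι K A 1 x ⊗ₜ y)) = grMul K A 1 n (x ⊗ₜ grπ K A n y) := by
  refine directSum_induction (K := K) (p := fun y : Gr K A =>
    grπ K A (1 + n) ((grMaps cA).mul (grι K A 1 x ⊗ₜ y)) = grMul K A 1 n (x ⊗ₜ grπ K A n y)) y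
      ?_ (fun m z => ?_) ?_
  · simp
  · rw [show DirectSum.lof K ℕ (fun n => GrPiece K A n) m z = grι K A m z from rfl,
      grMaps_mul_grι]
    by_cases hm : m = n
    · subst hm
      rw [grπ_grι_self, grπ_grι_self]
    · rw [grπ_grι_of_ne hm, TensorProduct.tmul_zero, map_zero, grπ_grι_of_ne (by omega)]
  · intro x y hx hy
    rw [TensorProduct.tmul_add, map_add, map_add, map_add, TensorProduct.tmul_add, map_add, hx, hy]

include hA in
-- `S(V, c)` is spanned by words, and letters have degree one in `gr A`, so the degree `1 + n` part
-- of `v s` is `v` times the degree `n` part of `s`.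
theorem mem_range_grMul (n : ℕ) (x : GrPiece K A (1 + n)) :
    x ∈ LinearMap.range (grMul K A 1 n ∘ₗ (grVecOne e).rTensor (GrPiece K A n)) := by
  suffices ∀ t : TensorAlgebra K V, grπ K A (1 + n) (e.equiv.symm (symProj c lam t)) ∈
      LinearMap.range (grMul K A 1 n ∘ₗ (grVecOne e).rTensor (GrPiece K A n)) by
    obtain ⟨t, ht⟩ := symProj_surjective (e.equiv (grι K A (1 + n) x))
    have h := this t
    rwa [ht, LinearEquiv.symm_apply_apply, grπ_grι_self] at h
  intro t
  induction t using tensorAlgebra_induction_left with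
  | one =>
    obtain ⟨h1, hone⟩ := grMaps_one e
    have h : e.equiv.symm (symProj c lam 1) = (grMaps cA).one := by
      rw [LinearEquiv.symm_apply_eq, e.map_one]
      rfl
    rw [h, hone, grπ_grι_of_ne (by omega)]
    exact zero_mem _
  | smul r s hs => rw [map_smul, map_smul, map_smul]; exact Submodule.smul_mem _ r hs
  | add s t hs ht => rw [map_add, map_add, map_add]; exact add_mem hs ht
  | ι_mul v s hs =>
    have h : e.equiv.symm (symProj c lam (TensorAlgebra.ι K v * s)) =
        (grMaps cA).mul (grι K A 1 (grVecOne e v) ⊗ₜ e.equiv.symm (symProj c lam s)) := by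
      rw [LinearEquiv.symm_apply_eq, equiv_mul, equiv_grι_grVecOne hA, LinearEquiv.apply_symm_apply]
      rfl
    rw [h, grπ_mul_grι_one]
    exact ⟨v ⊗ₜ _, rfl⟩

include hA in
-- The case `n = 0` of `mem_range_grMul`, where `1 + 0` reduces to `1`, together with `gr^0 A =
-- K·1`.
theorem grVecOne_surjective : Function.Surjective (grVecOne e) := by
  intro x
  obtain ⟨z, hz⟩ := mem_range_grMul hA e 0 x
  rw [← LinearMap.mem_range, ← hz]
  clear hz
  induction z with
  | zero => rw [map_zero]; exact zero_mem _
  | add x y hx hy => rw [map_add]; exact add_mem hx hy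
  | tmul v y =>
    obtain ⟨r, hr⟩ := exists_smul_one hA e y
    refine ⟨r • v, grι_injective 1 (e.equiv.injective ?_)⟩
    rw [equiv_grι_grVecOne hA, LinearMap.comp_apply, LinearMap.rTensor_tmul]
    refine Eq.trans ?_ (congrArg e.equiv (grMaps_mul_grι cA 1 0 (grVecOne e v) y))
    rw [equiv_mul, equiv_grι_grVecOne hA, hr, map_smul e.equiv, e.map_one,
      map_smul (TensorAlgebra.ι K), map_smul (symProj c lam), mul_smul_comm]
    exact congrArg (r • ·) (mul_one _).symm

/-- The map from `gr^1 A` to the primitive elements. -/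
def grOneToPrim (hA : IsBraidedBialgebra cA) (h0 : coradFil K A 0 = K ∙ (1 : A)) :
    GrPiece K A 1 →ₗ[K] A :=
  ((coradPrev K A 1).submoduleOf (coradFil K A 1)).liftQ
    (reduce K A ∘ₗ (coradFil K A 1).subtype) (by
      intro x hx
      have hx' : (x : A) ∈ K ∙ (1 : A) := h0 ▸ (Submodule.mem_comap.1 hx : (x : A) ∈ coradFil K A 0)
      obtain ⟨r, hr⟩ := Submodule.mem_span_singleton.1 hx'
      rw [LinearMap.mem_ker, LinearMap.comp_apply, Submodule.subtype_apply, ← hr, map_smul,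
        reduce_apply, hA.counit_one, one_smul, sub_self, smul_zero])

theorem grOneToPrim_grQ (h0 : coradFil K A 0 = K ∙ (1 : A)) (a : coradFil K A 1) :
    grOneToPrim hA h0 (grQ K A 1 a) = reduce K A a := rfl

/-- The map from `V` to the primitive elements. -/
def primVec (hA : IsBraidedBialgebra cA) (e : (grMaps cA).Iso (symMaps hc hH)) : V →ₗ[K] A :=
  grOneToPrim hA (coradFil_zero hA e) ∘ₗ grVecOne e

theorem primVec_mem_prim (v : V) : primVec hA e v ∈ prim K A := by
  obtain ⟨a, ha⟩ := Submodule.mkQ_surjective _ (grVecOne e v)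
  rw [primVec, LinearMap.comp_apply, ← ha, grOneToPrim_grQ]
  exact reduce_mem_prim hA.comul_one hA.counit_one (coradFil_zero hA e) a.2

theorem primVec_mem_coradFil (v : V) : primVec hA e v ∈ coradFil K A 1 :=
  prim_le_coradFil_one hA.counit_one (coradFil_zero hA e) (primVec_mem_prim hA e v)

theorem grQ_primVec (v : V) :
    grQ K A 1 ⟨primVec hA e v, primVec_mem_coradFil hA e v⟩ = grVecOne e v := by
  obtain ⟨a, ha⟩ := Submodule.mkQ_surjective _ (grVecOne e v)
  rw [← ha, Submodule.mkQ_apply, Submodule.mkQ_apply, Submodule.Quotient.eq]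
  change primVec hA e v - a ∈ coradFil K A 0
  rw [primVec, LinearMap.comp_apply, ← ha, grOneToPrim_grQ, reduce_apply, sub_sub_cancel_left,
    coradFil_zero hA e]
  exact neg_mem (Submodule.smul_mem _ _ (Submodule.mem_span_singleton_self _))

theorem primVec_injective : Function.Injective (primVec hA e) := by
  intro v v' h
  apply grVecOne_injective hA e
  rw [← grQ_primVec hA e, ← grQ_primVec hA e]
  congr 1
  exact Subtype.ext h

theorem prim_le_range_primVec : prim K A ≤ LinearMap.range (primVec hA e) := by
  intro x hx
  obtain ⟨v, hv⟩ := grVecOne_surjective hA e (grQ K A 1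
    ⟨x, prim_le_coradFil_one hA.counit_one (coradFil_zero hA e) hx⟩)
  refine ⟨v, ?_⟩
  rw [primVec, LinearMap.comp_apply, hv, grOneToPrim_grQ, reduce_apply, counit_prim hA hx,
    zero_smul, sub_zero]

include hA in
-- `gr^1 A ⊗ gr^1 A` embeds in `S(V, c) ⊗ S(V, c)`, whose braiding is `c` on letters.
theorem braiding_grVecOne (z : V ⊗[K] V) :
    grBraiding cA 1 1 (TensorProduct.map (grVecOne e) (grVecOne e) z) =
      TensorProduct.map (grVecOne e) (grVecOne e) (c z) := by
  let f : GrPiece K A 1 →ₗ[K] BraidedSym c lam := e.equiv.toLinearMap ∘ₗ grι K A 1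
  have hf : Function.Injective f := e.equiv.injective.comp (grι_injective 1)
  have hff : Function.Injective (TensorProduct.map f f) :=
    TensorProduct.map_injective_of_flat_flat f f hf hf
  have hcomp : f ∘ₗ grVecOne e = symProj c lam ∘ₗ TensorAlgebra.ι K :=
    LinearMap.ext (equiv_grι_grVecOne hA e)
  have hmap : ∀ z, TensorProduct.map f f (TensorProduct.map (grVecOne e) (grVecOne e) z) =
      TensorProduct.map (symProj c lam) (symProj c lam)
        (TensorProduct.map (TensorAlgebra.ι K) (TensorAlgebra.ι K) z) := fun z => by
    rw [← LinearMap.comp_apply, ← TensorProduct.map_comp, hcomp, TensorProduct.map_comp,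
      LinearMap.comp_apply]
  have hfe : ∀ y, TensorProduct.map f f y = TensorProduct.map e.equiv.toLinearMap
      e.equiv.toLinearMap (TensorProduct.map (grι K A 1) (grι K A 1) y) := fun y => by
    rw [← LinearMap.comp_apply, ← TensorProduct.map_comp]
  apply hff
  rw [hmap, ← tensorBraiding_ι, ← symMaps_braiding_map hc hH, ← hmap, hfe, hfe,
    ← grMaps_braiding_grι]
  exact LinearMap.congr_fun e.map_braiding _

/-- `gr^1 A` determines the braiding of primitive elements only up to terms with a leg in `A_0`.
Applying `grOneToPrim` to both legs discards such terms, and `reduce_braid` says that there are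
none. -/
theorem braiding_primVec (hlam : lam ≠ 0) (z : V ⊗[K] V) :
    cA (TensorProduct.map (primVec hA e) (primVec hA e) z) =
      TensorProduct.map (primVec hA e) (primVec hA e) (c z) := by
  rcases isInduced_induced_or_eq_zero (TensorProduct.map (grQ K A 1) (grQ K A 1))
    (cA ∘ₗ TensorProduct.map (coradFil K A 1).subtype (coradFil K A 1).subtype)
    (TensorProduct.map (coradFil K A 1).subtype (coradFil K A 1).subtype)
    (TensorProduct.map (grQ K A 1) (grQ K A 1)) with h | h
  · let j' : V →ₗ[K] coradFil K A 1 :=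
      (primVec hA e).codRestrict _ (primVec_mem_coradFil hA e)
    have hj' : (coradFil K A 1).subtype ∘ₗ j' = primVec hA e := rfl
    have hqj' : grQ K A 1 ∘ₗ j' = grVecOne e := LinearMap.ext (grQ_primVec hA e)
    obtain ⟨u, hu, hg⟩ := h (TensorProduct.map j' j' z)
    rw [LinearMap.comp_apply, ← LinearMap.comp_apply (TensorProduct.map _ _)
      (TensorProduct.map j' j'), ← TensorProduct.map_comp, hj'] at hu
    rw [← LinearMap.comp_apply (TensorProduct.map _ _) (TensorProduct.map j' j'),
      ← TensorProduct.map_comp, hqj'] at hg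
    have hb := braiding_grVecOne hA e z
    rw [grBraiding, hg] at hb
    have hr : grOneToPrim hA (coradFil_zero hA e) ∘ₗ grQ K A 1 =
        reduce K A ∘ₗ (coradFil K A 1).subtype := rfl
    have h2 := congrArg (TensorProduct.map (grOneToPrim hA (coradFil_zero hA e))
      (grOneToPrim hA (coradFil_zero hA e))) hb
    rw [← LinearMap.comp_apply, ← TensorProduct.map_comp, ← LinearMap.comp_apply,
      ← TensorProduct.map_comp, hr, TensorProduct.map_comp, LinearMap.comp_apply, hu,
      reduce_braid hA _ fun v => counit_prim hA (primVec_mem_prim hA e v)] at h2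
    exact h2
  -- Default case: `c` vanishes, and the Hecke relation leaves `lam z = 0`.
  · have hzero : ∀ z, c z = 0 := by
      intro z
      have hb := braiding_grVecOne hA e z
      rw [grBraiding, h, LinearMap.zero_apply] at hb
      exact TensorProduct.map_injective_of_flat_flat _ _ (grVecOne_injective hA e)
        (grVecOne_injective hA e) (hb.symm.trans (map_zero _).symm)
    have hz : z = 0 := by
      have := hH.apply_apply z
      rw [hzero, hzero, smul_zero, zero_add] at this
      exact (smul_eq_zero.1 this.symm).resolve_left hlam
    rw [hz, map_zero, map_zero, map_zero, map_zero]

theorem exists_grMul (n : ℕ) (v : V) (a : coradFil K A n) :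
    ∃ b : coradFil K A (1 + n), (b : A) = primVec hA e v * a ∧
      grQ K A (1 + n) b = grMul K A 1 n (grVecOne e v ⊗ₜ grQ K A n a) := by
  rcases isInduced_induced_or_eq_zero (TensorProduct.map (grQ K A 1) (grQ K A n))
    (LinearMap.mul' K A ∘ₗ TensorProduct.map (coradFil K A 1).subtype (coradFil K A n).subtype)
    (coradFil K A (1 + n)).subtype (grQ K A (1 + n)) with h | h
  · obtain ⟨b, hb, hg⟩ := h (⟨primVec hA e v, primVec_mem_coradFil hA e v⟩ ⊗ₜ a)
    rw [TensorProduct.map_tmul, grQ_primVec] at hg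
    exact ⟨b, hb, hg.symm⟩
  -- Default case: products with `V` fill `gr^{1+n} A`, so it is zero and the equation of classes is
  -- automatic. Only the filtration degree of the product remains, and primitivity provides it.
  · have hsub : ∀ x : GrPiece K A (1 + n), x = 0 := fun x => by
      obtain ⟨z, rfl⟩ := mem_range_grMul hA e n x
      rw [LinearMap.comp_apply, grMul, h, LinearMap.zero_apply]
    refine ⟨⟨primVec hA e v * a, ?_⟩, rfl, (hsub _).trans (hsub _).symm⟩
    rw [add_comm]
    exact prim_mul_mem_coradFil hA (coradFil_zero hA e) (primVec_mem_prim hA e v) n a.2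

/-- `gr A` is generated in degree one: if `a` represents `y`, then `primVec v * a` represents the
product of `v` and `y`, and it is also the value of the morphism there. -/
theorem symLift_graded
    (hrel : ∀ z, LinearMap.mul' K A (TensorProduct.map (primVec hA e) (primVec hA e)
      (c z - lam • z)) = 0) (n : ℕ) (x : GrPiece K A n) :
    ∃ a : coradFil K A n, symLift (primVec hA e) lam hrel (e.equiv (grι K A n x)) = a ∧
      grQ K A n a = x := by
  induction n with
  | zero =>
    obtain ⟨h1, hone⟩ := grMaps_one e
    obtain ⟨r, hr⟩ := exists_smul_one hA e x
    refine ⟨r • ⟨1, h1⟩, ?_, ?_⟩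
    · rw [hr, map_smul, e.map_one, map_smul]
      exact congrArg (r • ·) (map_one (symLift (primVec hA e) lam hrel))
    · apply grι_injective 0
      rw [hr, map_smul, map_smul, hone]
  | succ n ih =>
    suffices ∀ x : GrPiece K A (1 + n), ∃ a : coradFil K A (1 + n),
        symLift (primVec hA e) lam hrel (e.equiv (grι K A (1 + n) x)) = a ∧
          grQ K A (1 + n) a = x by
      revert x
      rw [add_comm 1 n] at this
      exact this
    intro x
    obtain ⟨z, rfl⟩ := mem_range_grMul hA e n x
    induction z with
    | zero => exact ⟨0, by simp, by simp⟩
    | add x y hx hy =>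
      obtain ⟨a, ha, haq⟩ := hx
      obtain ⟨b, hb, hbq⟩ := hy
      exact ⟨a + b, by rw [map_add, map_add, map_add, map_add, ha, hb]; rfl,
        by rw [map_add, haq, hbq, map_add]⟩
    | tmul v y =>
      obtain ⟨a, ha, rfl⟩ := ih y
      obtain ⟨b, hb, hbq⟩ := exists_grMul hA e n v a
      refine ⟨b, ?_, hbq⟩
      rw [LinearMap.comp_apply, LinearMap.rTensor_tmul, ← grMaps_mul_grι cA, equiv_mul, map_mul,
        ha, hb, equiv_grι_grVecOne hA, symLift_symProj, TensorAlgebra.lift_ι_apply]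

end Generators

end Braided

end

theorem mainTheorem5 {K : Type*} [Field K] (hK : ringChar K ≠ 2)
    {V : Type*} [AddCommGroup V] [Module K V]
    (c : V ⊗[K] V →ₗ[K] V ⊗[K] V) (hc : Braided.IsBraiding c)
    (lam : K) (hH : Braided.IsHecke c lam) (hreg : Braided.IsRegularMark lam) (hlam : lam ≠ 1)
    {A : Type*} [Ring A] [Algebra K A] [Coalgebra K A]
    (cA : A ⊗[K] A →ₗ[K] A ⊗[K] A) (hA : Braided.IsBraidedBialgebra cA)
    (hgr : Nonempty ((Braided.grMaps cA).Iso (Braided.symMaps hc hH))) :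
    Nonempty ((Braided.structureMaps cA).Iso (Braided.symMaps hc hH)) := by
  obtain ⟨e⟩ := hgr
  have hj := Braided.primVec_mem_prim hA e
  have hjc := Braided.braiding_primVec hA e hreg.1
  have hrel := Braided.mul_rel_eq_zero hK hc hH hreg hlam hA (Braided.primVec hA e)
    (Braided.primVec_injective hA e) hj (Braided.prim_le_range_primVec hA e) hjc
  have h0 := Braided.coradFil_zero hA e
  -- The composite `gr A → S(V, c) → A` lifts every class, so it is bijective; cancelling `e` gives
  -- the bijectivity of the second map.
  have hbij : Function.Bijective
      ((Braided.symLift (Braided.primVec hA e) lam hrel).toLinearMap ∘ₗ e.equiv.toLinearMap) :=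
    Braided.bijective_of_graded (Braided.coradFil_mono hA e)
      (Braided.exists_mem_coradFil hA.comul_one hA.counit_one h0)
      (Braided.symLift_graded hA e hrel)
  exact ⟨(Braided.symIso (Braided.primVec hA e) hc hH hA hj hjc hrel
    ((Function.Bijective.of_comp_iff _ e.equiv.bijective).1 hbij)).symm⟩
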